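/- Let $F$ be an algebraically closed field, let $X$ be a complete nonsingular algebraic curve over $F$ (an integral proper $F$-scheme of dimension one all of whose local rings are regular), and let $S$ be a finite nonempty set of closed points of $X$. For each $s\in S$ choose a uniformizer $\pi_s$ of the local ring $\mathcal O_{X,s}$, i.e. a generator of its maximal ideal; for a meromorphic function $f=\sum_i a_i\pi_s^i$ ($a_i\in F$) on $X$ let $f^{(s)}=\sum_i a_it^i\in F((t))$ be its Laurent expansion at $s$. Let $k$ be an artinian local ring with maximal ideal $m$ that is a finite $F$-algebra, and put $R=H^0(X\setminus S,\mathcal O_X)\otimes_F k$, mapped to $k((t))^S$ by $f\otimes c\mapsto (c\,f^{(s)})_{s\in S}$. For $f\in R$ let $f_s\in k((t))$ be the component of its image at $s$. Each $f\in k((t))^\times$ can be written (in exactly one way) as $$f=t^{w(f)}\cdot a_0\cdot\prod_{i=1}^\infty(1-a_{-i}t^{-i})\cdot\prod_{i=1}^\infty(1-a_it^i)$$ with $w(f)\in\mathbb Z$, $a_0\in k^\times$, $a_i\in k$ and $a_{-i}\in m$ for $i>0$, and $a_{-i}=0$ for $i\gg0$. If $g\in k((t))^\times$ is written in the same way with $w(g)$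 and $(b_j)$, the Contou-Carrère symbol of $f$ and $g$ is $$\langle f,g\rangle=(-1)^{w(f)w(g)}\,\frac{a_0^{w(g)}}{b_0^{w(f)}}\cdot\frac{\prod_{i=1}^\infty\prod_{j=1}^\infty\bigl(1-a_i^{j/(i,j)}b_{-j}^{i/(i,j)}\bigr)^{(i,j)}}{\prod_{i=1}^\infty\prod_{j=1}^\infty\bigl(1-a_{-i}^{j/(i,j)}b_j^{i/(i,j)}\bigr)^{(i,j)}}\in k^\times,$$ where $(i,j)$ is the greatest common divisor and all but finitely many factors equal $1$. Then for all $f,g\in R^\times$, $$\prod_{s\in S}\langle f_s,g_s\rangle=1.$$ -/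

import Mathlib

open scoped LaurentSeries PowerSeries TensorProduct Polynomial
universe u v
namespace ContouCarrere
section WittParameters
variable {k : Type v} [CommRing k]

/-- The power series `∏_{i ≥ 1} (1 - aᵢ tⁱ)`.  Its `n`-th coefficient is that of the partial
product over `1 ≤ i ≤ n`, since the other factors do not change it. -/
noncomputable def prodSeries (a : ℕ → k) : k⟦X⟧ :=
  PowerSeries.mk fun n =>
    PowerSeries.coeff n (∏ i ∈ Finset.Icc 1 n, (1 - PowerSeries.C (a i) * PowerSeries.X ^ i))

/-- The partial product `∏_{1 ≤ i ≤ n} (1 - aᵢ tⁱ)`. -/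
noncomputable def partialProd (a : ℕ → k) (n : ℕ) : k[X] :=
  ∏ i ∈ Finset.Icc 1 n, (1 - Polynomial.C (a i) * Polynomial.X ^ i)

lemma coeff_prodSeries (a : ℕ → k) (n : ℕ) :
    PowerSeries.coeff n (prodSeries a) = (partialProd a n).coeff n := by
  have : ((partialProd a n : k[X]) : k⟦X⟧) =
      ∏ i ∈ Finset.Icc 1 n, (1 - PowerSeries.C (a i) * PowerSeries.X ^ i) := by
    rw [partialProd, ← Polynomial.coeToPowerSeries.ringHom_apply, map_prod]
    simp
  rw [prodSeries, PowerSeries.coeff_mk, ← this, Polynomial.coeff_coe]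

lemma partialProd_succ (a : ℕ → k) (n : ℕ) : partialProd a (n + 1) =
    partialProd a n * (1 - Polynomial.C (a (n + 1)) * Polynomial.X ^ (n + 1)) := by
  rw [partialProd, Finset.prod_Icc_succ_top (by omega)]; rfl

lemma coeff_zero_partialProd (a : ℕ → k) (n : ℕ) : (partialProd a n).coeff 0 = 1 := by
  induction n with
  | zero => simp [partialProd]
  | succ n ih => rw [partialProd_succ, Polynomial.mul_coeff_zero, ih]; simp

lemma coeff_partialProd_succ (a : ℕ → k) (n j : ℕ) (h : j ≤ n) :
    (partialProd a (n + 1)).coeff j = (partialProd a n).coeff j := by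
  rw [partialProd_succ, mul_sub, mul_one, ← mul_assoc, Polynomial.coeff_sub,
    Polynomial.coeff_mul_X_pow', if_neg (by omega), sub_zero]

lemma coeff_partialProd_succ_self (a : ℕ → k) (n : ℕ) :
    (partialProd a (n + 1)).coeff (n + 1) = (partialProd a n).coeff (n + 1) - a (n + 1) := by
  rw [partialProd_succ, mul_sub, mul_one, ← mul_assoc, Polynomial.coeff_sub,
    Polynomial.coeff_mul_X_pow', if_pos le_rfl, Nat.sub_self, Polynomial.coeff_mul_C,
    coeff_zero_partialProd, one_mul]

lemma coeff_prodSeries_of_le (a : ℕ → k) {n j : ℕ} (h : j ≤ n) :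
    PowerSeries.coeff j (prodSeries a) = (partialProd a n).coeff j := by
  induction n, h using Nat.le_induction with
  | base => exact coeff_prodSeries a j
  | succ n hn ih => rw [ih, coeff_partialProd_succ a n j hn]

lemma exists_prodSeries_eq (P : k⟦X⟧) (hP : PowerSeries.constantCoeff P = 1) :
    ∃ a : ℕ → k, prodSeries a = P := by
  let p : ℕ → k[X] := fun n => Nat.rec 1 (fun n q => q * (1 - Polynomial.C
    (q.coeff (n + 1) - PowerSeries.coeff (n + 1) P) * Polynomial.X ^ (n + 1))) n
  let a : ℕ → k := fun n => (p (n - 1)).coeff n - PowerSeries.coeff n P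
  have hp : ∀ n, partialProd a n = p n := by
    intro n
    induction n with
    | zero => simp [partialProd, p]
    | succ n ih => rw [partialProd_succ, ih]; rfl
  refine ⟨a, ?_⟩
  ext n
  rw [coeff_prodSeries]
  cases n with
  | zero => rw [coeff_zero_partialProd]; simpa using hP.symm
  | succ n =>
    rw [coeff_partialProd_succ_self, hp]
    simp [a]

lemma coeff_partialProd_mem {I J : Ideal k} (hIJ : I * I ≤ J) (hJI : J ≤ I) (a : ℕ → k)
    (ha : ∀ i, 1 ≤ i → a i ∈ I) (n j : ℕ) (hj : 1 ≤ j) :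
    (j ≤ n → (partialProd a n).coeff j + a j ∈ J) ∧
      (n < j → (partialProd a n).coeff j ∈ J) := by
  induction n generalizing j with
  | zero =>
    refine ⟨fun h => by omega, fun _ => ?_⟩
    rw [show partialProd a 0 = 1 by simp [partialProd], Polynomial.coeff_one,
      if_neg (by omega)]
    exact J.zero_mem
  | succ n ih =>
    refine ⟨fun h => ?_, fun h => ?_⟩
    · rcases Nat.lt_or_ge n j with h' | h'
      · obtain rfl : j = n + 1 := by omega
        rw [coeff_partialProd_succ_self, sub_add_cancel]
        exact (ih _ hj).2 h'
      · rw [coeff_partialProd_succ a n j h']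
        exact (ih _ hj).1 h'
    · have hI : ∀ i, 1 ≤ i → (partialProd a n).coeff i ∈ I := by
        intro i hi
        rcases Nat.lt_or_ge n i with h' | h'
        · exact hJI ((ih i hi).2 h')
        · have := I.sub_mem (hJI ((ih i hi).1 h')) (ha i hi)
          simpa using this
      rw [partialProd_succ, mul_sub, mul_one, ← mul_assoc, Polynomial.coeff_sub,
        Polynomial.coeff_mul_X_pow', if_pos (by omega), Polynomial.coeff_mul_C]
      exact J.sub_mem ((ih j hj).2 (by omega))
        (hIJ (Ideal.mul_mem_mul (hI _ (by omega)) (ha _ (by omega))))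

lemma prodSeries_split (a : ℕ → k) (N : ℕ) : prodSeries a =
    (partialProd a N : k[X]) * prodSeries (fun i => if i ≤ N then 0 else a i) := by
  set a' : ℕ → k := fun i => if i ≤ N then 0 else a i with ha'
  have h1 : partialProd a' N = 1 := by
    refine Finset.prod_eq_one fun i hi => ?_
    simp [ha', (Finset.mem_Icc.mp hi).2]
  have h : ∀ n, N ≤ n → partialProd a n = partialProd a N * partialProd a' n := by
    intro n hn
    induction n, hn using Nat.le_induction with
    | base => rw [h1, mul_one]
    | succ n hn ih =>
      rw [partialProd_succ, partialProd_succ, ih, mul_assoc]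
      simp [ha', show ¬ (n + 1 ≤ N) by omega]
  ext j
  rw [coeff_prodSeries_of_le a (le_max_left j N), h _ (le_max_right j N), PowerSeries.coeff_mul,
    Polynomial.coeff_mul]
  refine Finset.sum_congr rfl fun x hx => ?_
  have : x.2 ≤ j := by have := Finset.HasAntidiagonal.mem_antidiagonal.mp hx; omega
  rw [coeff_prodSeries_of_le a' (this.trans (le_max_left j N)), Polynomial.coeff_coe]

lemma isUnit_partialProd (a : ℕ → k) (ha : ∀ i, 1 ≤ i → IsNilpotent (a i)) (n : ℕ) :
    IsUnit (partialProd a n) := by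
  induction n with
  | zero => simp [partialProd]
  | succ n ih =>
    rw [partialProd_succ]
    refine ih.mul (IsNilpotent.isUnit_one_sub ?_)
    exact Commute.isNilpotent_mul_right (Commute.all _ _)
      (by simpa using (ha (n + 1) (by omega)).map Polynomial.C)

/-- A polynomial with constant term `1` and the other coefficients in a nilpotent ideal is a
finite product of factors `1 - aᵢ tⁱ` with `aᵢ` in that ideal. -/
lemma exists_partialProd_eq {I : Ideal k} (hI : IsNilpotent I) (q : k[X]) (h0 : q.coeff 0 = 1)
    (hq : ∀ i, 1 ≤ i → q.coeff i ∈ I) :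
    ∃ (a : ℕ → k) (N : ℕ), (∀ i, 1 ≤ i → a i ∈ I) ∧ (∀ i, N < i → a i = 0) ∧
      partialProd a N = q := by
  obtain ⟨a, ha⟩ := exists_prodSeries_eq (q : k⟦X⟧) (by simpa using h0)
  have hc : ∀ j, (partialProd a j).coeff j = q.coeff j := fun j => by
    rw [← coeff_prodSeries, ha, Polynomial.coeff_coe]
  have haI : ∀ i, 1 ≤ i → a i ∈ I := by
    intro i
    induction i using Nat.strong_induction_on with
    | _ i ih =>
      intro hi
      let b : ℕ → k := fun l => if l < i then a l else 0
      have hb : ∀ n, n < i → partialProd a n = partialProd b n := by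
        intro n hn
        refine Finset.prod_congr rfl fun l hl => ?_
        simp [b, show l < i by have := (Finset.mem_Icc.mp hl).2; omega]
      obtain ⟨n, rfl⟩ : ∃ n, i = n + 1 := ⟨i - 1, by omega⟩
      have h1 := hc (n + 1)
      rw [coeff_partialProd_succ_self, hb n (by omega)] at h1
      have h2 := (coeff_partialProd_mem (Ideal.mul_le_right : I * I ≤ I) le_rfl b (by
        intro l hl
        change (if l < n + 1 then a l else 0) ∈ I
        split_ifs with h
        · exact ih l h hl
        · exact I.zero_mem) n (n + 1) (by omega)).2 (by omega)
      have h3 := I.sub_mem h2 (hq (n + 1) hi)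
      rw [← h1] at h3
      simpa using h3
  have hnil : ∀ i, 1 ≤ i → IsNilpotent (a i) := by
    intro i hi
    obtain ⟨n, hn⟩ := hI
    refine ⟨n, ?_⟩
    have := Ideal.pow_mem_pow (haI i hi) n
    rwa [hn] at this
  have hfin : ∀ r, ∃ N, ∀ i, N < i → a i ∈ I ^ (r + 1) := by
    intro r
    induction r with
    | zero => exact ⟨0, fun i hi => by simpa using haI i hi⟩
    | succ r ih =>
      obtain ⟨N, hN⟩ := ih
      obtain ⟨u, hu⟩ := isUnit_partialProd a hnil N
      have hs := prodSeries_split a N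
      set a' : ℕ → k := fun i => if i ≤ N then 0 else a i with ha'
      have hQ : prodSeries a' = ((((u⁻¹ : (k[X])ˣ) : k[X]) * q : k[X]) : k⟦X⟧) := by
        rw [Polynomial.coe_mul, ← ha, hs, ← mul_assoc, ← Polynomial.coe_mul, ← hu]
        simp
      refine ⟨max N (((u⁻¹ : (k[X])ˣ) : k[X]) * q).natDegree, fun i hi => ?_⟩
      have hiN : N < i := lt_of_le_of_lt (le_max_left _ _) hi
      have h1 : (partialProd a' i).coeff i = 0 := by
        rw [← coeff_prodSeries, hQ, Polynomial.coeff_coe]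
        exact Polynomial.coeff_eq_zero_of_natDegree_lt (lt_of_le_of_lt (le_max_right _ _) hi)
      have h2 := (coeff_partialProd_mem (I := I ^ (r + 1)) (J := I ^ (r + 1 + 1))
        (by rw [← pow_add]; exact Ideal.pow_le_pow_right (by omega))
        (Ideal.pow_le_pow_right (by omega)) a' (by
          intro l hl
          by_cases h : l ≤ N
          · simp [a', h]
          · simpa [a', h] using hN l (by omega)) i i (by omega)).1 le_rfl
      rw [h1, zero_add] at h2
      simpa [a', show ¬ i ≤ N by omega] using h2
  obtain ⟨R, hR⟩ := hI
  obtain ⟨N, hN⟩ := hfin R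
  have hN' : ∀ i, N < i → a i = 0 := by
    intro i hi
    have := hN i hi
    rw [pow_succ, hR, zero_mul] at this
    simpa using this
  refine ⟨a, N, haI, hN', ?_⟩
  have hs := prodSeries_split a N
  have : prodSeries (fun i => if i ≤ N then 0 else a i) = 1 := by
    have h0 : (fun i => if i ≤ N then 0 else a i) = fun _ => (0 : k) := by
      funext i
      by_cases h : i ≤ N
      · simp [h]
      · simp [h, hN' i (by omega)]
    rw [h0]
    ext n
    simp [prodSeries]
  rw [this, mul_one, ha] at hs
  exact (Polynomial.coe_injective k hs).symm

/-- The ring homomorphism `A((t)) → B((t))` induced by `A → B` on coefficients. -/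
noncomputable def mapLaurent {A B : Type*} [CommRing A] [CommRing B] (φ : A →+* B) :
    A⸨X⸩ →+* B⸨X⸩ where
  toFun f := HahnSeries.map f φ
  map_one' := by ext n; by_cases h : n = 0 <;> simp [HahnSeries.coeff_one, h]
  map_mul' x y := HahnSeries.map_mul (φ : A →ₙ+* B)
  map_zero' := by ext; simp
  map_add' x y := by ext; simp

@[simp]
lemma mapLaurent_coeff {A B : Type*} [CommRing A] [CommRing B] (φ : A →+* B) (f : A⸨X⸩) (n : ℤ) :
    (mapLaurent φ f).coeff n = φ (f.coeff n) := rfl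

variable (k) in
/-- A winding number `w` and a family `(aᵢ)`, indexed by the integers, with `a₀` a unit,
`aᵢ` in the maximal ideal for `i < 0`, and `aᵢ = 0` for `i ≪ 0`. -/
structure WittParameters [IsLocalRing k] where
  winding : ℤ
  param : ℤ → k
  isUnit_zero : IsUnit (param 0)
  mem_of_neg : ∀ i < 0, param i ∈ IsLocalRing.maximalIdeal k
  eventually_zero : ∃ N : ℤ, ∀ i < N, param i = 0

/-- The Laurent series `t ^ w · a₀ · ∏_{i ≥ 1} (1 - a₋ᵢ t⁻ⁱ) · ∏_{i ≥ 1} (1 - aᵢ tⁱ)`.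
All but finitely many factors of the first product are `1`. -/
noncomputable def WittParameters.toLaurentSeries [IsLocalRing k] (a : WittParameters k) : k⸨X⸩ :=
  HahnSeries.single a.winding (a.param 0) *
    (∏ᶠ i : ℕ+, (1 - HahnSeries.single (-(i : ℤ)) (a.param (-(i : ℤ))))) *
    HahnSeries.ofPowerSeries ℤ k (prodSeries fun i => a.param (i : ℤ))

lemma map_residue_powerSeriesPart_ne_zero [IsLocalRing k] (f : (k⸨X⸩)ˣ) :
    (f : k⸨X⸩).powerSeriesPart.map (IsLocalRing.residue k) ≠ 0 := by
  intro h
  have h0 : mapLaurent (IsLocalRing.residue k) (f : k⸨X⸩) = 0 := by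
    ext n
    rw [mapLaurent_coeff]
    rcases lt_or_ge n (f : k⸨X⸩).order with hn | hn
    · rw [HahnSeries.coeff_eq_zero_of_lt_order hn]; simp
    · obtain ⟨m, rfl⟩ := Int.le.dest hn
      have := congrArg (PowerSeries.coeff m) h
      rw [PowerSeries.coeff_map, LaurentSeries.powerSeriesPart_coeff] at this
      rw [this]; simp
  have := (f.isUnit.map (mapLaurent (IsLocalRing.residue k))).ne_zero
  exact this h0

lemma isAdicComplete_of_isNilpotent {I : Ideal k} (hI : IsNilpotent I) : IsAdicComplete I k := by
  obtain ⟨n, hn⟩ := hI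
  have hz : ∀ m, n ≤ m → (I ^ m • ⊤ : Submodule k k) = ⊥ := by
    intro m hm
    have : I ^ m = ⊥ := by
      rw [eq_bot_iff]; exact (Ideal.pow_le_pow_right hm).trans (by rw [hn]; rfl)
    rw [this]; simp
  have h1 : IsHausdorff I k := ⟨fun x hx => by
    have := hx n
    rw [hz n le_rfl, SModEq.bot] at this
    exact this⟩
  have h2 : IsPrecomplete I k := ⟨fun f hf => ⟨f n, fun m => by
    rcases le_total m n with h | h
    · exact hf h
    · have := hf h
      rw [hz n le_rfl, SModEq.bot] at this
      rw [this]⟩⟩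
  exact { }

/-- Every unit of `k((t))` has Witt parameters. -/
theorem exists_wittParameters [IsLocalRing k] [IsArtinianRing k] (f : (k⸨X⸩)ˣ) :
    ∃ a : WittParameters k, a.toLaurentSeries = f := by
  have hm : IsNilpotent (IsLocalRing.maximalIdeal k) :=
    IsLocalRing.jacobson_eq_maximalIdeal (⊥ : Ideal k) bot_ne_top ▸
      IsArtinianRing.isNilpotent_jacobson_bot
  have := isAdicComplete_of_isNilpotent hm
  obtain ⟨g, h, H⟩ := PowerSeries.exists_isWeierstrassFactorization
    (map_residue_powerSeriesPart_ne_zero f)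
  have hmon : g.Monic := H.isDistinguishedAt.monic
  obtain ⟨u, hu⟩ := H.isUnit.map (PowerSeries.constantCoeff (R := k))
  obtain ⟨b, hb⟩ := exists_prodSeries_eq (PowerSeries.C ((u⁻¹ : kˣ) : k) * h)
    (by rw [map_mul, ← hu]; simp)
  obtain ⟨c, N, hc, hcN, hcg⟩ := exists_partialProd_eq hm g.reverse
    (by rw [Polynomial.coeff_zero_reverse]; exact hmon) (by
      intro i hi
      rcases lt_or_ge g.natDegree i with h' | h'
      · rw [Polynomial.coeff_eq_zero_of_natDegree_lt
          (lt_of_le_of_lt (Polynomial.reverse_natDegree_le g) h')]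
        exact Ideal.zero_mem _
      · rw [Polynomial.coeff_reverse, Polynomial.revAt_le h']
        exact H.isDistinguishedAt.mem (by omega))
  let p : ℤ → k := fun i => if i < 0 then c i.natAbs else if i = 0 then u else b i.natAbs
  refine ⟨⟨(f : k⸨X⸩).order + g.natDegree, p, by simp [p], fun i hi => ?_, -N, fun i hi => ?_⟩, ?_⟩
  · simpa [p, hi] using hc i.natAbs (by omega)
  · have : i < 0 := by omega
    simpa [p, this] using hcN i.natAbs (by omega)
  · rw [WittParameters.toLaurentSeries]
    have e1 : prodSeries (fun i : ℕ => p (i : ℤ)) = PowerSeries.C ((u⁻¹ : kˣ) : k) * h := by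
      rw [← hb, prodSeries, prodSeries]
      congr 1
      funext n
      congr 1
      refine Finset.prod_congr rfl fun i hi => ?_
      have : i ≠ 0 := by have := (Finset.mem_Icc.mp hi).1; omega
      have h2 : ¬ ((i : ℤ) < 0) := by omega
      simp only [p, if_neg h2, Int.natCast_eq_zero, if_neg this, Int.natAbs_natCast]
    have e2 : (∏ᶠ i : ℕ+, (1 - HahnSeries.single (-(i : ℤ)) (p (-(i : ℤ)))) : k⸨X⸩) =
        Polynomial.eval₂ (HahnSeries.C : k →+* k⸨X⸩) (HahnSeries.single (-1) 1) g.reverse := by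
      rw [← hcg, partialProd, Polynomial.eval₂_finsetProd,
        finprod_eq_prod_of_mulSupport_subset (α := ℕ+) _
          (s := (Finset.Icc 1 N).subtype (0 < ·))]
      · refine Finset.prod_bij (fun i _ => (i : ℕ)) (fun i hi => Finset.mem_subtype.mp hi)
          (fun i _ j _ h => PNat.eq h)
          (fun n hn => ⟨⟨n, (Finset.mem_Icc.mp hn).1⟩, Finset.mem_subtype.mpr hn, rfl⟩)
          fun i _ => ?_
        have hi : -((i : ℕ) : ℤ) < 0 := neg_neg_of_pos (by exact_mod_cast i.2)
        have h1 : p (-((i : ℕ) : ℤ)) = c i := by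
          simp only [p, if_pos hi, Int.natAbs_neg, Int.natAbs_natCast]
        change (1 - HahnSeries.single (-((i : ℕ) : ℤ)) (p (-((i : ℕ) : ℤ))) : k⸨X⸩) = _
        rw [h1, Polynomial.eval₂_sub, Polynomial.eval₂_one, Polynomial.eval₂_mul,
          Polynomial.eval₂_C, Polynomial.eval₂_pow, Polynomial.eval₂_X, HahnSeries.single_pow,
          HahnSeries.C_apply, HahnSeries.single_mul_single]
        simp
      · intro i hi
        rw [Function.mem_mulSupport] at hi
        have hi0 := i.2
        refine Finset.mem_coe.mpr (Finset.mem_subtype.mpr (Finset.mem_Icc.mpr ⟨hi0, ?_⟩))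
        by_contra hN
        apply hi
        have h0 : -((i : ℕ) : ℤ) < 0 := neg_neg_of_pos (by exact_mod_cast i.2)
        have h1 : p (-((i : ℕ) : ℤ)) = 0 := by
          simp only [p, if_pos h0, Int.natAbs_neg, Int.natAbs_natCast]
          exact hcN _ (Nat.lt_of_not_le hN)
        rw [h1]; simp
    have e3 : HahnSeries.ofPowerSeries ℤ k (g : k⟦X⟧) =
        Polynomial.eval₂ (HahnSeries.C : k →+* k⸨X⸩) (HahnSeries.single 1 1) g := by
      change ((HahnSeries.ofPowerSeries ℤ k).comp Polynomial.coeToPowerSeries.ringHom) g =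
        Polynomial.eval₂RingHom (HahnSeries.C : k →+* k⸨X⸩) (HahnSeries.single 1 1) g
      congr 1
      apply Polynomial.ringHom_ext'
      · ext x; simp
      · simp
    have hs : ∀ m : ℕ, (HahnSeries.single (m : ℤ) (1 : k) : k⸨X⸩) = HahnSeries.single 1 1 ^ m := by
      intro m; rw [HahnSeries.single_pow]; simp
    let _ : Invertible (HahnSeries.single 1 1 : k⸨X⸩) :=
      ⟨HahnSeries.single (-1) 1, by simp [HahnSeries.single_mul_single],
        by simp [HahnSeries.single_mul_single]⟩
    have e4 := Polynomial.eval₂_reverse_mul_pow (HahnSeries.C : k →+* k⸨X⸩)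
      (HahnSeries.single 1 1) g
    rw [← e3, ← hs] at e4
    change Polynomial.eval₂ _ (HahnSeries.single (-1) 1) _ * _ = _ at e4
    change HahnSeries.single ((f : k⸨X⸩).order + g.natDegree) (p 0) *
      (∏ᶠ i : ℕ+, (1 - HahnSeries.single (-(i : ℤ)) (p (-(i : ℤ))))) *
      HahnSeries.ofPowerSeries ℤ k (prodSeries fun i : ℕ => p (i : ℤ)) = f
    have e5 : (HahnSeries.single ((f : k⸨X⸩).order + g.natDegree) (p 0) : k⸨X⸩) =
        HahnSeries.C (u : k) * (HahnSeries.single (f : k⸨X⸩).order 1 *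
          HahnSeries.single (g.natDegree : ℤ) 1) := by
      rw [HahnSeries.single_mul_single, HahnSeries.C_apply, HahnSeries.single_mul_single]
      simp [p]
    have e6 : (HahnSeries.C (u : k) : k⸨X⸩) * HahnSeries.C ((u⁻¹ : kˣ) : k) = 1 := by
      rw [← map_mul]; simp
    conv_rhs => rw [← LaurentSeries.single_order_mul_powerSeriesPart (f : k⸨X⸩), H.eq_mul,
      map_mul, ← e4]
    rw [e1, e2, e5, map_mul, HahnSeries.ofPowerSeries_C]
    linear_combination (HahnSeries.single (f : k⸨X⸩).order 1 *
          HahnSeries.single (g.natDegree : ℤ) 1 *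
          Polynomial.eval₂ (HahnSeries.C : k →+* k⸨X⸩) (HahnSeries.single (-1) 1) g.reverse *
          HahnSeries.ofPowerSeries ℤ k h) * e6

/-- The winding number and Witt parameters of a unit of `k((t))`; `a = wittParameters f` satisfies
`f = t ^ w · a₀ · ∏_{i ≥ 1} (1 - a₋ᵢ t⁻ⁱ) · ∏_{i ≥ 1} (1 - aᵢ tⁱ)`. -/
noncomputable def wittParameters [IsLocalRing k] [IsArtinianRing k] (f : (k⸨X⸩)ˣ) :
    WittParameters k :=
  (exists_wittParameters f).choose

lemma toLaurentSeries_wittParameters [IsLocalRing k] [IsArtinianRing k] (f : (k⸨X⸩)ˣ) :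
    (wittParameters f).toLaurentSeries = f :=
  (exists_wittParameters f).choose_spec

lemma isUnit_factor [IsLocalRing k] (x : k) {y : k} (hy : y ∈ IsLocalRing.maximalIdeal k)
    (i j : ℕ+) : IsUnit ((1 - x ^ ((j : ℕ) / Nat.gcd i j) * y ^ ((i : ℕ) / Nat.gcd i j)) ^
      Nat.gcd i j) := by
  refine IsUnit.pow _ ?_
  have h : (i : ℕ) / Nat.gcd i j ≠ 0 :=
    (Nat.div_pos (Nat.gcd_le_left _ i.2) (Nat.gcd_pos_of_pos_left _ i.2)).ne'
  exact IsLocalRing.isUnit_one_sub_self_of_mem_nonunits _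
    ((IsLocalRing.mem_maximalIdeal _).mp (Ideal.mul_mem_left _ _ (Ideal.pow_mem_of_mem _ hy _
      (Nat.pos_of_ne_zero h))))

/-- The factor `(1 - aᵢ ^ (j / (i, j)) · b₋ⱼ ^ (i / (i, j))) ^ (i, j)`, a unit of `k`. -/
noncomputable def WittParameters.factor [IsLocalRing k] (a b : WittParameters k) (i j : ℕ+) : kˣ :=
  (isUnit_factor (a.param (i : ℤ)) (b.mem_of_neg (-(j : ℤ)) (neg_neg_of_pos (by
    exact_mod_cast j.2))) i j).unit

/-- All but finitely many of the factors are `1`. -/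
lemma WittParameters.finite_mulSupport_factor [IsLocalRing k] [IsArtinianRing k]
    (a b : WittParameters k) :
    (Function.mulSupport fun p : ℕ+ × ℕ+ => a.factor b p.1 p.2).Finite := by
  have hm : IsNilpotent (IsLocalRing.maximalIdeal k) :=
    IsLocalRing.jacobson_eq_maximalIdeal (⊥ : Ideal k) bot_ne_top ▸
      IsArtinianRing.isNilpotent_jacobson_bot
  obtain ⟨R, hR⟩ := hm
  obtain ⟨M, hM⟩ := b.eventually_zero
  obtain ⟨N, hN⟩ : ∃ N : ℕ, ∀ j : ℕ+, N < (j : ℕ) → b.param (-(j : ℤ)) = 0 :=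
    ⟨M.natAbs, fun j hj => hM _ (by omega)⟩
  have hfin : {i : ℕ+ | (i : ℕ) ≤ R * N}.Finite :=
    Set.Finite.preimage (PNat.coe_injective.injOn) (Set.finite_Iic (R * N))
  have hfin' : {i : ℕ+ | (i : ℕ) ≤ N}.Finite :=
    Set.Finite.preimage (PNat.coe_injective.injOn) (Set.finite_Iic N)
  refine (hfin.prod hfin').subset fun ⟨i, j⟩ hp => ?_
  have hg : 0 < Nat.gcd i j := Nat.gcd_pos_of_pos_left _ i.2
  have hy : b.param (-(j : ℤ)) ^ ((i : ℕ) / Nat.gcd i j) ≠ 0 := by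
    intro h0
    apply hp
    ext
    change (1 - _ * b.param (-(j : ℤ)) ^ ((i : ℕ) / Nat.gcd i j)) ^ _ = (1 : k)
    rw [h0]; simp
  have hj : (j : ℕ) ≤ N := by
    by_contra h
    apply hy
    rw [hN j (by omega)]
    exact zero_pow (Nat.div_pos (Nat.gcd_le_left _ i.2) hg).ne'
  refine ⟨?_, hj⟩
  by_contra h
  apply hy
  have h1 : R ≤ (i : ℕ) / Nat.gcd i j := by
    rw [Nat.le_div_iff_mul_le hg]
    have h2 : R * Nat.gcd i j ≤ R * N := Nat.mul_le_mul_left _ ((Nat.gcd_le_right _ j.2).trans hj)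
    have h3 : ¬ ((i : ℕ) ≤ R * N) := h
    omega
  have h2 := Ideal.pow_mem_pow (b.mem_of_neg (-(j : ℤ)) (neg_neg_of_pos (by
    exact_mod_cast j.2))) R
  rw [hR] at h2
  exact pow_eq_zero_of_le h1 (by simpa using h2)

/-- The Contou-Carrère symbol of two units of `k((t))` with winding numbers `w(f)`, `w(g)` and
Witt parameters `(aᵢ)`, `(bⱼ)`: the unit `⟨f, g⟩` of `k` given by
`(-1) ^ (w(f) w(g)) · a₀ ^ w(g) / b₀ ^ w(f) · ∏_{i, j ≥ 1} (1 - aᵢ ^ (j/(i,j)) b₋ⱼ ^ (i/(i,j))) ^ (i,j)`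
divided by `∏_{i, j ≥ 1} (1 - a₋ᵢ ^ (j/(i,j)) bⱼ ^ (i/(i,j))) ^ (i,j)`. In the last product the
names of `i` and `j` are exchanged below. -/
noncomputable def symbol [IsLocalRing k] [IsArtinianRing k] (f g : (k⸨X⸩)ˣ) : kˣ :=
  let a := wittParameters f
  let b := wittParameters g
  (-1) ^ (a.winding * b.winding) *
    (a.isUnit_zero.unit ^ b.winding / b.isUnit_zero.unit ^ a.winding) *
    ((∏ᶠ p : ℕ+ × ℕ+, a.factor b p.1 p.2) / ∏ᶠ p : ℕ+ × ℕ+, b.factor a p.1 p.2)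

end WittParameters
section Expansion
variable {F A : Type*} [Field F] [CommRing A] [Algebra F A]

/-- `f = ∑ aᵢ πⁱ` in the `π`-adic sense: modulo `πⁿ`, `f` is the partial sum over `i < n`. -/
def IsExpansion (π f : A) (P : F⟦X⟧) : Prop :=
  ∀ n : ℕ, π ^ n ∣
    f - ∑ i ∈ Finset.range n, algebraMap F A (PowerSeries.coeff i P) * π ^ i

lemma sum_eq_aeval_trunc (π : A) (P : F⟦X⟧) (n : ℕ) :
    ∑ i ∈ Finset.range n, algebraMap F A (PowerSeries.coeff i P) * π ^ i =
      Polynomial.aeval π (PowerSeries.trunc n P) := by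
  cases n with
  | zero => simp
  | succ n =>
    rw [Polynomial.aeval_eq_sum_range' (PowerSeries.natDegree_trunc_lt P n)]
    refine Finset.sum_congr rfl fun i hi => ?_
    rw [PowerSeries.coeff_trunc, if_pos (Finset.mem_range.mp hi), Algebra.smul_def]

lemma isExpansion_iff {π f : A} {P : F⟦X⟧} : IsExpansion π f P ↔
    ∀ n : ℕ, ∃ p : F[X], (PowerSeries.X ^ n : F⟦X⟧) ∣ P - p ∧ π ^ n ∣ f - Polynomial.aeval π p := by
  constructor
  · intro h n
    refine ⟨PowerSeries.trunc n P, ?_, ?_⟩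
    · rw [PowerSeries.X_pow_dvd_iff]
      intro m hm
      rw [map_sub, Polynomial.coeff_coe, PowerSeries.coeff_trunc, if_pos hm, sub_self]
    · rw [← sum_eq_aeval_trunc]; exact h n
  · intro h n
    obtain ⟨p, h1, h2⟩ := h n
    rw [sum_eq_aeval_trunc]
    have h3 : (Polynomial.X ^ n : F[X]) ∣ p - PowerSeries.trunc n P := by
      rw [Polynomial.X_pow_dvd_iff]
      intro m hm
      have := PowerSeries.X_pow_dvd_iff.mp h1 m hm
      rw [map_sub, Polynomial.coeff_coe, sub_eq_zero] at this
      rw [Polynomial.coeff_sub, PowerSeries.coeff_trunc, if_pos hm, this, sub_self]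
    have h4 := map_dvd (Polynomial.aeval (R := F) π) h3
    rw [map_pow, Polynomial.aeval_X, map_sub] at h4
    have := dvd_add h2 h4
    simpa using this

lemma exists_isExpansion {π : A}
    (hres : ∀ x : A, ∃ c : F, π ∣ x - algebraMap F A c) (f : A) :
    ∃ P : F⟦X⟧, IsExpansion π f P := by
  choose c q hq using hres
  let r : ℕ → A := fun n => q^[n] f
  refine ⟨PowerSeries.mk fun n => c (r n), fun n => ⟨r n, ?_⟩⟩
  induction n with
  | zero => simp [r]
  | succ n ih =>
    have h1 : r (n + 1) = q (r n) := Function.iterate_succ_apply' q n f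
    have h2 := hq (r n)
    rw [Finset.sum_range_succ, ← sub_sub, ih, PowerSeries.coeff_mk, h1]
    linear_combination π ^ n * h2

lemma X_pow_dvd_of_pow_dvd_aeval {π : A} (hπ : π ∈ nonZeroDivisors A) (hu : ¬ IsUnit π) (n : ℕ)
    (d : F[X]) (h : π ^ n ∣ Polynomial.aeval π d) : (Polynomial.X ^ n : F[X]) ∣ d := by
  induction n generalizing d with
  | zero => simp
  | succ n ih =>
    have h0 : d.coeff 0 = 0 := by
      by_contra hc
      have h1 : π ∣ Polynomial.aeval π d := (dvd_pow_self π (by omega)).trans h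
      have h2 : Polynomial.aeval π d =
          Polynomial.aeval π d.divX * π + algebraMap F A (d.coeff 0) := by
        conv_lhs => rw [← Polynomial.divX_mul_X_add d]
        simp
      rw [h2, dvd_add_right (dvd_mul_left _ _)] at h1
      exact hu (isUnit_of_dvd_unit h1 ((IsUnit.mk0 _ hc).map (algebraMap F A)))
    have h1 := Polynomial.divX_mul_X_add d
    rw [h0, map_zero, add_zero] at h1
    rw [← h1, pow_succ]
    refine mul_dvd_mul_right (ih _ ?_) _
    rw [← h1, map_mul, Polynomial.aeval_X, pow_succ] at h
    obtain ⟨z, hz⟩ := h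
    refine ⟨z, ?_⟩
    have : (Polynomial.aeval π d.divX - π ^ n * z) * π = 0 := by linear_combination hz
    exact sub_eq_zero.mp (hπ.2 _ this)

lemma IsExpansion.unique {π : A} (hπ : π ∈ nonZeroDivisors A) (hu : ¬ IsUnit π) {f : A}
    {P Q : F⟦X⟧} (hP : IsExpansion π f P) (hQ : IsExpansion π f Q) : P = Q := by
  ext m
  obtain ⟨p, h1, h2⟩ := isExpansion_iff.mp hP (m + 1)
  obtain ⟨q, h3, h4⟩ := isExpansion_iff.mp hQ (m + 1)
  have h5 : (Polynomial.X ^ (m + 1) : F[X]) ∣ p - q := by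
    apply X_pow_dvd_of_pow_dvd_aeval hπ hu
    rw [map_sub]
    simpa using dvd_sub h4 h2
  have e1 := PowerSeries.X_pow_dvd_iff.mp h1 m (by omega)
  have e2 := PowerSeries.X_pow_dvd_iff.mp h3 m (by omega)
  have e3 := Polynomial.X_pow_dvd_iff.mp h5 m (by omega)
  rw [map_sub, Polynomial.coeff_coe] at e1 e2
  rw [Polynomial.coeff_sub] at e3
  linear_combination e1 - e2 + e3

lemma IsExpansion.algebraMap (π : A) (c : F) :
    IsExpansion π (algebraMap F A c) (PowerSeries.C c) := by
  rw [isExpansion_iff]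
  exact fun n => ⟨Polynomial.C c, by simp, by simp⟩

lemma IsExpansion.add {π f g : A} {P Q : F⟦X⟧} (hf : IsExpansion π f P) (hg : IsExpansion π g Q) :
    IsExpansion π (f + g) (P + Q) := by
  rw [isExpansion_iff] at *
  intro n
  obtain ⟨p, h1, h2⟩ := hf n
  obtain ⟨q, h3, h4⟩ := hg n
  refine ⟨p + q, ?_, ?_⟩
  · rw [Polynomial.coe_add, add_sub_add_comm]; exact dvd_add h1 h3
  · rw [map_add, add_sub_add_comm]; exact dvd_add h2 h4

lemma IsExpansion.mul {π f g : A} {P Q : F⟦X⟧} (hf : IsExpansion π f P) (hg : IsExpansion π g Q) :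
    IsExpansion π (f * g) (P * Q) := by
  rw [isExpansion_iff] at *
  intro n
  obtain ⟨p, h1, h2⟩ := hf n
  obtain ⟨q, h3, h4⟩ := hg n
  refine ⟨p * q, ?_, ?_⟩
  · rw [Polynomial.coe_mul]
    have := dvd_add (h1.mul_right Q) (h3.mul_left (p : F⟦X⟧))
    convert this using 1; ring
  · rw [map_mul]
    have := dvd_add (h2.mul_right g) (h4.mul_left (Polynomial.aeval π p))
    convert this using 1; ring

/-- `π` is a uniformizer of the local ring `A`: it generates the maximal ideal. -/
def IsUniformizer [IsLocalRing A] (π : A) : Prop :=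
  IsLocalRing.maximalIdeal A = Ideal.span {π}

variable [IsLocalRing A] [IsNoetherianRing A] [IsDomain A]

lemma exists_expansionHom (hA : ¬ IsField A)
    (hF : Function.Surjective (algebraMap F (IsLocalRing.ResidueField A)))
    {π : A} (hπ : IsUniformizer π) :
    ∃ φ : A →ₐ[F] F⟦X⟧, Function.Injective φ ∧ ∀ f, IsExpansion π f (φ f) := by
  have hmem : ∀ x : A, x ∈ IsLocalRing.maximalIdeal A ↔ π ∣ x := fun x => by
    rw [hπ, Ideal.mem_span_singleton]
  have hnz : π ∈ nonZeroDivisors A := mem_nonZeroDivisors_of_ne_zero fun h => hA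
    (IsLocalRing.isField_iff_maximalIdeal_eq.mpr (by rw [hπ, h]; simp))
  have hu : ¬ IsUnit π := (IsLocalRing.mem_maximalIdeal π).mp ((hmem π).mpr dvd_rfl)
  have hres : ∀ x : A, ∃ c : F, π ∣ x - algebraMap F A c := fun x => by
    obtain ⟨c, hc⟩ := hF (IsLocalRing.residue A x)
    refine ⟨c, (hmem _).mp ?_⟩
    rw [← IsLocalRing.residue_eq_zero_iff, map_sub, ← hc, sub_eq_zero]
    rfl
  choose φ hφ using fun f : A => exists_isExpansion hres f
  have h0 : φ 0 = 0 := (hφ 0).unique hnz hu (by simpa using IsExpansion.algebraMap π (0 : F))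
  let Φ : A →ₐ[F] F⟦X⟧ :=
    { toFun := φ
      map_one' := (hφ 1).unique hnz hu (by simpa using IsExpansion.algebraMap π (1 : F))
      map_mul' := fun f g => (hφ (f * g)).unique hnz hu ((hφ f).mul (hφ g))
      map_zero' := h0
      map_add' := fun f g => (hφ (f + g)).unique hnz hu ((hφ f).add (hφ g))
      commutes' := fun c => (hφ _).unique hnz hu (IsExpansion.algebraMap π c) }
  refine ⟨Φ, (injective_iff_map_eq_zero Φ).mpr fun f hf => ?_, hφ⟩
  have h1 : ∀ n : ℕ, π ^ n ∣ f := fun n => by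
    have := hφ f n
    rw [show φ f = 0 from hf] at this
    simpa using this
  have h2 := Ideal.iInf_pow_eq_bot_of_isLocalRing (IsLocalRing.maximalIdeal A)
    (Ideal.IsPrime.ne_top inferInstance)
  rw [← Ideal.mem_bot, ← h2, Ideal.mem_iInf]
  intro n
  rw [hπ, Ideal.span_singleton_pow, Ideal.mem_span_singleton]
  exact h1 n

variable (F) in
/-- The expansion homomorphism `A → F[[t]]`, `∑ aᵢ πⁱ ↦ ∑ aᵢ tⁱ`, for a uniformizer `π` of a
noetherian local domain `A` that is not a field and has residue field `F`. -/
noncomputable def expansion (hA : ¬ IsField A)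
    (hF : Function.Surjective (algebraMap F (IsLocalRing.ResidueField A)))
    {π : A} (hπ : IsUniformizer π) : A →ₐ[F] F⟦X⟧ :=
  (exists_expansionHom hA hF hπ).choose

lemma isExpansion_expansion (hA : ¬ IsField A)
    (hF : Function.Surjective (algebraMap F (IsLocalRing.ResidueField A)))
    {π : A} (hπ : IsUniformizer π) (f : A) : IsExpansion π f (expansion F hA hF hπ f) :=
  (exists_expansionHom hA hF hπ).choose_spec.2 f

lemma expansion_injective (hA : ¬ IsField A)
    (hF : Function.Surjective (algebraMap F (IsLocalRing.ResidueField A)))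
    {π : A} (hπ : IsUniformizer π) : Function.Injective (expansion F hA hF hπ) :=
  (exists_expansionHom hA hF hπ).choose_spec.1

variable (F) in
/-- The expansion homomorphism on the fraction field `K` of `A`: it maps `∑ aᵢ πⁱ`, with finitely
many negative powers of `π`, to `∑ aᵢ tⁱ`. -/
noncomputable def fractionExpansion (K : Type*) [Field K] [Algebra A K] [IsFractionRing A K]
    [Algebra F K] [IsScalarTower F A K] (hA : ¬ IsField A)
    (hF : Function.Surjective (algebraMap F (IsLocalRing.ResidueField A)))
    {π : A} (hπ : IsUniformizer π) : K →ₐ[F] F⸨X⸩ :=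
  IsFractionRing.liftAlgHom (A := A) (K := K) (R := F)
    (g := (AlgHom.mk (HahnSeries.ofPowerSeries ℤ F) fun _ => rfl : F⟦X⟧ →ₐ[F] F⸨X⸩).comp
      (expansion F hA hF hπ))
    (HahnSeries.ofPowerSeries_injective.comp (expansion_injective hA hF hπ))

end Expansion

/-- The homomorphism `B ⊗ k → C`, `b ⊗ c ↦ φ b · ψ c`. -/
noncomputable def tensorHom {F B k C : Type*} [CommRing F] [CommRing B] [CommRing k] [CommRing C]
    [Algebra F B] [Algebra F k] (φ : B →+* C) (ψ : k →+* C)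
    (h : ∀ c : F, φ (algebraMap F B c) = ψ (algebraMap F k c)) : B ⊗[F] k →+* C :=
  letI : Algebra F C := (ψ.comp (algebraMap F k)).toAlgebra
  (Algebra.TensorProduct.lift (AlgHom.mk φ h : B →ₐ[F] C)
    (AlgHom.mk ψ fun _ => rfl : k →ₐ[F] C) fun _ _ => Commute.all _ _).toRingHom

lemma tensorHom_tmul {F B k C : Type*} [CommRing F] [CommRing B] [CommRing k] [CommRing C]
    [Algebra F B] [Algebra F k] (φ : B →+* C) (ψ : k →+* C)
    (h : ∀ c : F, φ (algebraMap F B c) = ψ (algebraMap F k c)) (b : B) (c : k) :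
    tensorHom φ ψ h (b ⊗ₜ c) = φ b * ψ c :=
  letI : Algebra F C := (ψ.comp (algebraMap F k)).toAlgebra
  Algebra.TensorProduct.lift_tmul (AlgHom.mk φ h : B →ₐ[F] C)
    (AlgHom.mk ψ fun _ => rfl : k →ₐ[F] C) (fun _ _ => Commute.all _ _) b c

section Curve
open AlgebraicGeometry CategoryTheory
variable {F : Type u} [Field F] {X : Scheme.{u}} [X.Over (Spec (.of F))]

/-- The `F`-algebra structure on the sections of a scheme over `F`. -/
noncomputable instance sectionsAlgebra (U : X.Opens) : Algebra F Γ(X, U) :=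
  ((Scheme.ΓSpecIso (.of F)).inv ≫ (X ↘ Spec (.of F)).appTop ≫
    X.presheaf.map (homOfLE le_top).op).hom.toAlgebra

/-- The `F`-algebra structure on the local rings of a scheme over `F`. -/
noncomputable instance stalkAlgebra (x : X) : Algebra F (X.presheaf.stalk x) :=
  ((Scheme.ΓSpecIso (.of F)).inv ≫ (X ↘ Spec (.of F)).appTop ≫
    X.presheaf.germ ⊤ x (TopologicalSpace.Opens.mem_top x)).hom.toAlgebra

variable (F X) in
/-- `X` is a complete nonsingular curve over `F`: it is integral, proper over `F` (in particular
separated and of finite type), of dimension one, and all its local rings are regular. -/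
structure IsCompleteNonsingularCurve : Prop where
  isIntegral : IsIntegral X
  isProper : IsProper (X ↘ Spec (.of F))
  dim_eq_one : topologicalKrullDim X = 1
  isRegularLocalRing : ∀ x : X, IsRegularLocalRing (X.presheaf.stalk x)

lemma IsCompleteNonsingularCurve.ne_genericPoint (hX : IsCompleteNonsingularCurve F X)
    [IsIntegral X] {s : X} (hs : IsClosed {s}) : s ≠ genericPoint X := by
  rintro rfl
  have h1 : closure {genericPoint X} = (Set.univ : Set X) := genericPoint_spec X
  rw [hs.closure_eq] at h1
  have : Subsingleton X := ⟨fun x y => by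
    have hx : x ∈ ({genericPoint X} : Set X) := h1 ▸ Set.mem_univ x
    have hy : y ∈ ({genericPoint X} : Set X) := h1 ▸ Set.mem_univ y
    rw [Set.mem_singleton_iff.mp hx, Set.mem_singleton_iff.mp hy]⟩
  have h2 := topologicalKrullDim_zero_of_discreteTopology X
  rw [hX.dim_eq_one] at h2
  exact absurd h2 (by decide)

lemma IsCompleteNonsingularCurve.not_isField_stalk (hX : IsCompleteNonsingularCurve F X)
    {s : X} (hs : IsClosed {s}) : ¬ IsField (X.presheaf.stalk s) := by
  have := hX.isIntegral
  intro h
  apply hX.ne_genericPoint hs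
  have h1 : genericPoint X ∈ Set.range (X.fromSpecStalk s) := by
    rw [Scheme.range_fromSpecStalk]
    exact (genericPoint_spec X).specializes trivial
  obtain ⟨y, hy⟩ := h1
  let _ := h.toField
  have : y = IsLocalRing.closedPoint (X.presheaf.stalk s) := by
    apply PrimeSpectrum.ext
    have h2 : IsLocalRing.maximalIdeal (X.presheaf.stalk s) = ⊥ :=
      IsLocalRing.isField_iff_maximalIdeal_eq.mp h
    have h3 : y.asIdeal ≤ IsLocalRing.maximalIdeal (X.presheaf.stalk s) :=
      IsLocalRing.le_maximalIdeal y.2.ne_top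
    rw [h2, le_bot_iff] at h3
    rw [h3]
    exact h2.symm
  rw [← hy, this, Scheme.fromSpecStalk_closedPoint]

lemma specMap_algebraMap_stalk (x : X) :
    Spec.map (CommRingCat.ofHom (algebraMap F (X.presheaf.stalk x))) =
      X.fromSpecStalk x ≫ X ↘ Spec (.of F) := by
  apply ext_of_isAffine
  rw [Scheme.Hom.comp_appTop, Scheme.fromSpecStalk_appTop]
  rw [← cancel_mono (Scheme.ΓSpecIso _).hom, Scheme.ΓSpecIso_naturality]
  change (Scheme.ΓSpecIso _).hom ≫ (Scheme.ΓSpecIso (.of F)).inv ≫ (X ↘ Spec (.of F)).appTop ≫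
    X.presheaf.germ ⊤ x (TopologicalSpace.Opens.mem_top x) = _
  simp

lemma IsCompleteNonsingularCurve.residue_surjective [IsAlgClosed F]
    (hX : IsCompleteNonsingularCurve F X) {s : X} (hs : IsClosed {s}) : Function.Surjective
      (algebraMap F (IsLocalRing.ResidueField (X.presheaf.stalk s))) := by
  have := hX.isProper
  have h1 := SpecMap_residueFieldIsoBase_inv (X ↘ Spec (.of F)) s hs
  have h2 : (residueFieldIsoBase (X ↘ Spec (.of F)) s hs).inv =
      CommRingCat.ofHom (algebraMap F (X.presheaf.stalk s)) ≫ X.residue s := by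
    apply Spec.map_injective
    rw [h1, Spec.map_comp, specMap_algebraMap_stalk, Scheme.fromSpecResidueField, Category.assoc]
  have h3 := (ConcreteCategory.bijective_of_isIso
    (residueFieldIsoBase (X ↘ Spec (.of F)) s hs).inv).2
  rw [h2] at h3
  exact h3

/-- The open subscheme `X ∖ S`. -/
def complOpens (S : Finset (closedPoints X)) : X.Opens :=
  ⟨(⋃ s ∈ S, {s.1})ᶜ, (isClosed_biUnion_finset fun s _ => s.2).isOpen_compl⟩

lemma IsCompleteNonsingularCurve.genericPoint_mem [IsIntegral X]
    (hX : IsCompleteNonsingularCurve F X) (S : Finset (closedPoints X)) :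
    genericPoint X ∈ complOpens S := by
  intro h
  obtain ⟨s, -, hs⟩ := Set.mem_iUnion₂.mp h
  exact hX.ne_genericPoint s.2 hs.symm

instance stalk_isScalarTower [IsIntegral X] (x : X) :
    IsScalarTower F (X.presheaf.stalk x) X.functionField := by
  refine IsScalarTower.of_algebraMap_eq' ?_
  have h : ((Scheme.ΓSpecIso (.of F)).inv ≫ (X ↘ Spec (.of F)).appTop ≫
      X.presheaf.germ ⊤ (genericPoint X) (TopologicalSpace.Opens.mem_top _)) =
      ((Scheme.ΓSpecIso (.of F)).inv ≫ (X ↘ Spec (.of F)).appTop ≫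
      X.presheaf.germ ⊤ x (TopologicalSpace.Opens.mem_top x)) ≫
        X.presheaf.stalkSpecializes ((genericPoint_spec X).specializes trivial) := by
    rw [Category.assoc, Category.assoc, TopCat.Presheaf.germ_stalkSpecializes]
  exact congrArg CommRingCat.Hom.hom h

/-- The inclusion of the sections over `X ∖ S` into the meromorphic functions. -/
noncomputable def IsCompleteNonsingularCurve.toFunctionField [IsIntegral X]
    (hX : IsCompleteNonsingularCurve F X) (S : Finset (closedPoints X)) :
    Γ(X, complOpens S) →ₐ[F] X.functionField :=
  AlgHom.mk (X.presheaf.germ (complOpens S) (genericPoint X) (hX.genericPoint_mem S)).hom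
    (fun c => by
      have h : ((Scheme.ΓSpecIso (.of F)).inv ≫ (X ↘ Spec (.of F)).appTop ≫
          X.presheaf.map (homOfLE le_top).op) ≫
            X.presheaf.germ (complOpens S) (genericPoint X) (hX.genericPoint_mem S) =
          ((Scheme.ΓSpecIso (.of F)).inv ≫ (X ↘ Spec (.of F)).appTop ≫
            X.presheaf.germ ⊤ (genericPoint X) (TopologicalSpace.Opens.mem_top _)) := by
        simp
      exact congrArg (fun φ => CommRingCat.Hom.hom φ c) h)

/-- The Laurent expansion `H⁰(X ∖ S, 𝒪_X) → F((t))`, at a closed point `s`, in powers of a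
uniformizer `π` of the local ring at `s`. -/
noncomputable def IsCompleteNonsingularCurve.laurentExpansion [IsAlgClosed F]
    (hX : IsCompleteNonsingularCurve F X) (S : Finset (closedPoints X)) (s : closedPoints X)
    {π : X.presheaf.stalk s.1} (hπ : IsUniformizer π) : Γ(X, complOpens S) →ₐ[F] F⸨X⸩ :=
  have := hX.isIntegral
  have := hX.isRegularLocalRing s.1
  (fractionExpansion F X.functionField (hX.not_isField_stalk s.2)
    (hX.residue_surjective s.2) hπ).comp (hX.toFunctionField S)

/-- The homomorphism `H⁰(X ∖ S, 𝒪_X) ⊗ k → k((t))`, `f ⊗ c ↦ c · f⁽ˢ⁾`, where `f⁽ˢ⁾` is the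
Laurent expansion of `f` at `s`. -/
noncomputable def IsCompleteNonsingularCurve.laurentExpansionTensor [IsAlgClosed F]
    (hX : IsCompleteNonsingularCurve F X) (S : Finset (closedPoints X))
    (k : Type v) [CommRing k] [Algebra F k] (s : closedPoints X)
    {π : X.presheaf.stalk s.1} (hπ : IsUniformizer π) :
    Γ(X, complOpens S) ⊗[F] k →+* k⸨X⸩ :=
  tensorHom ((mapLaurent (algebraMap F k)).comp (hX.laurentExpansion S s hπ).toRingHom)
    HahnSeries.C fun c => by
      change mapLaurent (algebraMap F k) (hX.laurentExpansion S s hπ (algebraMap F _ c)) =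
        HahnSeries.C (algebraMap F k c)
      rw [AlgHom.commutes]
      change mapLaurent (algebraMap F k) (HahnSeries.ofPowerSeries ℤ F (PowerSeries.C c)) = _
      rw [HahnSeries.ofPowerSeries_C]
      exact HahnSeries.map_C c (algebraMap F k)

lemma IsCompleteNonsingularCurve.laurentExpansionTensor_tmul [IsAlgClosed F]
    (hX : IsCompleteNonsingularCurve F X) (S : Finset (closedPoints X))
    (k : Type v) [CommRing k] [Algebra F k] (s : closedPoints X)
    {π : X.presheaf.stalk s.1} (hπ : IsUniformizer π) (f : Γ(X, complOpens S)) (c : k) :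
    hX.laurentExpansionTensor S k s hπ (f ⊗ₜ c) =
      mapLaurent (algebraMap F k) (hX.laurentExpansion S s hπ f) * HahnSeries.C c :=
  tensorHom_tmul _ _ _ f c

end Curve
end ContouCarrere

open AlgebraicGeometry ContouCarrere

/-!
The Contou-Carrère symbol measures how far the multiplications by `f` and `g` are from commuting on
determinants of lattices, and the reciprocity law holds because these determinants can also be
computed on the side of the functions regular outside `S`.

Let `W` be a lattice in a module `V`, and let `f` and `g` be commuting automorphisms of `V` that
enlarge `W`. For bases `e` of `f W / W` and `d` of `g W / W` there are two bases `(e, f d)` and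
`(g e, d)` of `f g W / W`, and the determinant between them does not depend on `e` and `d`
(`IsLatticeSymbol`). If `f` and `g` shrink a submodule `A`, the same recipe with `A / f A` and
`A / g A` gives a second symbol (`IsDiscreteSymbol`). When `A + W = V` and `A ∩ W` is free of finite
rank, the two agree: all the bases involved complete bases of `A ∩ W` or of its image under `f g`
to bases of `A ∩ f g W` (`IsLatticeSymbol.eq_of_isDiscreteSymbol`).

On `k((t))` with `W = k[[t]]`, Weierstrass preparation makes the lattice symbol explicit. For
`u = α D` and `v = β E` with invertible power series `α`, `β` and distinguished polynomials `D`, `E`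
of degrees `p`, `q`, the symbol of `u⁻¹` and `v⁻¹` is `(-1) ^ (p q) N_E(α) / N_D(β)`, where `N_D` is
the norm from `k[[t]] / (D)` to `k` (`detMod_symbol`, `detMod_polarFamily`). The norm is
multiplicative in the modulus, and that of `1 - b tʲ` modulo `tⁱ - a` is the determinant of a
weighted cyclic matrix with `(i, j)` cycles, namely
`(1 - a ^ (j / (i, j)) b ^ (i / (i, j))) ^ (i, j)` (`det_cyclic`). So the norms are the double
products in the Contou-Carrère symbol (`WittParameters.quotNorm_distPoly`).

Let now `A` be the space of expansions in `k((t))^S` of the functions regular outside `S`. It meets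
each lattice `t ^ (-N) k[[t]]^S` in a module of finite rank, and together with it spans `k((t))^S`
for large `N`. In particular there is `x ∈ A` with a pole of the same large order at each point of
`S`; then `x / f`, `x / g` and `x` shrink `A` and enlarge the lattices. Since `f` and `g` preserve
`A`, their actions on `A / x A` give a relation between the symbols of the pairs
`(x / f, x / g)`, `(x, x)`, `(x / f, x)`, `(x, x / g)` along `A`
(`IsDiscreteSymbol.exists_mul_eq_mul`), and the local computation turns this relation into the
reciprocity law (`prod_symbol_eq_one`). The bases are chosen over `F` and then extended to `k`, so
that finiteness is needed over the field `F` only.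

The two finiteness properties are proved by weak approximation, for any family of places that has
the formal properties of the closed points of a complete curve (`IsPlaceSystem`). Bounded poles
leave a finite-dimensional space since functions without poles are constant
(`IsPlaceSystem.finiteDimensional_boundedPoles`). For the spanning property, first `S` is replaced
by the set of poles of a function `x`, whose powers, times a fixed function `b`, clear the poles of
approximating functions elsewhere, and then the additional poles are removed by linear algebra
(`IsPlaceSystem.exists_regularOutside_approx`). The closed points of a complete nonsingular curve
are such a family (`IsCompleteNonsingularCurve.isPlaceSystem`), and the functions regular outside
`S` are the sections over `X ∖ S`.
-/

namespace ContouCarrere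

/-! ### Determinants of families of vectors modulo a submodule -/

section DetMod
variable {k V : Type*} [CommRing k] [AddCommGroup V] [Module k V]
variable {ι κ : Type*} [Fintype ι] [Fintype κ]

/-- The family `b` of elements of `M` is a basis of `M` modulo `N`: it is linearly independent
modulo `N`, and together with `N` it spans `M`. The inclusion `N ≤ M` is not part of the
definition. -/
structure IsBasisMod (N M : Submodule k V) (b : ι → V) : Prop where
  mem : ∀ i, b i ∈ M
  indep : ∀ c : ι → k, ∑ i, c i • b i ∈ N → c = 0
  span : ∀ m ∈ M, ∃ c : ι → k, m - ∑ i, c i • b i ∈ N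

section
variable {N M : Submodule k V} {b c : ι → V}

lemma IsBasisMod.map {V' : Type*} [AddCommGroup V'] [Module k V'] (f : V →ₗ[k] V')
    (hf : Function.Injective f) (h : IsBasisMod N M b) :
    IsBasisMod (N.map f) (M.map f) fun i => f (b i) where
  mem i := Submodule.mem_map_of_mem (h.mem i)
  indep c hc := by
    obtain ⟨n, hn, hn'⟩ := hc
    refine h.indep c ?_
    rw [show ∑ i, c i • b i = n from hf (by rw [hn']; simp)]
    exact hn
  span m hm := by
    obtain ⟨m, hm, rfl⟩ := hm
    obtain ⟨c, hc⟩ := h.span m hm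
    exact ⟨c, by simpa using Submodule.mem_map_of_mem (f := f) hc⟩

lemma IsBasisMod.congr (h : IsBasisMod N M b) (hc : ∀ i, c i - b i ∈ N) (hM : ∀ i, c i ∈ M) :
    IsBasisMod N M c := by
  have h1 : ∀ x : ι → k, ∑ i, x i • c i - ∑ i, x i • b i ∈ N := fun x => by
    rw [← Finset.sum_sub_distrib]
    exact N.sum_mem fun i _ => by rw [← smul_sub]; exact N.smul_mem _ (hc i)
  refine ⟨hM, fun x hx => h.indep x ?_, fun m hm => ?_⟩
  · have := N.sub_mem hx (h1 x)
    rwa [sub_sub_cancel] at this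
  · obtain ⟨x, hx⟩ := h.span m hm
    refine ⟨x, ?_⟩
    have := N.sub_mem hx (h1 x)
    rwa [sub_sub_sub_cancel_right] at this

lemma IsBasisMod.reindex (h : IsBasisMod N M b) (σ : κ ≃ ι) : IsBasisMod N M (b ∘ σ) where
  mem i := h.mem _
  indep c hc := by
    have := h.indep (c ∘ σ.symm) (by rw [← σ.sum_comp]; simpa using hc)
    ext i
    simpa using congrFun this (σ i)
  span m hm := by
    obtain ⟨c, hc⟩ := h.span m hm
    refine ⟨c ∘ σ, ?_⟩
    rw [← σ.sum_comp] at hc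
    exact hc

/-- A family `b` in `M` independent modulo `N`, followed by a family independent modulo `M`, is
independent modulo `N`. -/
lemma indep_sumElim {x : κ → V} (hNM : N ≤ M) (hbM : ∀ i, b i ∈ M)
    (hb : ∀ c : ι → k, ∑ i, c i • b i ∈ N → c = 0)
    (hx : ∀ c : κ → k, ∑ i, c i • x i ∈ M → c = 0) (c : ι ⊕ κ → k)
    (hc : ∑ i, c i • Sum.elim b x i ∈ N) : c = 0 := by
  rw [Fintype.sum_sum_type] at hc
  simp only [Sum.elim_inl, Sum.elim_inr] at hc
  have h1 : ∑ i, c (Sum.inl i) • b i ∈ M := M.sum_mem fun i _ => M.smul_mem _ (hbM i)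
  have h2 := hx (fun i => c (Sum.inr i)) (by
    have := M.sub_mem (hNM hc) h1
    rwa [add_sub_cancel_left] at this)
  have h3 := hb (fun i => c (Sum.inl i)) (by
    have h4 : ∑ i, c (Sum.inr i) • x i = 0 :=
      Finset.sum_eq_zero fun i _ => by rw [congrFun h2 i]; simp
    rwa [h4, add_zero] at hc)
  ext (i | i)
  exacts [congrFun h3 i, congrFun h2 i]

/-- A basis of `M` modulo `N` followed by a basis of `L` modulo `M` is a basis of `L` modulo
`N`. -/
lemma IsBasisMod.sumElim {L : Submodule k V} {x : κ → V} (h : IsBasisMod N M b)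
    (hx : IsBasisMod M L x) (hNM : N ≤ M) (hML : M ≤ L) : IsBasisMod N L (Sum.elim b x) where
  mem := by rintro (i | i); exacts [hML (h.mem i), hx.mem i]
  indep := indep_sumElim hNM h.mem h.indep hx.indep
  span m hm := by
    obtain ⟨y, hy⟩ := hx.span m hm
    obtain ⟨z, hz⟩ := h.span _ hy
    refine ⟨Sum.elim z y, ?_⟩
    rw [Fintype.sum_sum_type]
    simpa [sub_sub, add_comm] using hz

lemma IsBasisMod.card_eq [Nontrivial k] {x : κ → V} (h : IsBasisMod (⊥ : Submodule k V) M b)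
    (hx : IsBasisMod (⊥ : Submodule k V) M x) : Fintype.card ι = Fintype.card κ := by
  have key : ∀ {n : ℕ} {y : Fin n → V}, IsBasisMod (⊥ : Submodule k V) M y →
      ∃ B : Module.Basis (Fin n) k M, True := by
    intro n y hy
    refine ⟨Module.Basis.mk (v := fun i => (⟨y i, hy.mem i⟩ : M)) ?_ ?_, trivial⟩
    · rw [Fintype.linearIndependent_iff]
      intro g hg i
      refine congrFun (hy.indep g ?_) i
      simpa using congrArg Subtype.val hg
    · rintro ⟨m, hm⟩ -
      obtain ⟨c, hc⟩ := hy.span m hm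
      rw [Submodule.mem_span_range_iff_exists_fun]
      refine ⟨c, Subtype.ext ?_⟩
      rw [Submodule.mem_bot, sub_eq_zero] at hc
      simp [hc]
  obtain ⟨B, -⟩ := key (h.reindex (Fintype.equivFin ι).symm)
  obtain ⟨B', -⟩ := key (hx.reindex (Fintype.equivFin κ).symm)
  simpa using Fintype.card_congr (B.indexEquiv B')

/-- Bases modulo submodules of the factors of a finite product, put together. -/
lemma IsBasisMod.sigma {S : Type*} [Fintype S] [DecidableEq S] {ι : S → Type*}
    [∀ s, Fintype (ι s)] {V : S → Type*} [∀ s, AddCommGroup (V s)]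
    [∀ s, Module k (V s)] {N M : ∀ s, Submodule k (V s)} {b : ∀ s, ι s → V s}
    (h : ∀ s, IsBasisMod (N s) (M s) (b s)) :
    IsBasisMod (Submodule.pi Set.univ N) (Submodule.pi Set.univ M)
      (fun i : Σ s, ι s => Pi.single i.1 (b i.1 i.2)) := by
  have key : ∀ (c : (Σ s, ι s) → k) (s : S),
      (∑ i : Σ s, ι s, c i • (Pi.single i.1 (b i.1 i.2) : ∀ s, V s)) s =
        ∑ j, c ⟨s, j⟩ • b s j := by
    intro c s
    simp only [Fintype.sum_sigma, Finset.sum_apply, Pi.smul_apply]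
    rw [Finset.sum_eq_single s]
    · simp
    · intro t _ ht
      refine Finset.sum_eq_zero fun i _ => ?_
      rw [Pi.single_eq_of_ne (Ne.symm ht), smul_zero]
    · simp
  refine ⟨?_, fun c hc => ?_, fun m hm => ?_⟩
  · rintro ⟨s, j⟩ s' -
    by_cases hs : s = s'
    · subst hs
      simpa using (h s).mem j
    · simp [Pi.single_eq_of_ne (Ne.symm hs)]
  · ext ⟨s, j⟩
    refine congrFun ((h s).indep (fun j => c ⟨s, j⟩) ?_) j
    rw [← key]
    exact hc s trivial
  · choose c hc using fun s => (h s).span (m s) (hm s trivial)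
    refine ⟨fun i => c i.1 i.2, fun s _ => ?_⟩
    rw [Pi.sub_apply, key]
    exact hc s

lemma sum_smul_eq_of_matrix (P Q : Matrix ι ι k) (b : ι → V) (j : ι) :
    ∑ i, (P * Q) i j • b i = ∑ l, Q l j • ∑ i, P i l • b i := by
  simp only [Matrix.mul_apply, Finset.sum_smul, Finset.smul_sum, smul_smul]
  rw [Finset.sum_comm]
  simp only [mul_comm]

end

variable [DecidableEq ι] [DecidableEq κ]

/-- Modulo `N`, the family `c` is obtained from the family `b` by a square matrix of determinant
`d`. -/
def DetMod (N : Submodule k V) (b c : ι → V) (d : k) : Prop :=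
  ∃ P : Matrix ι ι k, P.det = d ∧ ∀ j, c j - ∑ i, P i j • b i ∈ N

variable {N M : Submodule k V} {b c b' : ι → V} {d d' : k}

lemma DetMod.of_sub_mem (h : ∀ i, c i - b i ∈ N) : DetMod N b c 1 :=
  ⟨1, Matrix.det_one, fun j => by simpa [Matrix.one_apply, ite_smul] using h j⟩

lemma DetMod.refl (N : Submodule k V) (b : ι → V) : DetMod N b b 1 :=
  .of_sub_mem fun i => by simp

lemma DetMod.trans (h : DetMod N b c d) (h' : DetMod N c b' d') : DetMod N b b' (d * d') := by
  obtain ⟨P, hP, h⟩ := h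
  obtain ⟨Q, hQ, h'⟩ := h'
  refine ⟨P * Q, by rw [Matrix.det_mul, hP, hQ], fun j => ?_⟩
  rw [sum_smul_eq_of_matrix]
  have h1 : ∑ l, Q l j • (c l - ∑ i, P i l • b i) ∈ N :=
    N.sum_mem fun l _ => N.smul_mem _ (h l)
  have := N.add_mem (h' j) h1
  simpa only [smul_sub, Finset.sum_sub_distrib, sub_add_sub_cancel] using this

lemma DetMod.mono {N' : Submodule k V} (hN : N ≤ N') (h : DetMod N b c d) : DetMod N' b c d := by
  obtain ⟨P, hP, h⟩ := h
  exact ⟨P, hP, fun j => hN (h j)⟩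

lemma DetMod.map {V' : Type*} [AddCommGroup V'] [Module k V'] (f : V →ₗ[k] V')
    (h : DetMod N b c d) : DetMod (N.map f) (fun i => f (b i)) (fun i => f (c i)) d := by
  obtain ⟨P, hP, h⟩ := h
  refine ⟨P, hP, fun j => ?_⟩
  simpa using Submodule.mem_map_of_mem (f := f) (h j)

lemma DetMod.reindex (σ : κ ≃ ι) (h : DetMod N b c d) : DetMod N (b ∘ σ) (c ∘ σ) d := by
  obtain ⟨P, hP, h⟩ := h
  refine ⟨P.submatrix σ σ, by rw [Matrix.det_submatrix_equiv_self, hP], fun j => ?_⟩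
  have := h (σ j)
  rw [← σ.sum_comp] at this
  exact this

lemma DetMod.perm (N : Submodule k V) (b : ι → V) (σ : Equiv.Perm ι) :
    DetMod N b (b ∘ σ) ((Equiv.Perm.sign σ : ℤ) : k) := by
  refine ⟨((σ⁻¹).toPEquiv.toMatrix : Matrix ι ι k), ?_, fun j => ?_⟩
  · rw [Matrix.det_permutation, Equiv.Perm.sign_inv]
  · have : ∑ i, ((σ⁻¹).toPEquiv.toMatrix : Matrix ι ι k) i j • b i = (b ∘ σ) j := by
      rw [Finset.sum_eq_single (σ j)]
      · simp [PEquiv.toMatrix_apply]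
      · intro i _ hi
        rw [PEquiv.toMatrix_apply, if_neg, zero_smul]
        simp only [Equiv.toPEquiv_apply, Option.mem_def, Option.some.injEq]
        rintro rfl
        simp at hi
      · simp
    rw [this, sub_self]
    exact N.zero_mem

/-- A change of the first half of a family modulo the span of the second half: the matrix is block
triangular. -/
lemma DetMod.sumElim_left {x : κ → V}
    (h : DetMod (N ⊔ Submodule.span k (Set.range x)) b c d) :
    DetMod N (Sum.elim b x) (Sum.elim c x) d := by
  obtain ⟨P, hP, h⟩ := h
  have h1 : ∀ j, ∃ q : κ → k, c j - ∑ i, P i j • b i - ∑ i, q i • x i ∈ N := by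
    intro j
    obtain ⟨n, hn, y, hy, hny⟩ := Submodule.mem_sup.mp (h j)
    obtain ⟨q, rfl⟩ := (Submodule.mem_span_range_iff_exists_fun k).mp hy
    exact ⟨q, by rw [← hny, add_sub_cancel_right]; exact hn⟩
  choose q hq using h1
  refine ⟨Matrix.fromBlocks P 0 (Matrix.of fun i j => q j i) 1, ?_, ?_⟩
  · rw [Matrix.det_fromBlocks_zero₁₂, hP, Matrix.det_one, mul_one]
  · rintro (j | j)
    · simpa [Fintype.sum_sum_type, sub_sub] using hq j
    · simp [Fintype.sum_sum_type, Matrix.one_apply, ite_smul]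

lemma DetMod.swap {x y : κ → V} (h : DetMod N (Sum.elim b x) (Sum.elim c y) d) :
    DetMod N (Sum.elim x b) (Sum.elim y c) d := by
  have := h.reindex (Equiv.sumComm κ ι)
  convert this using 1 <;> ext (i | i) <;> rfl

lemma DetMod.sumElim_right {x : κ → V}
    (h : DetMod (N ⊔ Submodule.span k (Set.range x)) b c d) :
    DetMod N (Sum.elim x b) (Sum.elim x c) d :=
  h.sumElim_left.swap

/-- The determinant is determined by the families if the first one is independent. -/
lemma DetMod.eq_of_indep (hb : ∀ c : ι → k, ∑ i, c i • b i ∈ N → c = 0)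
    (h : DetMod N b c d) (h' : DetMod N b c d') : d = d' := by
  obtain ⟨P, rfl, h⟩ := h
  obtain ⟨Q, rfl, h'⟩ := h'
  congr 1
  ext i j
  have := N.sub_mem (h' j) (h j)
  rw [sub_sub_sub_cancel_left, ← Finset.sum_sub_distrib] at this
  simp only [← sub_smul] at this
  exact sub_eq_zero.mp (congrFun (hb _ this) i)

lemma DetMod.exists_of_span (hb : ∀ j, ∃ x : ι → k, c j - ∑ i, x i • b i ∈ N) :
    ∃ d, DetMod N b c d := by
  choose x hx using hb
  exact ⟨_, Matrix.of fun i j => x j i, rfl, hx⟩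

lemma DetMod.symm {u : kˣ} (h : DetMod N b c u) : DetMod N c b (u⁻¹ : kˣ) := by
  obtain ⟨P, hP, h⟩ := h
  have hu : IsUnit P.det := hP ▸ u.isUnit
  refine ⟨P⁻¹, by rw [Matrix.det_nonsing_inv, hP, Ring.inverse_unit], fun j => ?_⟩
  have h1 : ∑ l, P⁻¹ l j • (c l - ∑ i, P i l • b i) ∈ N :=
    N.sum_mem fun l _ => N.smul_mem _ (h l)
  simp only [smul_sub, Finset.sum_sub_distrib] at h1
  rw [← sum_smul_eq_of_matrix, Matrix.mul_nonsing_inv _ hu] at h1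
  have := N.neg_mem h1
  simpa [Matrix.one_apply, ite_smul] using this

/-- Two bases of the same module differ by an invertible determinant. -/
lemma IsBasisMod.exists_detMod (hb : IsBasisMod N M b) (hc : IsBasisMod N M c) :
    ∃ d : kˣ, DetMod N b c d := by
  obtain ⟨d, hd⟩ := DetMod.exists_of_span fun j => hb.span _ (hc.mem j)
  obtain ⟨d', hd'⟩ := DetMod.exists_of_span fun j => hc.span _ (hb.mem j)
  have h1 : d * d' = 1 := DetMod.eq_of_indep hb.indep (hd.trans hd') (.refl N b)
  exact ⟨⟨d, d', h1, by rw [mul_comm, h1]⟩, hd⟩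

lemma det_blockDiagonal'_eq_prod {S : Type*} [Fintype S] [DecidableEq S] {ι : S → Type*}
    [∀ s, Fintype (ι s)] [∀ s, DecidableEq (ι s)] (P : ∀ s, Matrix (ι s) (ι s) k) :
    (Matrix.blockDiagonal' P).det = ∏ s, (P s).det := by
  let _ : LinearOrder S := LinearOrder.lift' (Fintype.equivFin S) (Fintype.equivFin S).injective
  have h : (Matrix.blockDiagonal' P).BlockTriangular (Sigma.fst : (Σ s, ι s) → S) :=
    fun i j hij => Matrix.blockDiagonal'_apply_ne _ _ _ (ne_of_gt hij)
  have h1 := h.det_fintype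
  convert h1 using 1
  refine Finset.prod_congr rfl fun s _ => ?_
  rw [← Matrix.det_submatrix_equiv_self (Equiv.sigmaSubtype s).symm]
  congr 1
  ext i j
  simp [Matrix.toSquareBlock_def, Equiv.sigmaSubtype, Matrix.blockDiagonal'_apply_eq]

/-- A relation in a finite product, made of relations in the factors by a block diagonal matrix. -/
lemma DetMod.sigma {S : Type*} [Fintype S] [DecidableEq S] {ι : S → Type*}
    [∀ s, Fintype (ι s)] [∀ s, DecidableEq (ι s)] {V : S → Type*} [∀ s, AddCommGroup (V s)]
    [∀ s, Module k (V s)] {N : ∀ s, Submodule k (V s)} {b c : ∀ s, ι s → V s} {d : S → k}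
    (h : ∀ s, DetMod (N s) (b s) (c s) (d s)) :
    DetMod (Submodule.pi Set.univ N) (fun i : Σ s, ι s => Pi.single i.1 (b i.1 i.2))
      (fun i : Σ s, ι s => Pi.single i.1 (c i.1 i.2)) (∏ s, d s) := by
  choose P hP h using h
  refine ⟨Matrix.blockDiagonal' P, by simp [det_blockDiagonal'_eq_prod, hP], ?_⟩
  rintro ⟨s, j⟩ s' -
  simp only [Fintype.sum_sigma, Pi.sub_apply, Finset.sum_apply, Pi.smul_apply]
  rw [Finset.sum_eq_single s']
  · by_cases hs : s = s'
    · subst hs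
      simpa [Matrix.blockDiagonal'_apply_eq] using h s j
    · rw [Pi.single_eq_of_ne (Ne.symm hs), Finset.sum_eq_zero]
      · simp
      · intro i _
        rw [Matrix.blockDiagonal'_apply_ne _ _ _ (Ne.symm hs), zero_smul]
  · intro t _ ht
    refine Finset.sum_eq_zero fun i _ => ?_
    rw [Pi.single_eq_of_ne (Ne.symm ht), smul_zero]
  · simp

lemma DetMod.sigma_sumElim {S : Type*} [Fintype S] [DecidableEq S] {ι κ : S → Type*}
    [∀ s, Fintype (ι s)] [∀ s, DecidableEq (ι s)] [∀ s, Fintype (κ s)] [∀ s, DecidableEq (κ s)]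
    {V : S → Type*} [∀ s, AddCommGroup (V s)] [∀ s, Module k (V s)] {N : ∀ s, Submodule k (V s)}
    {x x' : ∀ s, ι s → V s} {y y' : ∀ s, κ s → V s} {d : S → k}
    (h : ∀ s, DetMod (N s) (Sum.elim (x s) (y s)) (Sum.elim (x' s) (y' s)) (d s)) :
    DetMod (Submodule.pi Set.univ N)
      (Sum.elim (fun i : Σ s, ι s => Pi.single i.1 (x i.1 i.2))
        fun i : Σ s, κ s => Pi.single i.1 (y i.1 i.2))
      (Sum.elim (fun i : Σ s, ι s => Pi.single i.1 (x' i.1 i.2))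
        fun i : Σ s, κ s => Pi.single i.1 (y' i.1 i.2)) (∏ s, d s) := by
  have := (DetMod.sigma h).reindex (Equiv.sigmaSumDistrib ι κ).symm
  convert this using 1 <;> ext (i | i) : 1 <;> rfl

end DetMod

/-! ### The commutator of two commuting automorphisms along a lattice -/

section Commutator
variable {k V : Type*} [CommRing k] [AddCommGroup V] [Module k V]

/-- `ρ` is the symbol of the automorphisms `f` and `g`, that enlarge the lattice `W`: for bases `e`
of `f W / W` and `d` of `g W / W`, both `(e, f d)` and `(g e, d)` are bases of `f g W / W`, and `ρ`
is the determinant of the change of basis. -/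
def IsLatticeSymbol (W : Submodule k V) (f g : V ≃ₗ[k] V) (ρ : k) : Prop :=
  ∃ (p q : ℕ) (e : Fin p → V) (d : Fin q → V),
    IsBasisMod W (W.map f.toLinearMap) e ∧ IsBasisMod W (W.map g.toLinearMap) d ∧
    DetMod W (Sum.elim e fun i => f (d i)) (Sum.elim (fun i => g (e i)) d) ρ

/-- `ρ` is the symbol of the automorphisms `f` and `g`, that shrink the submodule `A`: for bases `e`
of `A / f A` and `d` of `A / g A`, both `(e, f d)` and `(g e, d)` are bases of `A / f g A`, and `ρ`
is the determinant of the change of basis. -/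
def IsDiscreteSymbol (A : Submodule k V) (f g : V ≃ₗ[k] V) (ρ : k) : Prop :=
  ∃ (p q : ℕ) (e : Fin p → V) (d : Fin q → V),
    IsBasisMod (A.map f.toLinearMap) A e ∧ IsBasisMod (A.map g.toLinearMap) A d ∧
    DetMod ((A.map g.toLinearMap).map f.toLinearMap) (Sum.elim e fun i => f (d i))
      (Sum.elim (fun i => g (e i)) d) ρ

lemma IsBasisMod.le_sup_span {ι : Type*} [Fintype ι] {N M : Submodule k V} {b : ι → V}
    (h : IsBasisMod N M b) : M ≤ N ⊔ Submodule.span k (Set.range b) := fun m hm => by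
  obtain ⟨c, hc⟩ := h.span m hm
  rw [← sub_add_cancel m (∑ i, c i • b i)]
  exact Submodule.add_mem_sup hc
    ((Submodule.mem_span_range_iff_exists_fun k).mpr ⟨c, rfl⟩)

variable {W A : Submodule k V} {f g : V ≃ₗ[k] V} {ρ : k}

/-- The bases in the lattice symbol may be taken in `A` if `A + W = V`. -/
lemma IsLatticeSymbol.exists_mem (hAW : A ⊔ W = ⊤)
    (hf : W ≤ W.map f.toLinearMap) (hg : W ≤ W.map g.toLinearMap) (h : IsLatticeSymbol W f g ρ) :
    ∃ (p q : ℕ) (e : Fin p → V) (d : Fin q → V),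
      (∀ i, e i ∈ A) ∧ (∀ i, d i ∈ A) ∧
      IsBasisMod W (W.map f.toLinearMap) e ∧ IsBasisMod W (W.map g.toLinearMap) d ∧
      DetMod W (Sum.elim e fun i => f (d i)) (Sum.elim (fun i => g (e i)) d) ρ := by
  obtain ⟨p, q, e, d, he, hd, hρ⟩ := h
  have key : ∀ v : V, ∃ a ∈ A, a - v ∈ W := fun v => by
    obtain ⟨a, ha, w, hw, h⟩ := Submodule.mem_sup.mp (hAW ▸ Submodule.mem_top : v ∈ A ⊔ W)
    exact ⟨a, ha, by rw [← h, sub_add_cancel_left]; exact W.neg_mem hw⟩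
  choose e' he'A he' using fun i => key (e i)
  choose d' hd'A hd' using fun i => key (d i)
  have he'b : IsBasisMod W (W.map f.toLinearMap) e' := he.congr he' fun i => by
    have := add_mem (hf (he' i)) (he.mem i)
    rwa [sub_add_cancel] at this
  have hd'b : IsBasisMod W (W.map g.toLinearMap) d' := hd.congr hd' fun i => by
    have := add_mem (hg (hd' i)) (hd.mem i)
    rwa [sub_add_cancel] at this
  refine ⟨p, q, e', d', he'A, hd'A, he'b, hd'b, ?_⟩
  have h1 : DetMod W (Sum.elim e' fun i => f (d' i)) (Sum.elim e fun i => f (d' i)) 1 := by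
    refine .of_sub_mem ?_
    rintro (i | i)
    · simpa using W.neg_mem (he' i)
    · simp
  have h2 : DetMod W (Sum.elim e fun i => f (d' i)) (Sum.elim e fun i => f (d i)) 1 := by
    refine .sumElim_right (.of_sub_mem fun i => he.le_sup_span ?_)
    rw [← map_sub]
    exact Submodule.mem_map_of_mem (by simpa using W.neg_mem (hd' i))
  have h3 : DetMod W (Sum.elim (fun i => g (e i)) d) (Sum.elim (fun i => g (e i)) d') 1 := by
    refine .of_sub_mem ?_
    rintro (i | i)
    · simp
    · exact hd' i
  have h4 : DetMod W (Sum.elim (fun i => g (e i)) d') (Sum.elim (fun i => g (e' i)) d') 1 := by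
    refine .sumElim_left (.of_sub_mem fun i => hd'b.le_sup_span ?_)
    rw [← map_sub]
    exact Submodule.mem_map_of_mem (he' i)
  simpa using (((h1.trans h2).trans hρ).trans h3).trans h4

/-- The bases in the discrete symbol may be taken in `f W` and `g W` if `A + W = V`. -/
lemma IsDiscreteSymbol.exists_mem (hAW : A ⊔ W = ⊤)
    (hf : A.map f.toLinearMap ≤ A) (hg : A.map g.toLinearMap ≤ A) (hfg : ∀ v, f (g v) = g (f v))
    (h : IsDiscreteSymbol A f g ρ) :
    ∃ (p q : ℕ) (e : Fin p → V) (d : Fin q → V),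
      (∀ i, e i ∈ W.map f.toLinearMap) ∧ (∀ i, d i ∈ W.map g.toLinearMap) ∧
      IsBasisMod (A.map f.toLinearMap) A e ∧ IsBasisMod (A.map g.toLinearMap) A d ∧
      DetMod ((A.map g.toLinearMap).map f.toLinearMap) (Sum.elim e fun i => f (d i))
        (Sum.elim (fun i => g (e i)) d) ρ := by
  obtain ⟨p, q, e, d, he, hd, hρ⟩ := h
  have key : ∀ (φ : V ≃ₗ[k] V) (v : V), ∃ w ∈ W.map φ.toLinearMap,
      w - v ∈ A.map φ.toLinearMap := fun φ v => by
    obtain ⟨a, ha, w, hw, h⟩ :=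
      Submodule.mem_sup.mp (hAW ▸ Submodule.mem_top : φ.symm v ∈ A ⊔ W)
    refine ⟨φ w, Submodule.mem_map_of_mem hw, ?_⟩
    have : φ w - v = φ (-a) := by
      rw [← φ.apply_symm_apply v, ← h, ← map_sub]; simp
    rw [this]
    exact Submodule.mem_map_of_mem (A.neg_mem ha)
  choose e' he'W he' using fun i => key f (e i)
  choose d' hd'W hd' using fun i => key g (d i)
  have he'b : IsBasisMod (A.map f.toLinearMap) A e' := he.congr he' fun i => by
    have := add_mem (hf (he' i)) (he.mem i)
    rwa [sub_add_cancel] at this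
  have hd'b : IsBasisMod (A.map g.toLinearMap) A d' := hd.congr hd' fun i => by
    have := add_mem (hg (hd' i)) (hd.mem i)
    rwa [sub_add_cancel] at this
  refine ⟨p, q, e', d', he'W, hd'W, he'b, hd'b, ?_⟩
  have hcomm : (A.map f.toLinearMap).map g.toLinearMap =
      (A.map g.toLinearMap).map f.toLinearMap := by
    rw [← Submodule.map_comp, ← Submodule.map_comp]
    congr 1
    ext v
    simp [hfg]
  have hspan : ∀ (φ : V ≃ₗ[k] V) {N : Submodule k V} {n : ℕ} {b : Fin n → V},
      IsBasisMod N A b → A.map φ.toLinearMap ≤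
        N.map φ.toLinearMap ⊔ Submodule.span k (Set.range fun i => φ (b i)) := by
    intro φ N n b hb
    refine (Submodule.map_mono hb.le_sup_span).trans ?_
    rw [Submodule.map_sup, Submodule.map_span, ← Set.range_comp]
    rfl
  set N := (A.map g.toLinearMap).map f.toLinearMap
  have h1 : DetMod N (Sum.elim e' fun i => f (d' i)) (Sum.elim e fun i => f (d' i)) 1 := by
    refine .sumElim_left (.of_sub_mem fun i => hspan f hd'b ?_)
    simpa using neg_mem (he' i)
  have h2 : DetMod N (Sum.elim e fun i => f (d' i)) (Sum.elim e fun i => f (d i)) 1 := by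
    refine .of_sub_mem ?_
    rintro (i | i)
    · simp
    · simp only [Sum.elim_inr, ← map_sub]
      exact Submodule.mem_map_of_mem (by simpa using neg_mem (hd' i))
  have h3 : DetMod N (Sum.elim (fun i => g (e i)) d) (Sum.elim (fun i => g (e i)) d') 1 := by
    refine .sumElim_right (.of_sub_mem fun i => ?_)
    rw [← hcomm]
    exact hspan g he (hd' i)
  have h4 : DetMod N (Sum.elim (fun i => g (e i)) d') (Sum.elim (fun i => g (e' i)) d') 1 := by
    refine .of_sub_mem ?_
    rintro (i | i)
    · simp only [Sum.elim_inl, ← map_sub, ← hcomm]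
      exact Submodule.mem_map_of_mem (he' i)
    · simp
  simpa using (((h1.trans h2).trans hρ).trans h3).trans h4

section Triples
variable {ι κ τ : Type*} [Fintype ι] [DecidableEq ι] [Fintype κ] [DecidableEq κ]
  [Fintype τ] [DecidableEq τ] {N : Submodule k V}

lemma DetMod.triple₁₂ {x x' : ι → V} {y y' : κ → V} {d : k}
    (h : DetMod N (Sum.elim x y) (Sum.elim x' y') d) (z : τ → V) :
    DetMod N (Sum.elim x (Sum.elim y z)) (Sum.elim x' (Sum.elim y' z)) d := by
  have h1 : DetMod N (Sum.elim (Sum.elim x y) z) (Sum.elim (Sum.elim x' y') z) d :=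
    .sumElim_left (h.mono le_sup_left)
  have := h1.reindex (Equiv.sumAssoc ι κ τ).symm
  convert this using 1 <;> ext (i | i | i) <;> rfl

lemma DetMod.triple₁₃ {x x' : ι → V} {z z' : τ → V} {d : k}
    (h : DetMod N (Sum.elim x z) (Sum.elim x' z') d) (y : κ → V) :
    DetMod N (Sum.elim x (Sum.elim y z)) (Sum.elim x' (Sum.elim y z')) d := by
  have := (h.triple₁₂ y).reindex (Equiv.sumCongr (Equiv.refl ι) (Equiv.sumComm κ τ))
  convert this using 1 <;> ext (i | i | i) <;> rfl

end Triples

/-- If `H = A ∩ W` is free on `h` and `A + W = V`, then two bases of `A ∩ f W` are given by `h` and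
a basis `e` of `f W / W`, and by `f h` and a basis `e'` of `A / f A`. -/
lemma isBasisMod_inter {ι κ κ' : Type*} [Fintype ι] [Fintype κ] [Fintype κ'] {h : ι → V}
    {e : κ → V} {e' : κ' → V} (hh : IsBasisMod ⊥ (A ⊓ W) h)
    (hfW : W ≤ W.map f.toLinearMap) (hfA : A.map f.toLinearMap ≤ A)
    (he : IsBasisMod W (W.map f.toLinearMap) e) (heA : ∀ i, e i ∈ A)
    (he' : IsBasisMod (A.map f.toLinearMap) A e') (heW : ∀ i, e' i ∈ W.map f.toLinearMap) :
    IsBasisMod ⊥ (A ⊓ W.map f.toLinearMap) (Sum.elim h e) ∧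
      IsBasisMod ⊥ (A ⊓ W.map f.toLinearMap) (Sum.elim (fun i => f (h i)) e') := by
  have hm : (A ⊓ W).map f.toLinearMap = A.map f.toLinearMap ⊓ W.map f.toLinearMap :=
    Submodule.map_inf _ f.injective
  constructor
  · refine hh.sumElim (M := A ⊓ W) ?_ bot_le (inf_le_inf_left A hfW)
    refine ⟨fun i => ⟨heA i, he.mem i⟩, fun c hc => he.indep c hc.2, fun m hm => ?_⟩
    obtain ⟨c, hc⟩ := he.span m hm.2
    exact ⟨c, A.sub_mem hm.1 (A.sum_mem fun i _ => A.smul_mem _ (heA i)), hc⟩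
  · have h1 := hh.map f.toLinearMap f.injective
    rw [Submodule.map_bot] at h1
    refine h1.sumElim ?_ bot_le (hm.le.trans (inf_le_inf_right _ hfA))
    rw [hm]
    refine ⟨fun i => ⟨he'.mem i, heW i⟩, fun c hc => he'.indep c hc.1, fun m hm => ?_⟩
    obtain ⟨c, hc⟩ := he'.span m hm.1
    exact ⟨c, hc, Submodule.sub_mem _ hm.2
      (Submodule.sum_mem _ fun i _ => Submodule.smul_mem _ _ (heW i))⟩

/-- The symbol of `f` and `g` computed along a lattice `W` agrees with the one computed along a
complementary submodule `A`, provided `A + W` is everything and `A ∩ W` is free of finite rank: with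
bases `h` of `A ∩ W` and `e`, `d`, `e'`, `d'` of `f W / W`, `g W / W`, `A / f A`, `A / g A`
lifted to `A ∩ f W` and `A ∩ g W`, the families `(h, e, f d)`, `(h, g e, d)`,
`(f g h, e', f d')` and `(f g h, g e', d')` are bases of `A ∩ f g W`; the first two differ by the lattice symbol, the last
two by the discrete symbol, and the determinant between the first and the third is the one between
the second and the fourth. -/
theorem IsLatticeSymbol.eq_of_isDiscreteSymbol [Nontrivial k] {n : ℕ} {h : Fin n → V} {ρ' : k}
    (hAW : A ⊔ W = ⊤) (hh : IsBasisMod ⊥ (A ⊓ W) h)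
    (hfW : W ≤ W.map f.toLinearMap) (hgW : W ≤ W.map g.toLinearMap)
    (hfA : A.map f.toLinearMap ≤ A) (hgA : A.map g.toLinearMap ≤ A)
    (hfg : ∀ v, f (g v) = g (f v))
    (hρ : IsLatticeSymbol W f g ρ) (hρ' : IsDiscreteSymbol A f g ρ') : ρ = ρ' := by
  obtain ⟨p, q, e, d, heA, hdA, he, hd, hρ⟩ := hρ.exists_mem hAW hfW hgW
  obtain ⟨p', q', e', d', heW, hdW, he', hd', hρ'⟩ := hρ'.exists_mem hAW hfA hgA hfg
  obtain ⟨be, be'⟩ := isBasisMod_inter hh hfW hfA he heA he' heW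
  obtain ⟨bd, bd'⟩ := isBasisMod_inter hh hgW hgA hd hdA hd' hdW
  obtain rfl : p = p' := by simpa using be.card_eq be'
  obtain rfl : q = q' := by simpa using bd.card_eq bd'
  obtain ⟨mf, hmf⟩ := be'.exists_detMod be
  obtain ⟨mg, hmg⟩ := bd'.exists_detMod bd
  -- a relation modulo `⊥` stays one after applying an automorphism
  have hmap : ∀ (φ : V ≃ₗ[k] V) {a b : ℕ} {x x' : Fin a → V} {y y' : Fin b → V} {m : k},
      DetMod ⊥ (Sum.elim x y) (Sum.elim x' y') m →
      DetMod ⊥ (Sum.elim (fun i => φ (x i)) fun i => φ (y i))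
        (Sum.elim (fun i => φ (x' i)) fun i => φ (y' i)) m := by
    intro φ a b x x' y y' m hm
    have := hm.map φ.toLinearMap
    rw [Submodule.map_bot] at this
    convert this using 1 <;> ext (i | i) <;> rfl
  have t1 : DetMod ⊥ (Sum.elim (fun i => f (g (h i))) (Sum.elim e' fun i => f (d' i)))
      (Sum.elim h (Sum.elim e fun i => f (d i))) ((mg : k) * mf) :=
    ((hmap f hmg).triple₁₃ e').trans (hmf.triple₁₂ fun i => f (d i))
  have t2 : DetMod ⊥ (Sum.elim (fun i => f (g (h i))) (Sum.elim (fun i => g (e' i)) d'))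
      (Sum.elim h (Sum.elim (fun i => g (e i)) d)) ((mf : k) * mg) := by
    simp only [hfg]
    exact ((hmap g hmf).triple₁₂ d').trans (hmg.triple₁₃ fun i => g (e i))
  -- the relations defining the two symbols, made exact
  have exact : ∀ {N : Submodule k V} {a : Fin n → V} {y z : Fin p ⊕ Fin q → V} {m : k}
      (M : Submodule k V), (∀ i, y i ∈ M) → (∀ i, z i ∈ M) → IsBasisMod ⊥ (M ⊓ N) a →
      DetMod N y z m → DetMod ⊥ (Sum.elim a y) (Sum.elim a z) m := by
    intro N a y z m M hy hz ha hm
    refine .sumElim_right ?_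
    obtain ⟨P, hP, hm⟩ := hm
    exact ⟨P, hP, fun j => ha.le_sup_span
      ⟨M.sub_mem (hz j) (M.sum_mem fun i _ => M.smul_mem _ (hy i)), hm j⟩⟩
  have hfd : ∀ v ∈ A, f v ∈ A := fun v hv => hfA (Submodule.mem_map_of_mem hv)
  have hge : ∀ v ∈ A, g v ∈ A := fun v hv => hgA (Submodule.mem_map_of_mem hv)
  have t3 : DetMod ⊥ (Sum.elim h (Sum.elim e fun i => f (d i)))
      (Sum.elim h (Sum.elim (fun i => g (e i)) d)) ρ :=
    exact A (by rintro (i | i); exacts [heA i, hfd _ (hdA i)])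
      (by rintro (i | i); exacts [hge _ (heA i), hdA i]) hh hρ
  have hcomm : ∀ M : Submodule k V, (M.map f.toLinearMap).map g.toLinearMap =
      (M.map g.toLinearMap).map f.toLinearMap := by
    intro M
    rw [← Submodule.map_comp, ← Submodule.map_comp]
    congr 1
    ext v
    simp [hfg]
  have hh' : IsBasisMod ⊥ ((W.map g.toLinearMap).map f.toLinearMap ⊓
      (A.map g.toLinearMap).map f.toLinearMap) fun i => f (g (h i)) := by
    have := (hh.map g.toLinearMap g.injective).map f.toLinearMap f.injective
    rw [Submodule.map_bot, Submodule.map_bot, inf_comm, Submodule.map_inf _ g.injective,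
      Submodule.map_inf _ f.injective] at this
    exact this
  have t4 : DetMod ⊥ (Sum.elim (fun i => f (g (h i))) (Sum.elim e' fun i => f (d' i)))
      (Sum.elim (fun i => f (g (h i))) (Sum.elim (fun i => g (e' i)) d')) ρ' := by
    refine exact _ ?_ ?_ hh' hρ'
    · rintro (i | i)
      · exact Submodule.map_mono hgW (heW i)
      · exact Submodule.mem_map_of_mem (hdW i)
    · rintro (i | i)
      · rw [← hcomm]
        exact Submodule.mem_map_of_mem (heW i)
      · rw [← hcomm]
        exact Submodule.map_mono hfW (hdW i)
  have hind : ∀ c : Fin n ⊕ (Fin p ⊕ Fin q) → k, ∑ i, c i • Sum.elim (fun i => f (g (h i)))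
      (Sum.elim e' fun i => f (d' i)) i ∈ (⊥ : Submodule k V) → c = 0 := by
    refine indep_sumElim bot_le hh'.mem hh'.indep fun c hc => ?_
    have h1 := (((hd'.map f.toLinearMap f.injective).sumElim he'
      (Submodule.map_mono hgA) hfA).reindex (Equiv.sumComm _ _)).indep c
    refine h1 ?_
    have h2 := hc.2
    rw [Fintype.sum_sum_type] at h2 ⊢
    exact h2
  have := DetMod.eq_of_indep hind (t1.trans t3) (t4.trans t2)
  rw [mul_comm ρ', mul_comm (mg : k)] at this
  exact (mf.isUnit.mul mg.isUnit).mul_left_cancel this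

end Commutator

/-! ### Weighted cyclic matrices -/

section Cyclic
variable {R : Type*} [CommRing R]

/-- For a permutation `σ` consisting of one cycle, only the identity and `σ` contribute to the
Leibniz expansion of `det (1 - Q)`, where `Q` is the permutation matrix of `σ` with weights `w`. -/
lemma det_one_sub_of_isCycle {ι : Type*} [Fintype ι] [DecidableEq ι] {σ : Equiv.Perm ι}
    (hσ : σ.IsCycle) (hs : σ.support = Finset.univ) (w : ι → R) :
    (1 - Matrix.of fun l m => if l = σ m then w m else 0 : Matrix ι ι R).det = 1 - ∏ m, w m := by
  have hne : ∀ m, σ m ≠ m := fun m => by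
    rw [← Equiv.Perm.mem_support, hs]; exact Finset.mem_univ m
  rw [Matrix.det_apply', ← Finset.sum_subset (Finset.subset_univ {1, σ})]
  · rw [Finset.sum_pair (fun h => by
      obtain ⟨m, hm, -⟩ := hσ
      rw [← h] at hm
      exact hm rfl)]
    have h1 : ∏ i, (1 - Matrix.of fun l m => if l = σ m then w m else 0 : Matrix ι ι R)
        ((1 : Equiv.Perm ι) i) i = 1 := Finset.prod_eq_one fun i _ => by
      simp [Ne.symm (hne i)]
    have h2 : ∏ i, (1 - Matrix.of fun l m => if l = σ m then w m else 0 : Matrix ι ι R) (σ i) i =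
        ∏ i, -w i := Finset.prod_congr rfl fun i _ => by
      simp [hne i]
    rw [h1, h2, hσ.sign, hs, Finset.prod_neg]
    simp only [Equiv.Perm.sign_one, Units.val_one, Int.cast_one, one_mul, Units.val_neg,
      Int.cast_neg, Units.val_pow_eq_pow_val, Int.cast_pow]
    rw [neg_mul, ← mul_assoc, ← mul_pow]
    simp [sub_eq_add_neg]
  · intro τ _ hτ
    simp only [Finset.mem_insert, Finset.mem_singleton, not_or] at hτ
    -- if every value `τ i` were `i` or `σ i`, the set where it is `σ i` would be `σ`-stable
    have h : ∃ i, τ i ≠ i ∧ τ i ≠ σ i := by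
      by_contra! hcon
      apply hτ.2
      have hstep : ∀ i, τ i = σ i → τ (σ i) = σ (σ i) := by
        intro i hi
        refine hcon _ fun h => hne i ?_
        rw [← hi] at h
        rw [← hi]
        exact τ.injective h
      obtain ⟨i, hi⟩ : ∃ i, τ i ≠ i := by
        by_contra! h
        exact hτ.1 (Equiv.ext h)
      have hpow : ∀ n : ℕ, τ ((σ ^ n) i) = σ ((σ ^ n) i) := by
        intro n
        induction n with
        | zero => exact hcon i hi
        | succ n ih =>
          rw [pow_succ']
          exact hstep _ ih
      ext j
      obtain ⟨n, rfl⟩ := hσ.exists_pow_eq (hne i) (hne j)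
      exact hpow n
    obtain ⟨i, hi, hi'⟩ := h
    rw [Finset.prod_eq_zero (Finset.mem_univ i), mul_zero]
    simp [hi, hi']

lemma sum_add_div_eq (n j : ℕ) (hn : 0 < n) : ∑ m : Fin n, (m + j) / n = j := by
  have := NeZero.of_pos hn
  have h1 : ∑ m : Fin n, ((m : ℕ) + j) % n = ∑ m : Fin n, (m : ℕ) := by
    rw [← Equiv.sum_comp (Equiv.addRight (Fin.ofNat n j)) fun m : Fin n => (m : ℕ)]
    refine Finset.sum_congr rfl fun m _ => ?_
    simp [Fin.val_add]
  have h2 : ∑ m : Fin n, ((m : ℕ) + j) = ∑ m : Fin n, (m : ℕ) + n * j := by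
    rw [Finset.sum_add_distrib]; simp
  have h3 : ∑ m : Fin n, ((m : ℕ) + j) =
      ∑ m : Fin n, ((m : ℕ) + j) % n + n * ∑ m : Fin n, ((m : ℕ) + j) / n := by
    rw [Finset.mul_sum, ← Finset.sum_add_distrib]
    exact Finset.sum_congr rfl fun m _ => (Nat.mod_add_div _ _).symm
  exact Nat.eq_of_mul_eq_mul_left hn (by omega)

lemma val_finRotate_pow (n j : ℕ) (m : Fin n) : ((finRotate n ^ j) m : ℕ) = (m + j) % n := by
  have := m.neZero
  induction j with
  | zero => simp [Nat.mod_eq_of_lt m.2]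
  | succ j ih =>
    rw [pow_succ', Equiv.Perm.mul_apply, finRotate_apply, Fin.val_add, ih]
    simp [add_assoc]

/-- If `n` and `j` are coprime, the exponents modulo `n` form one cycle under the addition of `j`,
and the weights `b a ^ ⌊(m + j) / n⌋` multiply to `a ^ j b ^ n`. -/
lemma det_cyclic_of_coprime (n j : ℕ) (hn : 0 < n) (hj : n.Coprime j) (a b : R) :
    (1 - Matrix.of fun l m : Fin n =>
        if (l : ℕ) = (m + j) % n then b * a ^ ((m + j) / n : ℕ) else 0 :
      Matrix (Fin n) (Fin n) R).det = 1 - a ^ j * b ^ n := by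
  have hprod : ∏ m : Fin n, b * a ^ (((m : ℕ) + j) / n) = a ^ j * b ^ n := by
    rw [Finset.prod_mul_distrib, Finset.prod_pow_eq_pow_sum, sum_add_div_eq n j hn]
    simp [mul_comm]
  rcases Nat.lt_or_ge 1 n with h1 | h1
  · have hc : (finRotate n).IsCycle := isCycle_finRotate_of_le h1
    have ho : orderOf (finRotate n) = n := by
      rw [hc.orderOf, support_finRotate_of_le h1]; simp
    have hc' : (finRotate n ^ j).IsCycle := hc.pow_iff.mpr (by rw [ho]; exact hj.symm)
    have hs : (finRotate n ^ j).support = Finset.univ := by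
      rw [Equiv.Perm.support_pow_coprime (by rw [ho]; exact hj.symm), support_finRotate_of_le h1]
    rw [← hprod, ← det_one_sub_of_isCycle hc' hs]
    congr 2
    ext l m
    simp only [Matrix.of_apply, Fin.ext_iff, val_finRotate_pow]
  · obtain rfl : n = 1 := by omega
    simp [Matrix.det_unique, Nat.mod_one, mul_comm]

/-- The determinant of `1 - b tʲ` on `R[t] / (tⁿ - a)`: modulo `g = (n, j)` the exponents decompose
into `g` cycles. -/
lemma det_cyclic (n j : ℕ) (hn : 0 < n) (a b : R) :
    (1 - Matrix.of fun l m : Fin n =>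
        if (l : ℕ) = (m + j) % n then b * a ^ ((m + j) / n : ℕ) else 0 :
      Matrix (Fin n) (Fin n) R).det =
      (1 - a ^ (j / n.gcd j) * b ^ (n / n.gcd j)) ^ n.gcd j := by
  obtain ⟨g, n', j', hg, hco, hn', hj'⟩ := Nat.exists_coprime' (Nat.gcd_pos_of_pos_left j hn)
  have hg' : n.gcd j = g := by
    rw [hn', hj', Nat.gcd_mul_right, hco, one_mul]
  have hn'0 : 0 < n' := Nat.pos_of_ne_zero (by rintro rfl; omega)
  subst hn' hj'
  rw [hg', Nat.mul_div_cancel _ hg, Nat.mul_div_cancel _ hg, ← det_cyclic_of_coprime n' j' hn'0 hco,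
    ← Matrix.det_submatrix_equiv_self finProdFinEquiv]
  have : ∀ M : Matrix (Fin n') (Fin n') R,
      M.det ^ g = (Matrix.blockDiagonal fun _ : Fin g => M).det :=
    fun M => by rw [Matrix.det_blockDiagonal]; simp
  rw [this]
  congr 1
  ext ⟨l, r⟩ ⟨m, s⟩
  have e1 : (s : ℕ) + g * m + j' * g = s + g * (m + j') := by ring
  have e2 : ((s : ℕ) + g * (m + j')) / (n' * g) = (m + j') / n' := by
    rw [mul_comm n', ← Nat.div_div_eq_div_mul, Nat.add_mul_div_left _ _ hg,
      Nat.div_eq_of_lt s.2, zero_add]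
  have e3 : ((s : ℕ) + g * (m + j')) % (n' * g) = s + g * ((m + j') % n') := by
    rw [mul_comm n', Nat.mod_mul, Nat.add_mul_div_left _ _ hg, Nat.div_eq_of_lt s.2, zero_add,
      Nat.add_mul_mod_self_left, Nat.mod_eq_of_lt s.2]
  have e4 : (r : ℕ) + g * l = s + g * ((m + j') % n') ↔ r = s ∧ (l : ℕ) = (m + j') % n' := by
    constructor
    · intro h
      have h1 := congrArg (· % g) h
      simp only [Nat.add_mul_mod_self_left, Nat.mod_eq_of_lt r.2, Nat.mod_eq_of_lt s.2] at h1
      exact ⟨Fin.ext h1, Nat.eq_of_mul_eq_mul_left hg (by omega)⟩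
    · rintro ⟨rfl, h⟩
      rw [h]
  simp only [Matrix.submatrix_apply, Matrix.sub_apply, Matrix.one_apply, Matrix.of_apply,
    finProdFinEquiv_apply_val, e1, e2, e3, e4, Matrix.blockDiagonal_apply,
    EmbeddingLike.apply_eq_iff_eq, Prod.mk.injEq]
  by_cases hrs : r = s <;> simp [hrs]

/-- The sign of the exchange of two blocks of sizes `p` and `q`. -/
lemma sign_sumComm_finSum (p q : ℕ) :
    Equiv.Perm.sign ((finSumFinEquiv (m := p) (n := q)).trans
      ((finCongr (add_comm p q)).trans
        (finSumFinEquiv.symm.trans (Equiv.sumComm (Fin q) (Fin p))))) = (-1) ^ (p * q) := by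
  -- conjugating with `finSumFinEquiv` turns the exchange of the blocks into a rotation
  have h : finSumFinEquiv.permCongr ((finSumFinEquiv (m := p) (n := q)).trans
      ((finCongr (add_comm p q)).trans
        (finSumFinEquiv.symm.trans (Equiv.sumComm (Fin q) (Fin p))))) = finRotate (p + q) ^ p := by
    ext x
    rw [val_finRotate_pow]
    simp only [Equiv.permCongr_apply, Equiv.trans_apply, Equiv.apply_symm_apply]
    obtain ⟨y, rfl⟩ := (finCongr (add_comm q p)).surjective x
    obtain ⟨y, rfl⟩ := finSumFinEquiv.surjective y
    rcases y with y | y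
    · have : ((y : ℕ) + p) % (p + q) = y + p := Nat.mod_eq_of_lt (by omega)
      simpa [finCongr, this] using add_comm p y
    · have : ((y : ℕ) + q + p) % (p + q) = y := by
        rw [show (y : ℕ) + q + p = y + (p + q) by ring, Nat.add_mod_right]
        exact Nat.mod_eq_of_lt (by omega)
      simp [finCongr, this]
  rw [← Equiv.Perm.sign_permCongr finSumFinEquiv, h, map_pow, sign_finRotate, ← pow_mul]
  rcases p with _ | p
  · simp
  · rw [show (p + 1 + q - 1) * (p + 1) = p * (p + 1) + (p + 1) * q by
      rw [show p + 1 + q - 1 = p + q by omega]; ring, pow_add,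
      (Nat.even_mul_succ_self p).neg_one_pow, one_mul]

end Cyclic

/-! ### Norms from `k[[t]] / (D)` -/

section Norm
variable {k : Type*} [CommRing k]

/-- The ideal of `k[[t]]` generated by `D`, as a `k`-submodule. -/
noncomputable def multiples (D : k⟦X⟧) : Submodule k k⟦X⟧ := (Ideal.span {D}).restrictScalars k

lemma mem_multiples {D f : k⟦X⟧} : f ∈ multiples D ↔ D ∣ f := by
  rw [multiples, Submodule.restrictScalars_mem, Ideal.mem_span_singleton]

lemma multiples_one : multiples (1 : k⟦X⟧) = ⊤ := by
  ext f; simp [mem_multiples]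

lemma map_mulLeft_multiples (D E : k⟦X⟧) :
    (multiples D).map (LinearMap.mulLeft k E) = multiples (E * D) := by
  ext f
  rw [Submodule.mem_map, mem_multiples]
  constructor
  · rintro ⟨x, hx, rfl⟩
    exact mul_dvd_mul_left E (mem_multiples.mp hx)
  · rintro ⟨x, rfl⟩
    exact ⟨D * x, mem_multiples.mpr (dvd_mul_right D x), (mul_assoc E D x).symm⟩

/-- The norm of `β` from `k[[t]] / (D)` to `k`. -/
noncomputable def quotNorm (D : k⟦X⟧) : k⟦X⟧ →* k :=
  (Algebra.norm k).comp (Ideal.Quotient.mk (Ideal.span {D})).toMonoidHom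

variable {D E β : k⟦X⟧} {ι : Type*} [Fintype ι] {b : ι → k⟦X⟧}

lemma isBasisMod_mul {κ : Type*} [Fintype κ] {b' : κ → k⟦X⟧}
    (hb : IsBasisMod (multiples D) ⊤ b) (hb' : IsBasisMod (multiples E) ⊤ b')
    (hE : Function.Injective fun x => E * x) :
    IsBasisMod (multiples (E * D)) ⊤ (Sum.elim (fun i => E * b i) b') := by
  have h1 := hb.map (LinearMap.mulLeft k E) hE
  rw [← multiples_one, map_mulLeft_multiples, map_mulLeft_multiples, mul_one] at h1
  exact h1.sumElim hb' (fun x hx => mem_multiples.mpr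
    ((dvd_mul_right E D).trans (mem_multiples.mp hx))) le_top

variable [DecidableEq ι]

/-- The norm is the determinant of the multiplication. -/
lemma detMod_quotNorm (hb : IsBasisMod (multiples D) ⊤ b) (β : k⟦X⟧) :
    DetMod (multiples D) b (fun i => β * b i) (quotNorm D β) := by
  let I := Ideal.span {D}
  have hsum : ∀ c : ι → k, Ideal.Quotient.mk I (∑ i, c i • b i) =
      ∑ i, c i • Ideal.Quotient.mk I (b i) := fun c => by
    rw [map_sum]; rfl
  have hli : LinearIndependent k fun i => Ideal.Quotient.mk I (b i) := by
    rw [Fintype.linearIndependent_iff]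
    intro c hc i
    refine congrFun (hb.indep c ?_) i
    rw [← hsum, Ideal.Quotient.eq_zero_iff_mem] at hc
    exact hc
  have hsp : ⊤ ≤ Submodule.span k (Set.range fun i => Ideal.Quotient.mk I (b i)) := by
    intro x _
    obtain ⟨x, rfl⟩ := Ideal.Quotient.mk_surjective x
    obtain ⟨c, hc⟩ := hb.span x trivial
    rw [Submodule.mem_span_range_iff_exists_fun]
    refine ⟨c, ?_⟩
    rw [← hsum, eq_comm, Ideal.Quotient.eq]
    exact hc
  let B := Module.Basis.mk hli hsp
  have hB : ∀ i, B i = Ideal.Quotient.mk I (b i) := fun i => Module.Basis.mk_apply hli hsp i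
  refine ⟨Algebra.leftMulMatrix B (Ideal.Quotient.mk I β), ?_, fun j => ?_⟩
  · rw [← Algebra.norm_eq_matrix_det]; rfl
  · change _ ∈ I
    rw [← Ideal.Quotient.eq, hsum, map_mul, ← hB]
    conv_lhs => rw [← B.sum_repr (Ideal.Quotient.mk I β * B j)]
    refine Finset.sum_congr rfl fun i _ => ?_
    rw [hB i, Algebra.leftMulMatrix_eq_repr_mul]

lemma quotNorm_eq_of_detMod (hb : IsBasisMod (multiples D) ⊤ b) {n : k}
    (h : DetMod (multiples D) b (fun i => β * b i) n) : quotNorm D β = n :=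
  DetMod.eq_of_indep hb.indep (detMod_quotNorm hb β) h

lemma quotNorm_congr {β' : k⟦X⟧} (h : D ∣ β - β') : quotNorm D β = quotNorm D β' := by
  change Algebra.norm k (Ideal.Quotient.mk _ β) = Algebra.norm k (Ideal.Quotient.mk _ β')
  rw [Ideal.Quotient.eq.mpr (Ideal.mem_span_singleton.mpr h)]

lemma DetMod.quotNorm_mul_left (hb : IsBasisMod (multiples D) ⊤ b) (β E : k⟦X⟧) :
    DetMod (multiples (E * D)) (fun i => E * b i) (fun i => E * (β * b i)) (quotNorm D β) := by
  rw [← map_mulLeft_multiples]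
  exact (detMod_quotNorm hb β).map (LinearMap.mulLeft k E)

/-- The norm is multiplicative in the modulus: on `k[[t]] / (E D)` the matrix of the multiplication
by `β` is block triangular for the filtration by `E k[[t]]`. -/
lemma quotNorm_mul {κ : Type*} [Fintype κ] [DecidableEq κ] {b' : κ → k⟦X⟧}
    (hb : IsBasisMod (multiples D) ⊤ b) (hb' : IsBasisMod (multiples E) ⊤ b')
    (hE : Function.Injective fun x => E * x) (β : k⟦X⟧) :
    quotNorm (E * D) β = quotNorm D β * quotNorm E β := by
  refine quotNorm_eq_of_detMod (isBasisMod_mul hb hb' hE) ?_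
  have h1 : DetMod (multiples (E * D)) (Sum.elim (fun i => E * b i) b')
      (Sum.elim (fun i => E * b i) fun i => β * b' i) (quotNorm E β) := by
    refine .sumElim_right ((detMod_quotNorm hb' β).mono ?_)
    have := (hb.map (LinearMap.mulLeft k E) hE).le_sup_span
    rwa [← multiples_one, map_mulLeft_multiples, map_mulLeft_multiples, mul_one] at this
  have h2 : DetMod (multiples (E * D)) (Sum.elim (fun i => E * b i) fun i => β * b' i)
      (Sum.elim (fun i => E * (β * b i)) fun i => β * b' i) (quotNorm D β) :=
    ((DetMod.quotNorm_mul_left hb β E).mono le_sup_left).sumElim_left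
  rw [mul_comm (quotNorm D β)]
  convert h1.trans h2 using 1
  ext (i | i) : 1
  · simp [mul_left_comm]
  · simp

lemma quotNorm_C (hb : IsBasisMod (multiples D) ⊤ b) (c : k) :
    quotNorm D (PowerSeries.C c) = c ^ Fintype.card ι := by
  refine quotNorm_eq_of_detMod hb ⟨c • 1, by simp, fun j => ?_⟩
  simp [Matrix.one_apply, ite_smul, PowerSeries.smul_eq_C_mul]

/-- The powers `1, t, …, t ^ (p - 1)`. -/
noncomputable def monomials (k : Type*) [CommRing k] (p : ℕ) (i : Fin p) : k⟦X⟧ :=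
  PowerSeries.X ^ (i : ℕ)

end Norm

section Distinguished
variable {k : Type*} [CommRing k]

lemma sum_smul_monomials (p : ℕ) (c : Fin p → k) : ∑ i, c i • monomials k p i =
    ((∑ i, Polynomial.C (c i) * Polynomial.X ^ (i : ℕ) : k[X]) : k⟦X⟧) := by
  rw [← Polynomial.coeToPowerSeries.ringHom_apply, map_sum]
  simp [monomials, PowerSeries.smul_eq_C_mul]

/-- Multiplying `1, …, t ^ (q - 1)` by `t ^ p` or by a monic polynomial of degree `p` is the same up
to a unitriangular matrix, modulo `1, …, t ^ (p - 1)`. -/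
lemma detMod_monomials [Nontrivial k] {D : k[X]} (hD : D.Monic) (q : ℕ) :
    DetMod ⊥
      (Sum.elim (monomials k D.natDegree) fun i => PowerSeries.X ^ D.natDegree * monomials k q i)
      (Sum.elim (monomials k D.natDegree) fun i => (D : k⟦X⟧) * monomials k q i) (1 : k) := by
  set p := D.natDegree with hp
  refine .sumElim_right ⟨Matrix.of fun i j => (D * Polynomial.X ^ (j : ℕ)).coeff (p + i), ?_, ?_⟩
  · rw [Matrix.det_of_isUpperTriangular]
    · refine Finset.prod_eq_one fun i _ => ?_
      rw [Matrix.of_apply, Polynomial.coeff_mul_X_pow]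
      exact hD
    · intro i j hij
      rw [Matrix.of_apply, Polynomial.coeff_eq_zero_of_natDegree_lt]
      rw [hD.natDegree_mul (Polynomial.monic_X_pow _), Polynomial.natDegree_X_pow]
      exact Nat.add_lt_add_left hij p
  · intro j
    have h1 := (D * Polynomial.X ^ (j : ℕ)).as_sum_range' (p + q) (by
      rw [hD.natDegree_mul (Polynomial.monic_X_pow _), Polynomial.natDegree_X_pow]
      have := j.2
      omega)
    rw [Finset.sum_range_add, Finset.sum_range, Finset.sum_range] at h1
    have h2 := congrArg (fun P : k[X] => (P : k⟦X⟧)) h1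
    simp only [Polynomial.coe_mul, Polynomial.coe_pow, Polynomial.coe_X, Polynomial.coe_add] at h2
    rw [bot_sup_eq, Submodule.mem_span_range_iff_exists_fun]
    refine ⟨fun i => (D * Polynomial.X ^ (j : ℕ)).coeff i, ?_⟩
    rw [sum_smul_monomials, eq_sub_iff_add_eq]
    change _ = (D : k⟦X⟧) * PowerSeries.X ^ (j : ℕ)
    rw [h2]
    congr 1
    · simp only [Polynomial.C_mul_X_pow_eq_monomial]
    · rw [← Polynomial.coeToPowerSeries.ringHom_apply, map_sum]
      refine Finset.sum_congr rfl fun i _ => ?_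
      rw [← Polynomial.C_mul_X_pow_eq_monomial, map_mul, map_pow]
      simp [monomials, PowerSeries.smul_eq_C_mul, pow_add]

/-- Exchanging the two blocks of `1, …, t ^ (p + q - 1)` gives the sign `(-1) ^ (p q)`. -/
lemma detMod_monomials_swap (p q : ℕ) :
    DetMod ⊥ (Sum.elim (fun i => PowerSeries.X ^ q * monomials k p i) (monomials k q))
      (Sum.elim (monomials k p) fun i => PowerSeries.X ^ p * monomials k q i)
      ((-1) ^ (p * q) : k) := by
  have := DetMod.perm (⊥ : Submodule k k⟦X⟧)
    (Sum.elim (fun i => PowerSeries.X ^ q * monomials k p i) (monomials k q))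
    ((finSumFinEquiv (m := p) (n := q)).trans ((finCongr (add_comm p q)).trans
      (finSumFinEquiv.symm.trans (Equiv.sumComm (Fin q) (Fin p)))))
  rw [sign_sumComm_finSum] at this
  have hs : ∀ x : Fin p ⊕ Fin q,
      Sum.elim (monomials k p) (fun i => PowerSeries.X ^ p * monomials k q i) x =
        PowerSeries.X ^ (finSumFinEquiv x : ℕ) := by
    rintro (i | i) <;> simp [monomials, pow_add]
  have hs' : ∀ x : Fin q ⊕ Fin p,
      Sum.elim (fun i => PowerSeries.X ^ q * monomials k p i) (monomials k q) x.swap =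
        PowerSeries.X ^ (finSumFinEquiv x : ℕ) := by
    rintro (i | i) <;> simp [monomials, pow_add]
  convert this using 1
  · ext x : 1
    simp only [Function.comp_apply, Equiv.trans_apply, Equiv.sumComm_apply, hs, hs',
      Equiv.apply_symm_apply]
    simp [finCongr]
  · simp

variable [IsLocalRing k] [IsArtinianRing k]

instance : IsAdicComplete (IsLocalRing.maximalIdeal k) k :=
  isAdicComplete_of_isNilpotent (IsLocalRing.jacobson_eq_maximalIdeal (⊥ : Ideal k) bot_ne_top ▸
      IsArtinianRing.isNilpotent_jacobson_bot)

variable {D E : k[X]} (hD : D.IsDistinguishedAt (IsLocalRing.maximalIdeal k))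
  (hE : E.IsDistinguishedAt (IsLocalRing.maximalIdeal k))

/-- Weierstrass division: `1, …, t ^ (p - 1)` is a basis modulo a distinguished polynomial of
degree `p`. -/
lemma isBasisMod_monomials (hD : D.IsDistinguishedAt (IsLocalRing.maximalIdeal k)) :
    IsBasisMod (multiples (D : k⟦X⟧)) ⊤ (monomials k D.natDegree) := by
  have ho : ((D : k⟦X⟧).map (Ideal.Quotient.mk (IsLocalRing.maximalIdeal k))).order.toNat =
      D.natDegree := by
    rw [← hD.coe_natDegree_eq_order_map D 1 (by
      rw [PowerSeries.constantCoeff_one, ← Ideal.ne_top_iff_one]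
      exact Ideal.IsPrime.ne_top inferInstance) (by simp)]
    simp
  have hw := hD.isWeierstrassDivisorAt'
  refine ⟨fun _ => trivial, fun c hc => ?_, fun f _ => ?_⟩
  · rw [sum_smul_monomials, mem_multiples] at hc
    obtain ⟨q, hq⟩ := hc
    have h1 := (hw.eq_zero_of_mul_eq (by
      rw [ho]
      exact Polynomial.degree_sum_fin_lt c) hq.symm).2
    ext i
    have h2 := congrArg (fun P => Polynomial.coeff P (i : ℕ)) h1
    simpa [Polynomial.finsetSum_coeff, Polynomial.coeff_X_pow, Fin.val_inj] using h2
  · have h1 := hw.isWeierstrassDivisionAt_div_mod f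
    refine ⟨fun i => (hw.mod f).coeff i, ?_⟩
    rw [sum_smul_monomials, mem_multiples]
    have h2 : hw.mod f = ∑ i : Fin D.natDegree,
        Polynomial.C ((hw.mod f).coeff i) * Polynomial.X ^ (i : ℕ) := by
      have h3 := h1.degree_lt
      rw [ho] at h3
      ext n
      rw [← Finset.sum_range fun i => Polynomial.C ((hw.mod f).coeff i) * Polynomial.X ^ i,
        Polynomial.finsetSum_coeff]
      simp only [Polynomial.coeff_C_mul_X_pow, Finset.sum_ite_eq, Finset.mem_range]
      split_ifs with hn
      · rfl
      · exact Polynomial.coeff_eq_zero_of_degree_lt (h3.trans_le (by exact_mod_cast not_lt.mp hn))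
    rw [← h2]
    exact ⟨hw.div f, by rw [sub_eq_iff_eq_add]; exact h1.eq_mul_add⟩

lemma mul_left_injective_of_isDistinguishedAt
    (hD : D.IsDistinguishedAt (IsLocalRing.maximalIdeal k)) :
    Function.Injective fun x : k⟦X⟧ => (D : k⟦X⟧) * x := by
  intro x y h
  have h1 : (D : k⟦X⟧) * (x - y) = ((0 : k[X]) : k⟦X⟧) := by
    rw [mul_sub, sub_eq_zero.mpr h, Polynomial.coe_zero]
  refine sub_eq_zero.mp (hD.isWeierstrassDivisorAt'.eq_zero_of_mul_eq ?_ h1).1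
  rw [Polynomial.degree_zero]
  exact WithBot.bot_lt_coe _

lemma quotNorm_mul_of_isDistinguishedAt (hD : D.IsDistinguishedAt (IsLocalRing.maximalIdeal k))
    (hE : E.IsDistinguishedAt (IsLocalRing.maximalIdeal k)) (β : k⟦X⟧) :
    quotNorm ((D * E : k[X]) : k⟦X⟧) β = quotNorm (D : k⟦X⟧) β * quotNorm (E : k⟦X⟧) β := by
  rw [Polynomial.coe_mul, quotNorm_mul (isBasisMod_monomials hE) (isBasisMod_monomials hD)
    (mul_left_injective_of_isDistinguishedAt hD), mul_comm]

/-- The symbol of `α D` and `β E`, for power series `α` and `β` with unit constant term and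
distinguished polynomials `D` and `E`. -/
lemma detMod_symbol (hD : D.IsDistinguishedAt (IsLocalRing.maximalIdeal k))
    (hE : E.IsDistinguishedAt (IsLocalRing.maximalIdeal k)) (α β : (k⟦X⟧)ˣ) :
    DetMod (multiples ((D * E : k[X]) : k⟦X⟧))
      (Sum.elim (fun i => (β * E : k⟦X⟧) * monomials k D.natDegree i) (monomials k E.natDegree))
      (Sum.elim (monomials k D.natDegree) fun i => (α * D : k⟦X⟧) * monomials k E.natDegree i)
      (((-1) ^ (D.natDegree * E.natDegree) * Units.map (quotNorm (E : k⟦X⟧)) α *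
        (Units.map (quotNorm (D : k⟦X⟧)) β)⁻¹ : kˣ) : k) := by
  have h1 := ((DetMod.quotNorm_mul_left (isBasisMod_monomials hE) (α : k⟦X⟧) (D : k⟦X⟧)).mono
    le_sup_left).sumElim_right (x := monomials k D.natDegree)
  have h2 : DetMod _ _ _ ((Units.map (quotNorm (D : k⟦X⟧)) β : kˣ) : k) :=
    ((DetMod.quotNorm_mul_left (isBasisMod_monomials hD) (β : k⟦X⟧) (E : k⟦X⟧)).mono
      le_sup_left).sumElim_left (x := monomials k E.natDegree)
  rw [mul_comm (E : k⟦X⟧), ← Polynomial.coe_mul] at h2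
  rw [← Polynomial.coe_mul] at h1
  have h3 := (detMod_monomials hD.monic E.natDegree).mono
    (bot_le (a := multiples ((D * E : k[X]) : k⟦X⟧)))
  have h4 : DetMod ⊥ _ _ ((1 : kˣ) : k) := (detMod_monomials hE.monic D.natDegree).swap
  have h5 := h4.symm.mono (bot_le (a := multiples ((D * E : k[X]) : k⟦X⟧)))
  have h6 := (detMod_monomials_swap (k := k) D.natDegree E.natDegree).mono
    (bot_le (a := multiples ((D * E : k[X]) : k⟦X⟧)))
  have := (((h2.symm.trans h5).trans h6).trans h3).trans h1
  convert this using 1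
  · ext (i | i) : 1
    · simp [mul_assoc, mul_left_comm]
    · rfl
  · ext (i | i) : 1
    · rfl
    · simp [mul_assoc, mul_left_comm]
  · simp only [Units.val_mul, inv_one, Units.val_one, mul_one, Units.coe_map,
      Units.val_pow_eq_pow_val, Units.val_neg]
    ring_nf

end Distinguished

/-! ### Witt parameters and norms -/

section WittNorm
variable {k : Type*} [CommRing k]

lemma X_pow_dvd_prodSeries_sub_partialProd (p : ℕ → k) (I : ℕ) :
    (PowerSeries.X ^ (I + 1) : k⟦X⟧) ∣ prodSeries p - (partialProd p I : k[X]) := by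
  rw [PowerSeries.X_pow_dvd_iff]
  intro m hm
  rw [map_sub, coeff_prodSeries_of_le p (Nat.lt_succ_iff.mp hm), Polynomial.coeff_coe, sub_self]

lemma coe_dvd_X_pow {D : k[X]} {r n : ℕ} (h : D ∣ Polynomial.X ^ r) (hn : r ≤ n) :
    (D : k⟦X⟧) ∣ PowerSeries.X ^ n := by
  have := map_dvd (Polynomial.coeToPowerSeries.ringHom (R := k)) (h.trans (pow_dvd_pow _ hn))
  simpa using this

/-- The positive integers up to `N`. -/
def pnatsLE (N : ℕ) : Finset ℕ+ := (Finset.Icc 1 N).subtype (0 < ·)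

lemma mem_pnatsLE {N : ℕ} {i : ℕ+} : i ∈ pnatsLE N ↔ (i : ℕ) ≤ N :=
  Finset.mem_subtype.trans (Finset.mem_Icc.trans (and_iff_right i.2))

lemma prod_pnatsLE {M : Type*} [CommMonoid M] (N : ℕ) (f : ℕ → M) :
    ∏ i ∈ pnatsLE N, f i = ∏ i ∈ Finset.Icc 1 N, f i :=
  Finset.prod_subtype_of_mem f fun _ hx => (Finset.mem_Icc.mp hx).1

variable [IsLocalRing k]

lemma isDistinguishedAt_X_pow_sub_C {a : k} (ha : a ∈ IsLocalRing.maximalIdeal k) {i : ℕ}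
    (hi : 1 ≤ i) :
    (Polynomial.X ^ i - Polynomial.C a : k[X]).IsDistinguishedAt (IsLocalRing.maximalIdeal k) where
  monic := Polynomial.monic_X_pow_sub_C a (by omega)
  mem := by
    intro n hn
    rw [Polynomial.natDegree_X_pow_sub_C] at hn
    rw [Polynomial.coeff_sub, Polynomial.coeff_X_pow, if_neg (by omega), zero_sub,
      Polynomial.coeff_C]
    split_ifs
    · exact neg_mem ha
    · simp

lemma isDistinguishedAt_X_pow (n : ℕ) :
    (Polynomial.X ^ n : k[X]).IsDistinguishedAt (IsLocalRing.maximalIdeal k) where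
  monic := Polynomial.monic_X_pow n
  mem := by
    intro i hi
    rw [Polynomial.natDegree_X_pow] at hi
    rw [Polynomial.coeff_X_pow, if_neg (by omega)]
    exact zero_mem _

lemma isDistinguishedAt_prod {ι : Type*} (s : Finset ι) (D : ι → k[X])
    (hD : ∀ i ∈ s, (D i).IsDistinguishedAt (IsLocalRing.maximalIdeal k)) :
    (∏ i ∈ s, D i).IsDistinguishedAt (IsLocalRing.maximalIdeal k) := by
  classical
  induction s using Finset.induction_on with
  | empty => simpa using isDistinguishedAt_X_pow (k := k) 0
  | insert i s his ih =>
    rw [Finset.prod_insert his]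
    exact (hD i (Finset.mem_insert_self i s)).mul
      (ih fun j hj => hD j (Finset.mem_insert_of_mem hj))

/-- The distinguished polynomial `t ^ c · ∏_{1 ≤ i ≤ N} (tⁱ - a₋ᵢ)`. -/
noncomputable def WittParameters.distPoly (a : WittParameters k) (N c : ℕ) : k[X] :=
  Polynomial.X ^ c * ∏ i ∈ Finset.Icc 1 N, (Polynomial.X ^ i - Polynomial.C (a.param (-(i : ℤ))))

/-- The power series `a₀ · ∏_{i ≥ 1} (1 - aᵢ tⁱ)`. -/
noncomputable def WittParameters.series (a : WittParameters k) : k⟦X⟧ :=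
  PowerSeries.C (a.param 0) * prodSeries fun i => a.param (i : ℤ)

variable (a b : WittParameters k)

lemma WittParameters.isUnit_series : IsUnit a.series := by
  rw [PowerSeries.isUnit_iff_constantCoeff, series, map_mul, PowerSeries.constantCoeff_C,
    ← PowerSeries.coeff_zero_eq_constantCoeff_apply, coeff_prodSeries, coeff_zero_partialProd,
    mul_one]
  exact a.isUnit_zero

lemma WittParameters.isDistinguishedAt_factor {i : ℕ} (hi : 1 ≤ i) :
    (Polynomial.X ^ i - Polynomial.C (a.param (-(i : ℤ))) : k[X]).IsDistinguishedAt
      (IsLocalRing.maximalIdeal k) :=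
  isDistinguishedAt_X_pow_sub_C (a.mem_of_neg _ (by omega)) hi

lemma WittParameters.isDistinguishedAt_distPoly (N c : ℕ) :
    (a.distPoly N c).IsDistinguishedAt (IsLocalRing.maximalIdeal k) :=
  (isDistinguishedAt_X_pow c).mul (isDistinguishedAt_prod _ _ fun _ hi =>
    a.isDistinguishedAt_factor (Finset.mem_Icc.mp hi).1)

lemma WittParameters.natDegree_distPoly (N c : ℕ) :
    (a.distPoly N c).natDegree = c + ∑ i ∈ Finset.Icc 1 N, i := by
  rw [distPoly, (Polynomial.monic_X_pow c).natDegree_mul (isDistinguishedAt_prod _ _ fun _ hi =>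
    a.isDistinguishedAt_factor (Finset.mem_Icc.mp hi).1).monic, Polynomial.natDegree_X_pow,
    Polynomial.natDegree_prod_of_monic _ _ fun _ hi =>
      (a.isDistinguishedAt_factor (Finset.mem_Icc.mp hi).1).monic]
  congr 1
  exact Finset.sum_congr rfl fun i _ => Polynomial.natDegree_X_pow_sub_C

variable [IsArtinianRing k]

/-- Modulo a nilpotent polynomial a distinguished polynomial is a power of `t`, hence it divides a
power of `t`. -/
lemma exists_dvd_X_pow {D : k[X]} (hD : D.IsDistinguishedAt (IsLocalRing.maximalIdeal k)) :
    ∃ r : ℕ, D ∣ Polynomial.X ^ r := by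
  have h1 : IsNilpotent (Polynomial.X ^ D.natDegree - D) := by
    rw [Polynomial.isNilpotent_iff]
    intro i
    have h2 : (Polynomial.X ^ D.natDegree - D).coeff i ∈ IsLocalRing.maximalIdeal k := by
      rw [← Ideal.Quotient.eq_zero_iff_mem, ← Polynomial.coeff_map, Polynomial.map_sub,
        hD.map_eq_X_pow]
      simp
    obtain ⟨n, hn⟩ : IsNilpotent (IsLocalRing.maximalIdeal k) :=
      IsLocalRing.jacobson_eq_maximalIdeal (⊥ : Ideal k) bot_ne_top ▸
        IsArtinianRing.isNilpotent_jacobson_bot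
    refine ⟨n, ?_⟩
    have := Ideal.pow_mem_pow h2 n
    rwa [hn] at this
  obtain ⟨r, hr⟩ := h1
  refine ⟨D.natDegree * r, ?_⟩
  have := sub_dvd_pow_sub_pow (Polynomial.X ^ D.natDegree) (Polynomial.X ^ D.natDegree - D) r
  rwa [hr, sub_sub_cancel, sub_zero, ← pow_mul] at this

/-- A factor of the Contou-Carrère symbol is a norm: in the basis `1, …, t ^ (i - 1)` of
`k[[t]] / (tⁱ - a)` the matrix of `1 - b tʲ` is weighted cyclic. -/
lemma quotNorm_X_pow_sub_C {a : k} (ha : a ∈ IsLocalRing.maximalIdeal k) {i : ℕ} (hi : 1 ≤ i)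
    (b : k) (j : ℕ) :
    quotNorm ((Polynomial.X ^ i - Polynomial.C a : k[X]) : k⟦X⟧)
      (1 - PowerSeries.C b * PowerSeries.X ^ j) =
      (1 - a ^ (j / i.gcd j) * b ^ (i / i.gcd j)) ^ i.gcd j := by
  have hb := isBasisMod_monomials (isDistinguishedAt_X_pow_sub_C ha hi)
  rw [Polynomial.natDegree_X_pow_sub_C] at hb
  refine quotNorm_eq_of_detMod hb ⟨_, det_cyclic i j (by omega) a b, fun m => ?_⟩
  have h1 : ∑ l, (1 - Matrix.of fun l m : Fin i =>
        if (l : ℕ) = (m + j) % i then b * a ^ ((m + j) / i : ℕ) else 0 :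
          Matrix (Fin i) (Fin i) k) l m •
          monomials k i l = PowerSeries.X ^ (m : ℕ) -
      PowerSeries.C (b * a ^ ((m + j) / i : ℕ)) * PowerSeries.X ^ ((m + j) % i : ℕ) := by
    simp only [Matrix.sub_apply, Matrix.of_apply, sub_smul, Finset.sum_sub_distrib,
      Matrix.one_apply, ite_smul, one_smul, zero_smul, Finset.sum_ite_eq', Finset.mem_univ, if_true]
    congr 1
    rw [Finset.sum_eq_single (⟨(m + j) % i, Nat.mod_lt _ hi⟩ : Fin i)]
    · simp [monomials, PowerSeries.smul_eq_C_mul]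
    · intro l _ hl
      rw [if_neg fun h => hl (Fin.ext h)]
    · simp
  rw [h1, mem_multiples]
  have h2 : (1 - PowerSeries.C b * PowerSeries.X ^ j) * monomials k i m - (PowerSeries.X ^ (m : ℕ) -
      PowerSeries.C (b * a ^ ((m + j) / i : ℕ)) * PowerSeries.X ^ ((m + j) % i : ℕ)) =
      -(PowerSeries.C b * PowerSeries.X ^ ((m + j) % i : ℕ)) *
        ((PowerSeries.X ^ i) ^ ((m + j) / i : ℕ) - (PowerSeries.C a) ^ ((m + j) / i : ℕ)) := by
    have h3 : (PowerSeries.X : k⟦X⟧) ^ j * PowerSeries.X ^ (m : ℕ) =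
        PowerSeries.X ^ ((m + j) % i : ℕ) * (PowerSeries.X ^ i) ^ ((m + j) / i : ℕ) := by
      rw [← pow_add, ← pow_mul, ← pow_add, Nat.mod_add_div, add_comm]
    rw [map_mul, map_pow, monomials]
    linear_combination -PowerSeries.C b * h3
  rw [h2, Polynomial.coe_sub, Polynomial.coe_pow, Polynomial.coe_X, Polynomial.coe_C]
  exact (sub_dvd_pow_sub_pow _ _ _).mul_left _

lemma quotNorm_prod {ι : Type*} (s : Finset ι) (D : ι → k[X])
    (hD : ∀ i ∈ s, (D i).IsDistinguishedAt (IsLocalRing.maximalIdeal k)) (β : k⟦X⟧) :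
    quotNorm ((∏ i ∈ s, D i : k[X]) : k⟦X⟧) β = ∏ i ∈ s, quotNorm (D i : k⟦X⟧) β := by
  classical
  induction s using Finset.induction_on with
  | empty =>
    have h := isBasisMod_monomials (isDistinguishedAt_X_pow (k := k) 0)
    rw [Polynomial.natDegree_X_pow] at h
    rw [Finset.prod_empty, Finset.prod_empty, ← pow_zero (Polynomial.X : k[X])]
    exact quotNorm_eq_of_detMod h ⟨1, Matrix.det_one, fun i => i.elim0⟩
  | insert i s his ih =>
    have h1 : ∀ j ∈ s, (D j).IsDistinguishedAt (IsLocalRing.maximalIdeal k) :=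
      fun j hj => hD j (Finset.mem_insert_of_mem hj)
    rw [Finset.prod_insert his, Finset.prod_insert his, ← ih h1]
    exact quotNorm_mul_of_isDistinguishedAt (hD i (Finset.mem_insert_self i s))
      (isDistinguishedAt_prod s D h1) β

lemma quotNorm_X_pow (c : ℕ) (β : k⟦X⟧) :
    quotNorm ((Polynomial.X ^ c : k[X]) : k⟦X⟧) β = PowerSeries.constantCoeff β ^ c := by
  have hX := isDistinguishedAt_X_pow (k := k) 1
  have h1 : quotNorm ((Polynomial.X ^ 1 : k[X]) : k⟦X⟧) β = PowerSeries.constantCoeff β := by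
    rw [quotNorm_congr (β' := PowerSeries.C (PowerSeries.constantCoeff β)),
      quotNorm_C (isBasisMod_monomials hX)]
    · simp
    · rw [pow_one, Polynomial.coe_X, PowerSeries.X_dvd_iff]
      simp
  have h2 := quotNorm_prod (Finset.range c) (fun _ => Polynomial.X ^ 1) (fun _ _ => hX) β
  rw [Finset.prod_const, Finset.prod_const, Finset.card_range, pow_one] at h2
  rw [h2, ← h1, pow_one]

lemma quotNorm_partialProd (p : ℕ → k) (I N : ℕ) :
    quotNorm ((∏ i ∈ Finset.Icc 1 N, (Polynomial.X ^ i - Polynomial.C (a.param (-(i : ℤ)))) :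
        k[X]) : k⟦X⟧) (partialProd p I : k[X]) = ∏ x ∈ Finset.Icc 1 I ×ˢ Finset.Icc 1 N,
      (1 - p x.1 ^ (x.2 / x.1.gcd x.2) * a.param (-(x.2 : ℤ)) ^ (x.1 / x.1.gcd x.2)) ^
        x.1.gcd x.2 := by
  rw [quotNorm_prod _ _ fun i hi => a.isDistinguishedAt_factor (Finset.mem_Icc.mp hi).1,
    Finset.prod_product_right]
  refine Finset.prod_congr rfl fun i hi => ?_
  rw [partialProd, ← Polynomial.coeToPowerSeries.ringHom_apply (φ := ∏ _ ∈ _, _), map_prod,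
    map_prod]
  refine Finset.prod_congr rfl fun j _ => ?_
  have := quotNorm_X_pow_sub_C
    (a.mem_of_neg (-(i : ℤ)) (by have := (Finset.mem_Icc.mp hi).1; omega))
    (Finset.mem_Icc.mp hi).1 (p j) j
  rw [Nat.gcd_comm j i, mul_comm (p j ^ _), ← this]
  simp

/-- The norm of `b₀ ∏ (1 - bᵢ tⁱ)` modulo `t ^ c ∏ (tʲ - a₋ⱼ)` is the product of the factors of the
Contou-Carrère symbol. -/
lemma WittParameters.quotNorm_distPoly {N : ℕ} (hN : ∀ i : ℕ, N < i → a.param (-(i : ℤ)) = 0)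
    (c : ℕ) :
    Units.map (quotNorm (a.distPoly N c : k⟦X⟧)) b.isUnit_series.unit =
      b.isUnit_zero.unit ^ (a.distPoly N c).natDegree * ∏ᶠ p : ℕ+ × ℕ+, b.factor a p.1 p.2 := by
  have hdist := a.isDistinguishedAt_distPoly N c
  obtain ⟨r, hr⟩ := exists_dvd_X_pow hdist
  have hfin := b.finite_mulSupport_factor a
  obtain ⟨I, hI⟩ : ∃ I, ∀ p ∈ Function.mulSupport fun p : ℕ+ × ℕ+ => b.factor a p.1 p.2,
      (p.1 : ℕ) ≤ I := by
    obtain ⟨I, hI⟩ := (hfin.image fun p : ℕ+ × ℕ+ => (p.1 : ℕ)).bddAbove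
    exact ⟨I, fun p hp => hI ⟨p, hp, rfl⟩⟩
  set J := max I r with hJ
  have hsupp : (Function.mulSupport fun p : ℕ+ × ℕ+ => b.factor a p.1 p.2) ⊆
      ↑(pnatsLE J ×ˢ pnatsLE N) := by
    intro p hp
    rw [Finset.coe_product]
    refine ⟨mem_pnatsLE.mpr ((hI p hp).trans (le_max_left I r)), mem_pnatsLE.mpr ?_⟩
    by_contra h
    apply hp
    ext
    change (1 - _ * a.param (-(p.2 : ℤ)) ^ ((p.1 : ℕ) / Nat.gcd p.1 p.2)) ^ _ = (1 : k)
    have h2 : a.param (-(p.2 : ℤ)) = 0 := hN p.2 (by simpa using h)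
    have h3 : (p.1 : ℕ) / Nat.gcd p.1 p.2 ≠ 0 :=
      (Nat.div_pos (Nat.gcd_le_left _ p.1.2) (Nat.gcd_pos_of_pos_left _ p.1.2)).ne'
    rw [h2, zero_pow h3]
    simp
  rw [finprod_eq_prod_of_mulSupport_subset _ hsupp]
  ext
  rw [Units.coe_map, IsUnit.unit_spec, Units.val_mul, Units.val_pow_eq_pow_val, IsUnit.unit_spec,
    series]
  change quotNorm (a.distPoly N c : k⟦X⟧) _ = _
  rw [map_mul, quotNorm_C (isBasisMod_monomials hdist), Fintype.card_fin]
  congr 1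
  have hX : ∀ D : k[X], D ∣ a.distPoly N c →
      quotNorm (D : k⟦X⟧) (prodSeries fun i => b.param (i : ℤ)) =
      quotNorm (D : k⟦X⟧) (partialProd (fun i => b.param (i : ℤ)) J : k[X]) := fun D hD =>
    quotNorm_congr ((coe_dvd_X_pow (hD.trans hr) (by omega)).trans
      (X_pow_dvd_prodSeries_sub_partialProd _ J))
  rw [distPoly, quotNorm_mul_of_isDistinguishedAt (isDistinguishedAt_X_pow c)
    (isDistinguishedAt_prod _ _ fun i hi => a.isDistinguishedAt_factor (Finset.mem_Icc.mp hi).1),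
    quotNorm_X_pow, ← PowerSeries.coeff_zero_eq_constantCoeff_apply, coeff_prodSeries,
    coeff_zero_partialProd, one_pow, one_mul, hX _ (dvd_mul_left _ _), quotNorm_partialProd,
    Units.coe_prod, Finset.prod_product, Finset.prod_product, ← prod_pnatsLE]
  refine Finset.prod_congr rfl fun i _ => ?_
  rw [← prod_pnatsLE]
  exact Finset.prod_congr rfl fun j _ => rfl

end WittNorm

/-! ### The lattice symbol of Laurent series -/

section Laurent
variable {k : Type*} [CommRing k]

instance : SMulCommClass k k⸨X⸩ k⸨X⸩ := ⟨fun a f g => by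
  rw [smul_eq_mul, smul_eq_mul, ← HahnSeries.C_mul_eq_smul, ← HahnSeries.C_mul_eq_smul,
    mul_left_comm]⟩

instance : IsScalarTower k k⸨X⸩ k⸨X⸩ := ⟨fun a f g => by
  rw [smul_eq_mul, smul_eq_mul, ← HahnSeries.C_mul_eq_smul, ← HahnSeries.C_mul_eq_smul,
    mul_assoc]⟩

/-- The inclusion of `k[[t]]` in `k((t))`, as a `k`-linear map. -/
noncomputable def ofPowerSeriesLinear (k : Type*) [CommRing k] : k⟦X⟧ →ₗ[k] k⸨X⸩ where
  toFun := HahnSeries.ofPowerSeries ℤ k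
  map_add' := map_add _
  map_smul' c f := by
    rw [PowerSeries.smul_eq_C_mul, map_mul, HahnSeries.ofPowerSeries_C, HahnSeries.C_mul_eq_smul]
    rfl

/-- The lattice `k[[t]]` in `k((t))`. -/
noncomputable def powerSeriesLattice (k : Type*) [CommRing k] : Submodule k k⸨X⸩ :=
  LinearMap.range (ofPowerSeriesLinear k)

lemma ofPowerSeriesLinear_apply (f : k⟦X⟧) :
    ofPowerSeriesLinear k f = HahnSeries.ofPowerSeries ℤ k f := rfl

lemma mem_powerSeriesLattice {f : k⸨X⸩} :
    f ∈ powerSeriesLattice k ↔ ∃ g : k⟦X⟧, HahnSeries.ofPowerSeries ℤ k g = f := Iff.rfl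

lemma mulLeftLinearEquiv_inv_comp {R : Type*} [CommRing R] [Module k R] [SMulCommClass k R R]
    (u : Rˣ) : (u⁻¹.mulLeftLinearEquiv k R).toLinearMap ∘ₗ (u.mulLeftLinearEquiv k R).toLinearMap =
      LinearMap.id :=
  LinearMap.ext fun x => u.inv_mul_cancel_left x

lemma map_multiples {D : k⟦X⟧} {u : (k⸨X⸩)ˣ} (hu : (u : k⸨X⸩) = HahnSeries.ofPowerSeries ℤ k D) :
    (multiples D).map (ofPowerSeriesLinear k) =
      (powerSeriesLattice k).map (u.mulLeftLinearEquiv k (k⸨X⸩)).toLinearMap := by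
  ext f
  rw [Submodule.mem_map, Submodule.mem_map]
  constructor
  · rintro ⟨x, hx, rfl⟩
    obtain ⟨y, rfl⟩ := mem_multiples.mp hx
    refine ⟨_, ⟨y, rfl⟩, ?_⟩
    simp [ofPowerSeriesLinear_apply, hu]
  · rintro ⟨_, ⟨y, rfl⟩, rfl⟩
    exact ⟨D * y, mem_multiples.mpr (dvd_mul_right D y), by simp [ofPowerSeriesLinear_apply, hu]⟩

lemma multiples_unit_mul (α : (k⟦X⟧)ˣ) (D : k⟦X⟧) : multiples (α * D : k⟦X⟧) = multiples D := by
  ext f; rw [mem_multiples, mem_multiples, α.mul_left_dvd]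

end Laurent

lemma IsLatticeSymbol.of_families {k V : Type*} [CommRing k] [AddCommGroup V] [Module k V]
    {W : Submodule k V} {f g : V ≃ₗ[k] V} {ρ : k} {ι κ : Type*} [Fintype ι] [Fintype κ]
    [DecidableEq ι] [DecidableEq κ] {e : ι → V} {d : κ → V}
    (he : IsBasisMod W (W.map f.toLinearMap) e) (hd : IsBasisMod W (W.map g.toLinearMap) d)
    (h : DetMod W (Sum.elim e fun i => f (d i)) (Sum.elim (fun i => g (e i)) d) ρ) :
    IsLatticeSymbol W f g ρ := by
  refine ⟨_, _, _, _, he.reindex (Fintype.equivFin ι).symm,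
    hd.reindex (Fintype.equivFin κ).symm, ?_⟩
  have := h.reindex (Equiv.sumCongr (Fintype.equivFin ι).symm (Fintype.equivFin κ).symm)
  convert this using 1 <;> ext (i | i) <;> rfl

/-- The lattice symbol does not change if the lattice is moved by an automorphism that commutes with
`f` and `g`. -/
lemma IsLatticeSymbol.map {k V : Type*} [CommRing k] [AddCommGroup V] [Module k V]
    {W : Submodule k V} {f g : V ≃ₗ[k] V} {ρ : k} (h : IsLatticeSymbol W f g ρ) (φ : V ≃ₗ[k] V)
    (hf : ∀ v, φ (f v) = f (φ v)) (hg : ∀ v, φ (g v) = g (φ v)) :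
    IsLatticeSymbol (W.map φ.toLinearMap) f g ρ := by
  obtain ⟨p, q, e, d, he, hd, hρ⟩ := h
  have hcomm : ∀ ψ : V ≃ₗ[k] V, (∀ v, φ (ψ v) = ψ (φ v)) →
      (W.map ψ.toLinearMap).map φ.toLinearMap = (W.map φ.toLinearMap).map ψ.toLinearMap := by
    intro ψ h
    rw [← Submodule.map_comp, ← Submodule.map_comp]
    congr 1
    ext v
    exact h v
  have he' := he.map φ.toLinearMap φ.injective
  have hd' := hd.map φ.toLinearMap φ.injective
  rw [hcomm f hf] at he'
  rw [hcomm g hg] at hd'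
  refine ⟨p, q, _, _, he', hd', ?_⟩
  convert hρ.map φ.toLinearMap using 1
  · ext (i | i) : 1
    · rfl
    · exact (hf _).symm
  · ext (i | i) : 1
    · exact (hg _).symm
    · rfl

section Local
variable {k : Type*} [CommRing k] [IsLocalRing k] [IsArtinianRing k]

/-- The symbol, as the lattice symbol computes it, of the series `α D` and `β E`, where `α` and `β`
are invertible power series and `D` and `E` are distinguished polynomials. -/
noncomputable def distSymbol (D E : k[X]) (α β : (k⟦X⟧)ˣ) : kˣ :=
  (-1) ^ (D.natDegree * E.natDegree) * Units.map (quotNorm (E : k⟦X⟧)) α *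
    (Units.map (quotNorm (D : k⟦X⟧)) β)⁻¹

/-- The basis `u⁻¹, u⁻¹ t, …, u⁻¹ t ^ (p - 1)` of `u⁻¹ k[[t]]` modulo `k[[t]]`, for `u` of order
`p`. -/
noncomputable def polarFamily (u : (k⸨X⸩)ˣ) (p : ℕ) (i : Fin p) : k⸨X⸩ :=
  (u⁻¹ : (k⸨X⸩)ˣ) * HahnSeries.ofPowerSeries ℤ k (monomials k p i)

variable {D E : k[X]} {α β : (k⟦X⟧)ˣ} {u v : (k⸨X⸩)ˣ}

lemma isBasisMod_polarFamily (hD : D.IsDistinguishedAt (IsLocalRing.maximalIdeal k))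
    (hu : (u : k⸨X⸩) = HahnSeries.ofPowerSeries ℤ k (α * D)) :
    IsBasisMod (powerSeriesLattice k)
      ((powerSeriesLattice k).map (u⁻¹.mulLeftLinearEquiv k (k⸨X⸩)).toLinearMap)
      (polarFamily u D.natDegree) := by
  have h1 := (isBasisMod_monomials hD).map
    (ofPowerSeriesLinear k)
    (HahnSeries.ofPowerSeries_injective (Γ := ℤ) (R := k))
  rw [← multiples_unit_mul α, map_multiples hu, Submodule.map_top] at h1
  have h2 := h1.map (u⁻¹.mulLeftLinearEquiv k (k⸨X⸩)).toLinearMap (LinearEquiv.injective _)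
  rw [← Submodule.map_comp] at h2
  rw [mulLeftLinearEquiv_inv_comp, Submodule.map_id] at h2
  exact h2

/-- `distSymbol D E α β` is the symbol of `u⁻¹` and `v⁻¹` along `k[[t]]`, for `u = α D` and
`v = β E`. -/
lemma detMod_polarFamily (hD : D.IsDistinguishedAt (IsLocalRing.maximalIdeal k))
    (hE : E.IsDistinguishedAt (IsLocalRing.maximalIdeal k))
    (hu : (u : k⸨X⸩) = HahnSeries.ofPowerSeries ℤ k (α * D))
    (hv : (v : k⸨X⸩) = HahnSeries.ofPowerSeries ℤ k (β * E)) :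
    DetMod (powerSeriesLattice k)
      (Sum.elim (polarFamily u D.natDegree) fun i => (u⁻¹ : (k⸨X⸩)ˣ) * polarFamily v E.natDegree i)
      (Sum.elim (fun i => (v⁻¹ : (k⸨X⸩)ˣ) * polarFamily u D.natDegree i)
        (polarFamily v E.natDegree))
      (distSymbol D E α β : k) := by
  have h1 := (detMod_symbol hD hE α β).map
    (ofPowerSeriesLinear k)
  have huv : ((u * v : (k⸨X⸩)ˣ) : k⸨X⸩) = HahnSeries.ofPowerSeries ℤ k
      ((α * β : (k⟦X⟧)ˣ) * ((D * E : k[X]) : k⟦X⟧)) := by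
    rw [Units.val_mul, hu, hv, ← map_mul, Units.val_mul, Polynomial.coe_mul]
    congr 1; ring
  rw [← multiples_unit_mul (α * β), map_multiples huv] at h1
  have h2 := h1.map ((u * v)⁻¹.mulLeftLinearEquiv k (k⸨X⸩)).toLinearMap
  rw [← Submodule.map_comp, mulLeftLinearEquiv_inv_comp, Submodule.map_id] at h2
  have hu' : (u⁻¹ : (k⸨X⸩)ˣ) * HahnSeries.ofPowerSeries ℤ k (α * D) = 1 := by rw [← hu]; simp
  have hv' : (v⁻¹ : (k⸨X⸩)ˣ) * HahnSeries.ofPowerSeries ℤ k (β * E) = 1 := by rw [← hv]; simp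
  have hm : ∀ x : k⟦X⟧, ((u * v)⁻¹.mulLeftLinearEquiv k (k⸨X⸩)).toLinearMap
      ((ofPowerSeriesLinear k) x) =
      (u⁻¹ : (k⸨X⸩)ˣ) * ((v⁻¹ : (k⸨X⸩)ˣ) * HahnSeries.ofPowerSeries ℤ k x) := fun x => by
    change ((u * v)⁻¹ : (k⸨X⸩)ˣ).val * HahnSeries.ofPowerSeries ℤ k x = _
    rw [mul_inv, Units.val_mul, mul_assoc]
  convert h2 using 1
  · ext (i | i) : 1
    · simp only [Sum.elim_inl, hm, polarFamily]
      rw [map_mul _ (_ * _ : k⟦X⟧), ← mul_assoc (v⁻¹ : (k⸨X⸩)ˣ).val, hv', one_mul]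
    · simp only [Sum.elim_inr, hm, polarFamily]
  · ext (i | i) : 1
    · simp only [Sum.elim_inl, hm, polarFamily]
      ring
    · simp only [Sum.elim_inr, hm, polarFamily]
      rw [map_mul _ (_ * _ : k⟦X⟧), mul_left_comm, ← mul_assoc (u⁻¹ : (k⸨X⸩)ˣ).val, hu', one_mul]
  · rfl

/-- The lattice `∏ₛ k[[t]]` in `∏ₛ k((t))`. -/
noncomputable def productLattice (S k : Type*) [CommRing k] : Submodule k (S → k⸨X⸩) :=
  Submodule.pi Set.univ fun _ => powerSeriesLattice k

/-- The symbol along `∏ₛ k[[t]]` is the product of the local symbols. -/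
lemma isLatticeSymbol_productLattice {S : Type*} [Fintype S] {D E : S → k[X]}
    {α β : S → (k⟦X⟧)ˣ} {u v : (S → k⸨X⸩)ˣ}
    (hD : ∀ s, (D s).IsDistinguishedAt (IsLocalRing.maximalIdeal k))
    (hE : ∀ s, (E s).IsDistinguishedAt (IsLocalRing.maximalIdeal k))
    (hu : ∀ s, (u : S → k⸨X⸩) s = HahnSeries.ofPowerSeries ℤ k (α s * D s))
    (hv : ∀ s, (v : S → k⸨X⸩) s = HahnSeries.ofPowerSeries ℤ k (β s * E s)) :
    IsLatticeSymbol (productLattice S k) (u⁻¹.mulLeftLinearEquiv k (S → k⸨X⸩))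
      (v⁻¹.mulLeftLinearEquiv k (S → k⸨X⸩))
      ((∏ s, distSymbol (D s) (E s) (α s) (β s) : kˣ) : k) := by
  classical
  let us : S → (k⸨X⸩)ˣ := fun s => MulEquiv.piUnits u s
  let vs : S → (k⸨X⸩)ˣ := fun s => MulEquiv.piUnits v s
  have hmap : ∀ w : (S → k⸨X⸩)ˣ, (productLattice S k).map
      (w.mulLeftLinearEquiv k (S → k⸨X⸩)).toLinearMap = Submodule.pi Set.univ fun s =>
        (powerSeriesLattice k).map
          ((MulEquiv.piUnits w s).mulLeftLinearEquiv k (k⸨X⸩)).toLinearMap := by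
    intro w
    ext x
    constructor
    · rintro ⟨y, hy, rfl⟩ s -
      exact ⟨y s, hy s trivial, rfl⟩
    · intro hx
      choose y hy hyx using fun s => hx s trivial
      exact ⟨y, fun s _ => hy s, funext hyx⟩
  have hmul : ∀ (w : (S → k⸨X⸩)ˣ) (s : S) (x : k⸨X⸩), w.mulLeftLinearEquiv k (S → k⸨X⸩)
      (Pi.single s x) = Pi.single s ((MulEquiv.piUnits w s : k⸨X⸩) * x) := by
    intro w s x
    change (w : S → k⸨X⸩) * Pi.single s x = _
    ext t : 1
    rcases eq_or_ne t s with rfl | h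
    · simp [MulEquiv.piUnits]
    · simp [Pi.single_eq_of_ne h]
  let e : (Σ s, Fin (D s).natDegree) → S → k⸨X⸩ := fun i =>
    Pi.single i.1 (polarFamily (us i.1) _ i.2)
  let d : (Σ s, Fin (E s).natDegree) → S → k⸨X⸩ := fun i =>
    Pi.single i.1 (polarFamily (vs i.1) _ i.2)
  have he : IsBasisMod (productLattice S k) ((productLattice S k).map
      (u⁻¹.mulLeftLinearEquiv k (S → k⸨X⸩)).toLinearMap) e := by
    rw [hmap]
    exact IsBasisMod.sigma fun s => isBasisMod_polarFamily (u := us s) (hD s) (hu s)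
  have hd : IsBasisMod (productLattice S k) ((productLattice S k).map
      (v⁻¹.mulLeftLinearEquiv k (S → k⸨X⸩)).toLinearMap) d := by
    rw [hmap]
    exact IsBasisMod.sigma fun s => isBasisMod_polarFamily (u := vs s) (hE s) (hv s)
  refine IsLatticeSymbol.of_families he hd ?_
  have h1 := DetMod.sigma_sumElim (ι := fun s => Fin (D s).natDegree)
    (κ := fun s => Fin (E s).natDegree) fun s =>
      detMod_polarFamily (u := us s) (v := vs s) (hD s) (hE s) (hu s) (hv s)
  rw [Units.coe_prod]
  have hfd : (fun i => u⁻¹.mulLeftLinearEquiv k (S → k⸨X⸩) (d i)) = fun i =>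
      Pi.single i.1 (((us i.1)⁻¹ : (k⸨X⸩)ˣ) * polarFamily (vs i.1) _ i.2) :=
    funext fun i => hmul _ _ _
  have hge : (fun i => v⁻¹.mulLeftLinearEquiv k (S → k⸨X⸩) (e i)) = fun i =>
      Pi.single i.1 (((vs i.1)⁻¹ : (k⸨X⸩)ˣ) * polarFamily (us i.1) _ i.2) :=
    funext fun i => hmul _ _ _
  rw [hfd, hge]
  exact h1

end Local

/-! ### The Contou-Carrère symbol as a lattice symbol -/

section Witt
variable {k : Type*} [CommRing k] [IsLocalRing k]

lemma WittParameters.finprod_eq (a : WittParameters k) {N : ℕ}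
    (hN : ∀ i : ℕ, N < i → a.param (-(i : ℤ)) = 0) :
    (∏ᶠ i : ℕ+, (1 - HahnSeries.single (-(i : ℤ)) (a.param (-(i : ℤ)))) : k⸨X⸩) =
      ∏ i ∈ Finset.Icc 1 N, (1 - HahnSeries.single (-(i : ℤ)) (a.param (-(i : ℤ)))) := by
  rw [← prod_pnatsLE, finprod_eq_prod_of_mulSupport_subset]
  · intro i hi
    refine Finset.mem_coe.mpr (mem_pnatsLE.mpr ?_)
    by_contra h
    apply hi
    have h2 : a.param (-((i : ℕ) : ℤ)) = 0 := hN i (by simpa using h)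
    simp [h2]

lemma WittParameters.single_sum_mul_finprod (a : WittParameters k) {N : ℕ}
    (hN : ∀ i : ℕ, N < i → a.param (-(i : ℤ)) = 0) :
    HahnSeries.single ((∑ i ∈ Finset.Icc 1 N, i : ℕ) : ℤ) 1 *
      (∏ᶠ i : ℕ+, (1 - HahnSeries.single (-(i : ℤ)) (a.param (-(i : ℤ)))) : k⸨X⸩) =
      HahnSeries.ofPowerSeries ℤ k ((∏ i ∈ Finset.Icc 1 N,
        (Polynomial.X ^ i - Polynomial.C (a.param (-(i : ℤ)))) : k[X]) : k⟦X⟧) := by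
  have h : ∀ M : ℕ, HahnSeries.single ((∑ i ∈ Finset.Icc 1 M, i : ℕ) : ℤ) 1 *
      (∏ i ∈ Finset.Icc 1 M, (1 - HahnSeries.single (-(i : ℤ)) (a.param (-(i : ℤ)))) : k⸨X⸩) =
      HahnSeries.ofPowerSeries ℤ k ((∏ i ∈ Finset.Icc 1 M,
        (Polynomial.X ^ i - Polynomial.C (a.param (-(i : ℤ)))) : k[X]) : k⟦X⟧) := by
    intro M
    induction M with
    | zero => simp
    | succ M ih =>
      rw [Finset.prod_Icc_succ_top (by omega), Finset.prod_Icc_succ_top (by omega),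
        Finset.sum_Icc_succ_top (by omega), Polynomial.coe_mul, map_mul, ← ih]
      have h1 : HahnSeries.ofPowerSeries ℤ k ((Polynomial.X ^ (M + 1) -
          Polynomial.C (a.param (-((M + 1 : ℕ) : ℤ))) : k[X]) : k⟦X⟧) =
          HahnSeries.single ((M + 1 : ℕ) : ℤ) 1 *
          (1 - HahnSeries.single (-((M + 1 : ℕ) : ℤ)) (a.param (-((M + 1 : ℕ) : ℤ)))) := by
        rw [mul_sub, mul_one, HahnSeries.single_mul_single, one_mul, add_neg_cancel,
          Polynomial.coe_sub, Polynomial.coe_pow, Polynomial.coe_X, Polynomial.coe_C, map_sub,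
          HahnSeries.ofPowerSeries_X_pow, HahnSeries.ofPowerSeries_C]
        rfl
      have h2 : (HahnSeries.single ((∑ i ∈ Finset.Icc 1 M, i + (M + 1) : ℕ) : ℤ) 1 : k⸨X⸩) =
          HahnSeries.single ((∑ i ∈ Finset.Icc 1 M, i : ℕ) : ℤ) 1 *
            HahnSeries.single ((M + 1 : ℕ) : ℤ) 1 := by
        rw [HahnSeries.single_mul_single, one_mul, ← Nat.cast_add]
      rw [h1, h2]
      ring
  rw [a.finprod_eq hN, h]

/-- After multiplication by a high power of `t`, a unit of `k((t))` is the product of an invertible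
power series and a distinguished polynomial, both given by its Witt parameters. -/
lemma WittParameters.exists_single_mul_eq (a : WittParameters k) : ∃ n₀ : ℕ, ∀ n ≥ n₀, ∃ N c : ℕ,
    (∀ i : ℕ, N < i → a.param (-(i : ℤ)) = 0) ∧
    ((a.distPoly N c).natDegree : ℤ) = a.winding + n ∧
    HahnSeries.single (n : ℤ) 1 * a.toLaurentSeries =
      HahnSeries.ofPowerSeries ℤ k (a.series * (a.distPoly N c : k⟦X⟧)) := by
  obtain ⟨M, hM⟩ := a.eventually_zero
  have hN : ∀ i : ℕ, M.natAbs < i → a.param (-(i : ℤ)) = 0 := fun i hi => hM _ (by omega)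
  set N := M.natAbs
  set T := ∑ i ∈ Finset.Icc 1 N, i with hT
  refine ⟨T + a.winding.natAbs, fun n hn => ⟨N, (a.winding + n - T).toNat, hN, ?_, ?_⟩⟩
  · rw [natDegree_distPoly, ← hT]
    rw [Nat.cast_add, Int.toNat_of_nonneg (by omega)]
    exact sub_add_cancel _ _
  · have h1 : (HahnSeries.single (n : ℤ) 1 : k⸨X⸩) * HahnSeries.single a.winding (a.param 0) =
        HahnSeries.C (a.param 0) * (HahnSeries.single ((a.winding + n - T).toNat : ℤ) 1 *
          HahnSeries.single (T : ℤ) 1) := by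
      rw [HahnSeries.single_mul_single, HahnSeries.single_mul_single, HahnSeries.C_apply,
        HahnSeries.single_mul_single]
      congr 1
      · rw [Int.toNat_of_nonneg (by omega), sub_add_cancel, add_comm, zero_add]
      · simp
    rw [toLaurentSeries, ← mul_assoc, ← mul_assoc, h1,
      mul_assoc _ _ (HahnSeries.ofPowerSeries _ _ _), distPoly, series, Polynomial.coe_mul,
      map_mul, map_mul, map_mul,
      ← a.single_sum_mul_finprod hN, Polynomial.coe_pow, Polynomial.coe_X,
      HahnSeries.ofPowerSeries_X_pow, HahnSeries.ofPowerSeries_C]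
    ring

end Witt

section Local
variable {k : Type*} [CommRing k] [IsLocalRing k] [IsArtinianRing k]

lemma unitsMap_quotNorm_X_pow (n : ℕ) (β : (k⟦X⟧)ˣ) :
    Units.map (quotNorm ((Polynomial.X ^ n : k[X]) : k⟦X⟧)) β =
      Units.map (PowerSeries.constantCoeff (R := k)).toMonoidHom β ^ n := by
  ext
  rw [Units.coe_map, Units.val_pow_eq_pow_val, Units.coe_map]
  exact quotNorm_X_pow n (β : k⟦X⟧)

/-- The Contou-Carrère symbol of `f` and `g`, in terms of the lattice symbols of `z f`, `z g` and
`z`, where `z` is the product of `tⁿ` and an invertible series. -/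
lemma WittParameters.distSymbol_mul_distSymbol {f g : (k⸨X⸩)ˣ} {n N c N' c' : ℕ}
    (hN : ∀ i : ℕ, N < i → (wittParameters f).param (-(i : ℤ)) = 0)
    (hN' : ∀ i : ℕ, N' < i → (wittParameters g).param (-(i : ℤ)) = 0)
    (hd : (((wittParameters f).distPoly N c).natDegree : ℤ) = (wittParameters f).winding + n)
    (hd' : (((wittParameters g).distPoly N' c').natDegree : ℤ) = (wittParameters g).winding + n)
    (ζ : (k⟦X⟧)ˣ) :
    distSymbol ((wittParameters f).distPoly N c) ((wittParameters g).distPoly N' c')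
        ((wittParameters f).isUnit_series.unit * ζ) ((wittParameters g).isUnit_series.unit * ζ) *
      distSymbol (Polynomial.X ^ n) (Polynomial.X ^ n) ζ ζ =
    symbol f g * (distSymbol ((wittParameters f).distPoly N c) (Polynomial.X ^ n)
        ((wittParameters f).isUnit_series.unit * ζ) ζ *
      distSymbol (Polynomial.X ^ n) ((wittParameters g).distPoly N' c') ζ
        ((wittParameters g).isUnit_series.unit * ζ)) := by
  have h0 : ∀ a : WittParameters k, Units.map (PowerSeries.constantCoeff (R := k)).toMonoidHom
      a.isUnit_series.unit = a.isUnit_zero.unit := by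
    intro a
    ext
    change PowerSeries.constantCoeff a.series = a.param 0
    rw [series, map_mul, PowerSeries.constantCoeff_C,
      ← PowerSeries.coeff_zero_eq_constantCoeff_apply, coeff_prodSeries, coeff_zero_partialProd,
      mul_one]
  simp only [distSymbol, symbol, map_mul, unitsMap_quotNorm_X_pow, h0,
    WittParameters.quotNorm_distPoly _ _ hN, WittParameters.quotNorm_distPoly _ _ hN',
    Polynomial.natDegree_X_pow]
  generalize Units.map (quotNorm (((wittParameters f).distPoly N c : k[X]) : k⟦X⟧)) ζ = x
  generalize Units.map (quotNorm (((wittParameters g).distPoly N' c' : k[X]) : k⟦X⟧)) ζ = y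
  generalize Units.map (PowerSeries.constantCoeff (R := k)).toMonoidHom ζ = z
  generalize ((wittParameters f).distPoly N c).natDegree = d at *
  generalize ((wittParameters g).distPoly N' c').natDegree = d' at *
  generalize (wittParameters f).isUnit_zero.unit = a₀
  generalize (wittParameters g).isUnit_zero.unit = b₀
  generalize (∏ᶠ p : ℕ+ × ℕ+, (wittParameters f).factor (wittParameters g) p.1 p.2) = A
  generalize (∏ᶠ p : ℕ+ × ℕ+, (wittParameters g).factor (wittParameters f) p.1 p.2) = B
  obtain hw : (wittParameters f).winding = (d : ℤ) - n := by omega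
  obtain hw' : (wittParameters g).winding = (d' : ℤ) - n := by omega
  rw [hw, hw']
  have hsign : ((-1 : kˣ) ^ (d * d') * (-1) ^ (n * n) : kˣ) =
      (-1) ^ (((d : ℤ) - n) * (d' - n)) * ((-1) ^ (d * n) * (-1) ^ (n * d')) := by
    simp only [← zpow_natCast, ← zpow_add]
    congr 1
    push_cast
    ring
  calc _ = ((-1 : kˣ) ^ (d * d') * (-1) ^ (n * n)) * (a₀ ^ d' * A * y) *
        (b₀ ^ d * B * x)⁻¹ * (z ^ n * (z ^ n)⁻¹) := by
        simp only [mul_inv, mul_comm, mul_left_comm, mul_assoc]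
    _ = _ := by
      rw [hsign, zpow_sub, zpow_sub, zpow_natCast, zpow_natCast, zpow_natCast, zpow_natCast]
      apply Additive.ofMul.injective
      simp only [ofMul_mul, ofMul_inv, ofMul_div]
      abel

end Local

/-! ### Multiplicativity of the discrete symbol -/

section Discrete
variable {k V : Type*} [CommRing k] [AddCommGroup V] [Module k V]

/-- The relation between the symbols, along `A`, of the commuting automorphisms `x f`, `x g` and
`x`, where `f` and `g` preserve `A` and `x` shrinks it: the determinants of the actions of `f` and
`g` on `A / x A` cancel. -/
theorem IsDiscreteSymbol.exists_mul_eq_mul {A : Submodule k V} {x f g : V ≃ₗ[k] V} {n : ℕ}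
    {e : Fin n → V} (he : IsBasisMod (A.map x.toLinearMap) A e) (hxA : A.map x.toLinearMap ≤ A)
    (hfA : A.map f.toLinearMap = A) (hgA : A.map g.toLinearMap = A)
    (hf : ∀ v, x (f v) = f (x v)) (hg : ∀ v, x (g v) = g (x v)) :
    ∃ ρ₁ ρ₂ ρ₃ ρ₄ : kˣ, IsDiscreteSymbol A (f ≪≫ₗ x) (g ≪≫ₗ x) (ρ₁ : k) ∧
      IsDiscreteSymbol A x x (ρ₂ : k) ∧ IsDiscreteSymbol A (f ≪≫ₗ x) x (ρ₃ : k) ∧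
      IsDiscreteSymbol A x (g ≪≫ₗ x) (ρ₄ : k) ∧ ρ₁ * ρ₂ = ρ₃ * ρ₄ := by
  set B := (A.map x.toLinearMap).map x.toLinearMap with hB
  have hBA : B ≤ A.map x.toLinearMap := Submodule.map_mono hxA
  have hmap : ∀ h : V ≃ₗ[k] V, A.map h.toLinearMap = A →
      A.map (h ≪≫ₗ x).toLinearMap = A.map x.toLinearMap := fun h hh => by
    rw [LinearEquiv.coe_trans, Submodule.map_comp, hh]
  have hmapB : ∀ h : V ≃ₗ[k] V, A.map h.toLinearMap = A → (∀ v, x (h v) = h (x v)) →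
      (A.map x.toLinearMap).map (h ≪≫ₗ x).toLinearMap = B := fun h hh hx => by
    have h1 : (h ≪≫ₗ x).toLinearMap ∘ₗ x.toLinearMap =
        x.toLinearMap ∘ₗ x.toLinearMap ∘ₗ h.toLinearMap :=
      LinearMap.ext fun v => congrArg x (hx v).symm
    rw [← Submodule.map_comp, h1, Submodule.map_comp, Submodule.map_comp, hh]
  -- the action of `h` on `A / x A`, and on `x A / x ^ 2 A`
  have hdet : ∀ h : V ≃ₗ[k] V, A.map h.toLinearMap = A → (∀ v, x (h v) = h (x v)) →
      ∃ d : kˣ, DetMod B (fun i => x (e i)) (fun i => (h ≪≫ₗ x) (e i)) (d : k) := by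
    intro h hh hx
    have h1 := he.map h.toLinearMap h.injective
    have h2 : (A.map x.toLinearMap).map h.toLinearMap = A.map x.toLinearMap := by
      rw [← Submodule.map_comp, show h.toLinearMap ∘ₗ x.toLinearMap = x.toLinearMap ∘ₗ h.toLinearMap
        from LinearMap.ext fun v => (hx v).symm, Submodule.map_comp, hh]
    rw [h2, hh] at h1
    obtain ⟨d, hd⟩ := he.exists_detMod h1
    exact ⟨d, hd.map x.toLinearMap⟩
  obtain ⟨df, hdf⟩ := hdet f hfA hf
  obtain ⟨dg, hdg⟩ := hdet g hgA hg
  have hxe := he.map x.toLinearMap x.injective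
  have hb1 : IsBasisMod B A (Sum.elim (fun i => x (e i)) e) := hxe.sumElim he hBA hxA
  have hb2 : IsBasisMod B A (Sum.elim e fun i => x (e i)) := by
    convert hb1.reindex (Equiv.sumComm _ _) using 1
    ext (i | i) <;> rfl
  obtain ⟨σ, hσ⟩ := hb2.exists_detMod hb1
  have hF : DetMod B (Sum.elim e fun i => (f ≪≫ₗ x) (e i)) (Sum.elim e fun i => x (e i))
      (df⁻¹ : kˣ) :=
    (hdf.mono le_sup_left : DetMod (B ⊔ Submodule.span k (Set.range e)) _ _ _).symm.sumElim_right
  have hG : DetMod B (Sum.elim (fun i => x (e i)) e) (Sum.elim (fun i => (g ≪≫ₗ x) (e i)) e) dg :=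
    (hdg.mono le_sup_left : DetMod (B ⊔ Submodule.span k (Set.range e)) _ _ _).sumElim_left
  refine ⟨df⁻¹ * σ * dg, σ, df⁻¹ * σ, σ * dg, ⟨n, n, e, e, ?_, ?_, ?_⟩, ⟨n, n, e, e, he, he, hσ⟩,
    ⟨n, n, e, e, ?_, he, ?_⟩, ⟨n, n, e, e, he, ?_, ?_⟩, ?_⟩
  · rwa [hmap f hfA]
  · rwa [hmap g hgA]
  · rw [hmap g hgA, hmapB f hfA hf, Units.val_mul, Units.val_mul]
    exact (hF.trans hσ).trans hG
  · rwa [hmap f hfA]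
  · rw [hmapB f hfA hf, Units.val_mul]
    exact hF.trans hσ
  · rwa [hmap g hgA]
  · rw [hmap g hgA, Units.val_mul]
    exact hσ.trans hG
  · simp only [mul_comm, mul_left_comm, mul_assoc]

/-- A subspace of finite codimension has a complementary basis. -/
lemma exists_isBasisMod {F V : Type*} [Field F] [AddCommGroup V] [Module F V]
    {N M C : Submodule F V} [FiniteDimensional F C] (hM : M ≤ N ⊔ C) :
    ∃ (n : ℕ) (e : Fin n → V), IsBasisMod N M e := by
  have hfin : FiniteDimensional F (M.map N.mkQ) := by
    have h1 : M.map N.mkQ ≤ C.map N.mkQ := by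
      refine (Submodule.map_mono hM).trans ?_
      rw [Submodule.map_sup, N.mkQ_map_self, bot_sup_eq]
    exact Submodule.finiteDimensional_of_le h1
  let b := Module.finBasis F (M.map N.mkQ)
  choose e heM he using fun i => (b i).2
  have hsum : ∀ c : Fin _ → F, N.mkQ (∑ i, c i • e i) = (∑ i, c i • b i : M.map N.mkQ) := by
    intro c
    simp [he]
  refine ⟨_, e, heM, fun c hc => ?_, fun m hm => ?_⟩
  · have h1 := hsum c
    rw [Submodule.mkQ_apply, (Submodule.Quotient.mk_eq_zero N).mpr hc] at h1
    have h2 := Fintype.linearIndependent_iff.mp b.linearIndependent c (Subtype.ext h1.symm)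
    exact funext h2
  · refine ⟨b.repr ⟨N.mkQ m, Submodule.mem_map_of_mem hm⟩, ?_⟩
    rw [← Submodule.Quotient.mk_eq_zero, ← Submodule.mkQ_apply, map_sub, hsum, b.sum_repr, sub_self]

end Discrete

/-! ### Extension of scalars in families of Laurent series -/

lemma mem_map_mulLeft {k R : Type*} [CommRing k] [CommRing R] [Module k R] [SMulCommClass k R R]
    {M : Submodule k R} {u : Rˣ} {x : R} :
    x ∈ M.map (u.mulLeftLinearEquiv k R).toLinearMap ↔ (u⁻¹ : Rˣ) * x ∈ M := by
  constructor
  · rintro ⟨y, hy, rfl⟩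
    exact (u.inv_mul_cancel_left y).symm ▸ hy
  · exact fun h => ⟨_, h, u.mul_inv_cancel_left x⟩

section BaseChange
variable {F k S : Type*} [Field F] [CommRing k] [Algebra F k]

/-- The map `k((t))^S → F((t))^S` which applies an `F`-linear form on `k` to the coefficients. -/
def coeffMap (l : k →ₗ[F] F) (v : S → k⸨X⸩) : S → F⸨X⸩ := fun s => HahnSeries.map (v s) l

/-- The inclusion `F((t))^S → k((t))^S`. -/
noncomputable def scalarExt (k S : Type*) [CommRing k] [Algebra F k] :
    (S → F⸨X⸩) →+* (S → k⸨X⸩) :=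
  (mapLaurent (algebraMap F k)).compLeft S

lemma coeffMap_add (l : k →ₗ[F] F) (v w : S → k⸨X⸩) :
    coeffMap l (v + w) = coeffMap l v + coeffMap l w := by
  ext s n; exact map_add l _ _

lemma coeffMap_zero (l : k →ₗ[F] F) : coeffMap l (0 : S → k⸨X⸩) = 0 := by
  ext s n; exact map_zero l

lemma coeffMap_sum {ι : Type*} (l : k →ₗ[F] F) (t : Finset ι) (v : ι → S → k⸨X⸩) :
    coeffMap l (∑ i ∈ t, v i) = ∑ i ∈ t, coeffMap l (v i) :=
  map_sum (⟨⟨coeffMap l, coeffMap_zero l⟩, coeffMap_add l⟩ : (S → k⸨X⸩) →+ (S → F⸨X⸩)) _ _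

lemma coeffMap_smul (l : k →ₗ[F] F) (c : k) (v : S → k⸨X⸩) :
    coeffMap l (c • v) = coeffMap (l ∘ₗ LinearMap.mulLeft F c) v := rfl

lemma coeffMap_smul_scalarExt (l : k →ₗ[F] F) (c : k) (v : S → F⸨X⸩) :
    coeffMap l (c • scalarExt k S v) = l c • v := by
  ext s n
  change l (c * algebraMap F k _) = l c * _
  rw [mul_comm, ← Algebra.smul_def, map_smul, smul_eq_mul, mul_comm]

lemma coeffMap_scalarExt_mul (l : k →ₗ[F] F) (x : S → F⸨X⸩) (v : S → k⸨X⸩) :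
    coeffMap l (scalarExt k S x * v) = x * coeffMap l v := by
  ext s n
  change l ((mapLaurent (algebraMap F k) (x s) * v s).coeff n) =
    (x s * HahnSeries.map (v s) l).coeff n
  have h1 : (mapLaurent (algebraMap F k) (x s)).support ⊆ (x s).support := fun i hi h => hi (by
    simp [h])
  have h2 : (HahnSeries.map (v s) l).support ⊆ (v s).support := fun i hi h => hi (by
    simp [h])
  rw [HahnSeries.coeff_mul_left' (x s).isPWO_support h1,
    HahnSeries.coeff_mul_right' (v s).isPWO_support h2, map_sum]
  refine Finset.sum_congr rfl fun i _ => ?_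
  rw [mapLaurent_coeff, ← Algebra.smul_def, map_smul]
  rfl

variable (k) in
/-- The extension of scalars of a subspace of `F((t))^S`: the families of Laurent series over `k`
all of whose images under `F`-linear forms on `k` lie in the subspace. -/
def scalarExtSubmodule (M : Submodule F (S → F⸨X⸩)) : Submodule k (S → k⸨X⸩) where
  carrier := {v | ∀ l : k →ₗ[F] F, coeffMap l v ∈ M}
  add_mem' hv hw l := by rw [coeffMap_add]; exact M.add_mem (hv l) (hw l)
  zero_mem' l := by rw [coeffMap_zero]; exact M.zero_mem
  smul_mem' c v hv l := by rw [coeffMap_smul]; exact hv _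

variable {M N : Submodule F (S → F⸨X⸩)}

lemma smul_scalarExt_mem (c : k) {v : S → F⸨X⸩} (hv : v ∈ M) :
    c • scalarExt k S v ∈ scalarExtSubmodule k M := fun l => by
  rw [coeffMap_smul_scalarExt]; exact M.smul_mem _ hv

lemma scalarExt_mem {v : S → F⸨X⸩} (hv : v ∈ M) : scalarExt k S v ∈ scalarExtSubmodule k M := by
  simpa using smul_scalarExt_mem (1 : k) hv

lemma eq_zero_of_forall_linearForm {c : k} (h : ∀ l : k →ₗ[F] F, l c = 0) : c = 0 :=
  (Module.forall_dual_apply_eq_zero_iff F c).mp h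

lemma scalarExtSubmodule_bot : scalarExtSubmodule k (⊥ : Submodule F (S → F⸨X⸩)) = ⊥ := by
  rw [eq_bot_iff]
  intro v hv
  ext s n
  exact eq_zero_of_forall_linearForm fun l => congrArg (fun w => (w s).coeff n) (hv l)

lemma scalarExtSubmodule_inf :
    scalarExtSubmodule k (M ⊓ N) = scalarExtSubmodule k M ⊓ scalarExtSubmodule k N := by
  ext v
  exact forall_and

/-- Extension of scalars commutes with multiplication by units of `F((t))^S`. -/
lemma scalarExtSubmodule_map (u : (S → F⸨X⸩)ˣ) :
    scalarExtSubmodule k (M.map (u.mulLeftLinearEquiv F (S → F⸨X⸩)).toLinearMap) =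
      (scalarExtSubmodule k M).map ((Units.map (scalarExt k S).toMonoidHom u).mulLeftLinearEquiv k
        (S → k⸨X⸩)).toLinearMap := by
  ext v
  rw [mem_map_mulLeft]
  refine forall_congr' fun l => ?_
  rw [mem_map_mulLeft, ← coeffMap_scalarExt_mul]
  rfl

/-- A family of Laurent series over `k` is a combination of families over `F`, for a basis of `k`
over `F`. -/
lemma eq_sum_smul_scalarExt {m : Type*} [Fintype m] (b : Module.Basis m F k) (v : S → k⸨X⸩) :
    v = ∑ j, b j • scalarExt k S (coeffMap (b.coord j) v) := by
  have h : ∀ (f : m → S → k⸨X⸩) (s : S) (n : ℤ), ((∑ j, f j) s).coeff n = ∑ j, (f j s).coeff n := by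
    intro f s n
    simp
  ext s n
  rw [h]
  conv_lhs => rw [← b.sum_repr ((v s).coeff n)]
  refine Finset.sum_congr rfl fun j _ => ?_
  change _ = b j * algebraMap F k (b.coord j ((v s).coeff n))
  rw [mul_comm, ← Algebra.smul_def]
  rfl

section Finite
variable [Module.Finite F k]

lemma scalarExtSubmodule_sup (h : M ⊔ N = ⊤) :
    scalarExtSubmodule k M ⊔ scalarExtSubmodule k N = ⊤ := by
  rw [eq_top_iff]
  intro v _
  rw [eq_sum_smul_scalarExt (Module.finBasis F k) v]
  refine Submodule.sum_mem _ fun j _ => Submodule.smul_mem _ _ ?_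
  obtain ⟨a, ha, w, hw, haw⟩ := Submodule.mem_sup.mp
    (h ▸ Submodule.mem_top : coeffMap ((Module.finBasis F k).coord j) v ∈ M ⊔ N)
  rw [← haw, map_add]
  exact Submodule.add_mem_sup (scalarExt_mem ha) (scalarExt_mem hw)

lemma IsBasisMod.scalarExt {n : ℕ} {e : Fin n → S → F⸨X⸩} (h : IsBasisMod N M e) :
    IsBasisMod (scalarExtSubmodule k N) (scalarExtSubmodule k M)
      fun i => ContouCarrere.scalarExt k S (e i) where
  mem i := scalarExt_mem (h.mem i)
  indep c hc := by
    ext i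
    refine eq_zero_of_forall_linearForm (F := F) fun l => ?_
    have h1 := hc l
    rw [coeffMap_sum] at h1
    simp only [coeffMap_smul_scalarExt] at h1
    exact congrFun (h.indep (fun i => l (c i)) h1) i
  span v hv := by
    let b := Module.finBasis F k
    choose x hx using fun j => h.span _ (hv (b.coord j))
    refine ⟨fun i => ∑ j, x j i • b j, ?_⟩
    have h1 : v - ∑ i, (∑ j, x j i • b j) • ContouCarrere.scalarExt k S (e i) =
        ∑ j, b j • ContouCarrere.scalarExt k S (coeffMap (b.coord j) v - ∑ i, x j i • e i) := by
      have h2 : ∀ (c : F) (w : S → F⸨X⸩),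
          ContouCarrere.scalarExt k S (c • w) =
            algebraMap F k c • ContouCarrere.scalarExt k S w := by
        intro c w
        ext s n
        exact map_mul (algebraMap F k) _ _
      simp only [map_sub, map_sum, smul_sub, Finset.sum_sub_distrib, h2]
      rw [← eq_sum_smul_scalarExt b v]
      congr 1
      simp only [Finset.sum_smul, Finset.smul_sum, smul_smul]
      rw [Finset.sum_comm]
      refine Finset.sum_congr rfl fun j _ => Finset.sum_congr rfl fun i _ => ?_
      rw [Algebra.smul_def, mul_comm]
    rw [h1]
    exact Submodule.sum_mem _ fun j _ => smul_scalarExt_mem _ (hx j)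

end Finite
end BaseChange

/-! ### Reciprocity from finiteness -/

section Lattice
variable {k S : Type*} [CommRing k]

variable (k S) in
/-- The lattice `t ^ (-N) k[[t]]^S`. -/
def poleLattice (N : ℤ) : Submodule k (S → k⸨X⸩) where
  carrier := {v | ∀ s, ∀ n < -N, (v s).coeff n = 0}
  add_mem' hv hw s n hn := by
    rw [Pi.add_apply, HahnSeries.coeff_add, hv s n hn, hw s n hn, add_zero]
  zero_mem' _ _ _ := rfl
  smul_mem' c v hv s n hn := by
    rw [Pi.smul_apply, HahnSeries.coeff_smul, hv s n hn, smul_zero]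

lemma mem_poleLattice {N : ℤ} {v : S → k⸨X⸩} :
    v ∈ poleLattice k S N ↔ ∀ s, ∀ n < -N, (v s).coeff n = 0 := Iff.rfl

lemma mem_powerSeriesLattice_iff {f : k⸨X⸩} :
    f ∈ powerSeriesLattice k ↔ ∀ n < 0, f.coeff n = 0 := by
  rw [mem_powerSeriesLattice]
  constructor
  · rintro ⟨g, rfl⟩ n hn
    rw [HahnSeries.ofPowerSeries_apply]
    exact HahnSeries.embDomain_of_notMem_range (by rintro ⟨m, rfl⟩; simp at hn; omega)
  · intro h
    refine ⟨PowerSeries.mk fun n => f.coeff n, ?_⟩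
    ext n
    rcases lt_or_ge n 0 with hn | hn
    · rw [h n hn, HahnSeries.ofPowerSeries_apply]
      exact HahnSeries.embDomain_of_notMem_range (by rintro ⟨m, rfl⟩; simp at hn; omega)
    · lift n to ℕ using hn
      rw [LaurentSeries.coeff_coe_powerSeries, PowerSeries.coeff_mk]

lemma poleLattice_zero : poleLattice k S 0 = productLattice S k := by
  ext v
  simp only [mem_poleLattice, productLattice, Submodule.mem_pi, mem_powerSeriesLattice_iff,
    Set.mem_univ, true_imp_iff, neg_zero]

/-- The unit `tⁿ` of `k((t))^S`. -/
noncomputable def monomialUnit (k S : Type*) [CommRing k] (n : ℤ) : (S → k⸨X⸩)ˣ where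
  val _ := HahnSeries.single n 1
  inv _ := HahnSeries.single (-n) 1
  val_inv := by ext1; simp [HahnSeries.single_mul_single]
  inv_val := by ext1; simp [HahnSeries.single_mul_single]

lemma coeff_monomialUnit_mul (n m : ℤ) (v : S → k⸨X⸩) (s : S) :
    (((monomialUnit k S n : S → k⸨X⸩) * v) s).coeff m = (v s).coeff (m - n) := by
  have := HahnSeries.coeff_single_mul_add (r := (1 : k)) (x := v s) (a := m - n) (b := n)
  rw [sub_add_cancel, one_mul] at this
  exact this

lemma poleLattice_map_monomialUnit (M N : ℤ) :
    (poleLattice k S M).map ((monomialUnit k S N).mulLeftLinearEquiv k (S → k⸨X⸩)).toLinearMap =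
      poleLattice k S (M - N) := by
  ext v
  constructor
  · rintro ⟨w, hw, rfl⟩ s n hn
    change (((monomialUnit k S N : S → k⸨X⸩) * w) s).coeff n = 0
    rw [coeff_monomialUnit_mul]
    exact hw s _ (by omega)
  · intro hv
    refine ⟨(monomialUnit k S (-N) : S → k⸨X⸩) * v, fun s n hn => ?_, ?_⟩
    · rw [coeff_monomialUnit_mul]
      exact hv s _ (by omega)
    · ext s n
      change (((monomialUnit k S N : S → k⸨X⸩) * _) s).coeff n = _
      rw [coeff_monomialUnit_mul, coeff_monomialUnit_mul]
      congr 1; omega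

/-- Multiplication by integral families preserves the lattices. -/
lemma mul_mem_poleLattice {N : ℤ} {u v : S → k⸨X⸩} (hu : ∀ s, u s ∈ powerSeriesLattice k)
    (hv : v ∈ poleLattice k S N) : u * v ∈ poleLattice k S N := by
  rw [show N = 0 - -N by omega, ← poleLattice_map_monomialUnit, poleLattice_zero] at hv ⊢
  obtain ⟨w, hw, rfl⟩ := hv
  refine ⟨u * w, fun s _ => ?_, mul_left_comm _ _ _⟩
  obtain ⟨a, ha⟩ := hu s
  obtain ⟨b, hb⟩ := hw s trivial
  refine ⟨a * b, ?_⟩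
  rw [Pi.mul_apply, ← ha, ← hb]
  exact map_mul (HahnSeries.ofPowerSeries ℤ k) a b

/-- The symbol along `t ^ (-N) k[[t]]^S` is the one along `k[[t]]^S`, and agrees with the one
along `A`. -/
lemma latticeSymbol_eq_discreteSymbol [Nontrivial k] {A : Submodule k (S → k⸨X⸩)} {N : ℤ} {n : ℕ}
    {h : Fin n → S → k⸨X⸩} (hA : A ⊔ poleLattice k S N = ⊤)
    (hh : IsBasisMod ⊥ (A ⊓ poleLattice k S N) h) {u v : (S → k⸨X⸩)ˣ}
    (hu : ∀ s, (u : S → k⸨X⸩) s ∈ powerSeriesLattice k)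
    (hv : ∀ s, (v : S → k⸨X⸩) s ∈ powerSeriesLattice k)
    (huA : A.map (u⁻¹.mulLeftLinearEquiv k (S → k⸨X⸩)).toLinearMap ≤ A)
    (hvA : A.map (v⁻¹.mulLeftLinearEquiv k (S → k⸨X⸩)).toLinearMap ≤ A) {ρ ρ' : k}
    (hρ : IsLatticeSymbol (productLattice S k) (u⁻¹.mulLeftLinearEquiv k (S → k⸨X⸩))
      (v⁻¹.mulLeftLinearEquiv k (S → k⸨X⸩)) ρ)
    (hρ' : IsDiscreteSymbol A (u⁻¹.mulLeftLinearEquiv k (S → k⸨X⸩))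
      (v⁻¹.mulLeftLinearEquiv k (S → k⸨X⸩)) ρ') : ρ = ρ' := by
  have hW : ∀ w : (S → k⸨X⸩)ˣ, (∀ s, (w : S → k⸨X⸩) s ∈ powerSeriesLattice k) →
      poleLattice k S N ≤
        (poleLattice k S N).map (w⁻¹.mulLeftLinearEquiv k (S → k⸨X⸩)).toLinearMap :=
    fun w hw y hy => ⟨w * y, mul_mem_poleLattice hw hy, w.inv_mul_cancel_left y⟩
  have h1 := hρ.map ((monomialUnit k S (-N)).mulLeftLinearEquiv k (S → k⸨X⸩))
    (fun y => mul_left_comm _ _ y) (fun y => mul_left_comm _ _ y)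
  rw [← poleLattice_zero, poleLattice_map_monomialUnit, zero_sub, neg_neg] at h1
  exact h1.eq_of_isDiscreteSymbol hA hh (hW u hu) (hW v hv) huA hvA
    (fun y => mul_left_comm _ _ y) hρ'

end Lattice

section Field
variable {F S : Type*} [Field F] {A : Submodule F (S → F⸨X⸩)} {N : ℤ}

/-- If `A` and a lattice span, then `A` contains families with poles of any large order `n`, the
same at all places. -/
lemma exists_unit_mem_of_sup_eq_top (hA : A ⊔ poleLattice F S N = ⊤) {n : ℕ} (hn : N < n) :
    ∃ (x : (S → F⸨X⸩)ˣ) (ζ : S → (F⟦X⟧)ˣ), (x : S → F⸨X⸩) ∈ A ∧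
      ∀ s, ((x⁻¹ : (S → F⸨X⸩)ˣ) : S → F⸨X⸩) s =
        HahnSeries.single (n : ℤ) 1 * HahnSeries.ofPowerSeries ℤ F (ζ s) := by
  obtain ⟨a, ha, w, hw, haw⟩ := Submodule.mem_sup.mp
    (hA ▸ Submodule.mem_top : (monomialUnit F S (-n) : S → F⸨X⸩) ∈ A ⊔ poleLattice F S N)
  have hcoeff : ∀ s m, (((monomialUnit F S n : S → F⸨X⸩) * a) s).coeff m =
      if m = 0 then 1 else -(w s).coeff (m - n) := by
    intro s m
    have h1 : a = (monomialUnit F S (-n) : S → F⸨X⸩) - w := by rw [← haw, add_sub_cancel_right]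
    rw [coeff_monomialUnit_mul, h1]
    change (HahnSeries.single (-(n : ℤ)) (1 : F)).coeff (m - n) - (w s).coeff (m - n) = _
    split_ifs with h
    · subst h
      rw [hw s _ (by omega), zero_sub, HahnSeries.coeff_single_same, sub_zero]
    · rw [HahnSeries.coeff_single_of_ne (by omega), zero_sub]
  have hint : ∀ s, ((monomialUnit F S n : S → F⸨X⸩) * a) s ∈ powerSeriesLattice F := by
    intro s
    rw [mem_powerSeriesLattice_iff]
    intro m hm
    rw [hcoeff, if_neg hm.ne, hw s _ (by omega), neg_zero]
  choose p hp using fun s => mem_powerSeriesLattice.mp (hint s)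
  have hpu : ∀ s, IsUnit (p s) := fun s => by
    rw [PowerSeries.isUnit_iff_constantCoeff, ← PowerSeries.coeff_zero_eq_constantCoeff_apply]
    have h1 := LaurentSeries.coeff_coe_powerSeries (p s) 0
    have h2 := hcoeff s 0
    rw [← hp, if_pos rfl] at h2
    rw [← h1]
    exact h2 ▸ isUnit_one
  have hy : ∀ s, HahnSeries.ofPowerSeries ℤ F (p s) *
      HahnSeries.ofPowerSeries ℤ F (((hpu s).unit⁻¹ : (F⟦X⟧)ˣ) : F⟦X⟧) = 1 := fun s => by
    rw [← map_mul, (hpu s).mul_val_inv, map_one]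
  have hx : a * (fun s => HahnSeries.single (n : ℤ) 1 *
      HahnSeries.ofPowerSeries ℤ F (((hpu s).unit⁻¹ : (F⟦X⟧)ˣ) : F⟦X⟧)) = 1 := by
    ext1 s
    have h1 := hp s
    rw [Pi.mul_apply, Pi.one_apply, ← hy s, h1, Pi.mul_apply]
    change _ = HahnSeries.single (n : ℤ) 1 * a s * _
    ring
  exact ⟨⟨a, _, hx, by rw [mul_comm, hx]⟩, fun s => (hpu s).unit⁻¹, ha, fun s => rfl⟩

end Field

section Reciprocity
variable {F k S : Type*} [Field F] [CommRing k] [Algebra F k]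

lemma scalarExtSubmodule_poleLattice (N : ℤ) :
    scalarExtSubmodule k (poleLattice F S N) = poleLattice k S N := by
  ext v
  constructor
  · intro h s n hn
    exact eq_zero_of_forall_linearForm (F := F) fun l => h l s n hn
  · intro h l s n hn
    exact (congrArg l (h s n hn)).trans (map_zero l)

lemma mul_mem_scalarExtSubmodule [Module.Finite F k] {A : Submodule F (S → F⸨X⸩)}
    (hA : ∀ a ∈ A, ∀ b ∈ A, a * b ∈ A) {v w : S → k⸨X⸩} (hv : v ∈ scalarExtSubmodule k A)
    (hw : w ∈ scalarExtSubmodule k A) : v * w ∈ scalarExtSubmodule k A := by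
  have b := Module.finBasis F k
  rw [eq_sum_smul_scalarExt b v, eq_sum_smul_scalarExt b w, Finset.sum_mul_sum]
  refine Submodule.sum_mem _ fun i _ => Submodule.sum_mem _ fun j _ => ?_
  rw [smul_mul_smul_comm, ← map_mul (scalarExt k S)]
  exact smul_scalarExt_mem _ (hA _ (hv _) _ (hw _))

/-- If `A` and a lattice span, then `A / x A` is finite-dimensional. -/
lemma exists_isBasisMod_map_mulLeft {A : Submodule F (S → F⸨X⸩)} {N : ℤ}
    (hA : A ⊔ poleLattice F S N = ⊤) {n : ℕ}
    (hinf : FiniteDimensional F (A ⊓ poleLattice F S (N + n) : Submodule F (S → F⸨X⸩)))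
    {x : (S → F⸨X⸩)ˣ} {ζ : S → (F⟦X⟧)ˣ}
    (hxA : A.map (x.mulLeftLinearEquiv F (S → F⸨X⸩)).toLinearMap ≤ A)
    (hxζ : ∀ s, ((x⁻¹ : (S → F⸨X⸩)ˣ) : S → F⸨X⸩) s =
        HahnSeries.single (n : ℤ) 1 * HahnSeries.ofPowerSeries ℤ F (ζ s)) :
    ∃ (m : ℕ) (e : Fin m → S → F⸨X⸩),
      IsBasisMod (A.map (x.mulLeftLinearEquiv F (S → F⸨X⸩)).toLinearMap) A e := by
  refine exists_isBasisMod (C := A ⊓ poleLattice F S (N + n)) fun a ha => ?_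
  obtain ⟨a', ha', w, hw, haw⟩ := Submodule.mem_sup.mp
    (hA ▸ Submodule.mem_top : ((x⁻¹ : (S → F⸨X⸩)ˣ) : S → F⸨X⸩) * a ∈ A ⊔ poleLattice F S N)
  have hxa' : (x : S → F⸨X⸩) * a' ∈ A.map (x.mulLeftLinearEquiv F (S → F⸨X⸩)).toLinearMap :=
    ⟨a', ha', rfl⟩
  have h1 : a = x * a' + x * w := by rw [← mul_add, haw, x.mul_inv_cancel_left]
  rw [h1]
  refine Submodule.add_mem_sup hxa' ⟨?_, ?_⟩
  · rw [show (x : S → F⸨X⸩) * w = a - x * a' by rw [h1, add_sub_cancel_left]]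
    exact A.sub_mem ha (hxA hxa')
  · have h2 : ∀ s, ((monomialUnit F S n : S → F⸨X⸩) * x) s ∈ powerSeriesLattice F := fun s => by
      refine ⟨((ζ s)⁻¹ : (F⟦X⟧)ˣ), ?_⟩
      have h3 : HahnSeries.ofPowerSeries ℤ F (ζ s) *
          HahnSeries.ofPowerSeries ℤ F (((ζ s)⁻¹ : (F⟦X⟧)ˣ) : F⟦X⟧) = 1 := by
        rw [← map_mul, Units.mul_inv, map_one]
      have h4 := congrFun x.mul_inv s
      rw [Pi.mul_apply, Pi.one_apply, hxζ] at h4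
      change HahnSeries.ofPowerSeries ℤ F _ = HahnSeries.single (n : ℤ) 1 * (x : S → F⸨X⸩) s
      linear_combination (-(HahnSeries.ofPowerSeries ℤ F (((ζ s)⁻¹ : (F⟦X⟧)ˣ) : F⟦X⟧))) * h4 +
        (x : S → F⸨X⸩) s * HahnSeries.single (n : ℤ) 1 * h3
    have h5 := mul_mem_poleLattice h2 hw
    rw [show N = N + n - n by omega, ← poleLattice_map_monomialUnit, mul_assoc, mem_map_mulLeft,
      Units.inv_mul_cancel_left] at h5
    exact h5

/-- The reciprocity law for a ring `A` of families of Laurent series over `F` that has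
finite-dimensional intersection with each lattice, and with some lattice spans `F((t))^S`. Since
`f` and `g` need not enlarge a lattice, they are replaced by `x / f` and `x / g`, for a function `x`
with poles of high order: in the relation between the symbols of `x / f`, `x / g` and `x`, the
contributions of `x` cancel both along the lattice and along `A`. -/
theorem prod_symbol_eq_one [IsLocalRing k] [IsArtinianRing k] [Module.Finite F k] [Fintype S]
    {A : Submodule F (S → F⸨X⸩)} (hmul : ∀ a ∈ A, ∀ b ∈ A, a * b ∈ A)
    (hsup : ∃ N, A ⊔ poleLattice F S N = ⊤)
    (hinf : ∀ N, FiniteDimensional F (A ⊓ poleLattice F S N : Submodule F (S → F⸨X⸩)))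
    {f g : (S → k⸨X⸩)ˣ} (hf : (f : S → k⸨X⸩) ∈ scalarExtSubmodule k A)
    (hf' : ((f⁻¹ : (S → k⸨X⸩)ˣ) : S → k⸨X⸩) ∈ scalarExtSubmodule k A)
    (hg : (g : S → k⸨X⸩) ∈ scalarExtSubmodule k A)
    (hg' : ((g⁻¹ : (S → k⸨X⸩)ˣ) : S → k⸨X⸩) ∈ scalarExtSubmodule k A) :
    ∏ s, symbol (MulEquiv.piUnits f s) (MulEquiv.piUnits g s) = 1 := by
  obtain ⟨N, hN⟩ := hsup
  set fs : S → (k⸨X⸩)ˣ := MulEquiv.piUnits f with hfs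
  set gs : S → (k⸨X⸩)ˣ := MulEquiv.piUnits g with hgs
  choose m hm using fun s => (wittParameters (fs s)).exists_single_mul_eq
  choose m' hm' using fun s => (wittParameters (gs s)).exists_single_mul_eq
  -- the order of the pole of the auxiliary function `x`
  obtain ⟨n, hNn, hnm, hnm'⟩ : ∃ n : ℕ, N < n ∧ (∀ s, m s ≤ n) ∧ ∀ s, m' s ≤ n := by
    refine ⟨N.natAbs + 1 + (∑ s, m s + ∑ s, m' s), by omega, fun s => ?_, fun s => ?_⟩
    · have := Finset.single_le_sum (f := m) (fun _ _ => Nat.zero_le _) (Finset.mem_univ s)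
      omega
    · have := Finset.single_le_sum (f := m') (fun _ _ => Nat.zero_le _) (Finset.mem_univ s)
      omega
  choose M c hM hdeg hfac using fun s => hm s n (hnm s)
  choose M' c' hM' hdeg' hfac' using fun s => hm' s n (hnm' s)
  obtain ⟨x, ζ, hxA, hxζ⟩ := exists_unit_mem_of_sup_eq_top hN hNn
  have hxA' : A.map (x.mulLeftLinearEquiv F (S → F⸨X⸩)).toLinearMap ≤ A := by
    rintro _ ⟨a, ha, rfl⟩
    exact hmul _ hxA _ ha
  obtain ⟨r, e, he⟩ := exists_isBasisMod_map_mulLeft hN (hinf _) hxA' hxζ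
  have hfin := hinf N
  obtain ⟨q, h, hh⟩ := exists_isBasisMod (N := ⊥) (M := A ⊓ poleLattice F S N)
    (C := A ⊓ poleLattice F S N) le_sup_right
  replace he := he.scalarExt (k := k)
  replace hh := hh.scalarExt (k := k)
  rw [scalarExtSubmodule_inf, scalarExtSubmodule_poleLattice, scalarExtSubmodule_bot] at hh
  have hN' := scalarExtSubmodule_sup (k := k) hN
  rw [scalarExtSubmodule_poleLattice] at hN'
  rw [scalarExtSubmodule_map] at he
  have hxAk := scalarExt_mem (k := k) hxA
  have hmulk : ∀ v ∈ scalarExtSubmodule k A, ∀ w ∈ scalarExtSubmodule k A,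
    v * w ∈ scalarExtSubmodule k A := fun v hv w hw => mul_mem_scalarExtSubmodule hmul hv hw
  -- from here on only the extension `Ak` of `A` to `k` matters
  generalize scalarExtSubmodule k A = Ak at *
  have hmap : ∀ w : (S → k⸨X⸩)ˣ, (w : S → k⸨X⸩) ∈ Ak →
      Ak.map (w.mulLeftLinearEquiv k (S → k⸨X⸩)).toLinearMap ≤ Ak := by
    rintro w hw _ ⟨a, ha, rfl⟩
    exact hmulk _ hw _ ha
  have hmap' : ∀ w : (S → k⸨X⸩)ˣ, (w : S → k⸨X⸩) ∈ Ak →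
      ((w⁻¹ : (S → k⸨X⸩)ˣ) : S → k⸨X⸩) ∈ Ak →
      Ak.map (w.mulLeftLinearEquiv k (S → k⸨X⸩)).toLinearMap = Ak := fun w hw hw' =>
    le_antisymm (hmap w hw) fun a ha => mem_map_mulLeft.mpr (hmulk _ hw' _ ha)
  set y : (S → k⸨X⸩)ˣ := Units.map (scalarExt k S).toMonoidHom x with hy
  let η : S → (k⟦X⟧)ˣ := fun s => Units.map (PowerSeries.map (algebraMap F k)).toMonoidHom (ζ s)
  have hyη : ∀ s, ((y⁻¹ : (S → k⸨X⸩)ˣ) : S → k⸨X⸩) s =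
      HahnSeries.single (n : ℤ) 1 * HahnSeries.ofPowerSeries ℤ k (η s) := by
    intro s
    change mapLaurent (algebraMap F k) (((x⁻¹ : (S → F⸨X⸩)ˣ) : S → F⸨X⸩) s) = _
    rw [hxζ, map_mul]
    congr 1
    · ext i
      rw [mapLaurent_coeff]
      by_cases hi : i = n
      · subst hi; simp
      · simp [HahnSeries.coeff_single_of_ne hi]
    · ext i
      rw [mapLaurent_coeff, PowerSeries.coeff_coe, PowerSeries.coeff_coe]
      split_ifs
      · exact map_zero _
      · exact (PowerSeries.coeff_map _ _ _).symm
  -- `w / x` at `s` is an invertible power series times a distinguished polynomial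
  have hfac0 : ∀ (w : (S → k⸨X⸩)ˣ) (s : S) (P : k⟦X⟧), HahnSeries.single (n : ℤ) 1 *
      (wittParameters (MulEquiv.piUnits w s)).toLaurentSeries = HahnSeries.ofPowerSeries ℤ k P →
      ((y⁻¹ * w : (S → k⸨X⸩)ˣ) : S → k⸨X⸩) s = HahnSeries.ofPowerSeries ℤ k (η s * P) := by
    intro w s P h
    rw [toLaurentSeries_wittParameters] at h
    change ((y⁻¹ : (S → k⸨X⸩)ˣ) : S → k⸨X⸩) s * (w : S → k⸨X⸩) s = _
    rw [hyη, map_mul, ← h]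
    change HahnSeries.single (n : ℤ) 1 * _ * (w : S → k⸨X⸩) s =
      _ * (HahnSeries.single (n : ℤ) 1 * (w : S → k⸨X⸩) s)
    ring
  set Df : S → k[X] := fun s => (wittParameters (fs s)).distPoly (M s) (c s) with hDf
  set Dg : S → k[X] := fun s => (wittParameters (gs s)).distPoly (M' s) (c' s) with hDg
  set αf : S → (k⟦X⟧)ˣ := fun s => (wittParameters (fs s)).isUnit_series.unit * η s with hαf
  set αg : S → (k⟦X⟧)ˣ := fun s => (wittParameters (gs s)).isUnit_series.unit * η s with hαg
  have huf : ∀ s, ((y⁻¹ * f : (S → k⸨X⸩)ˣ) : S → k⸨X⸩) s =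
      HahnSeries.ofPowerSeries ℤ k (αf s * Df s) := fun s => by
    rw [hfac0 f s _ (hfac s), hαf, Units.val_mul, IsUnit.unit_spec, ← mul_assoc,
      mul_comm (η s : k⟦X⟧)]
  have hug : ∀ s, ((y⁻¹ * g : (S → k⸨X⸩)ˣ) : S → k⸨X⸩) s =
      HahnSeries.ofPowerSeries ℤ k (αg s * Dg s) := fun s => by
    rw [hfac0 g s _ (hfac' s), hαg, Units.val_mul, IsUnit.unit_spec, ← mul_assoc,
      mul_comm (η s : k⟦X⟧)]
  have hu1 : ∀ s, ((y⁻¹ : (S → k⸨X⸩)ˣ) : S → k⸨X⸩) s =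
      HahnSeries.ofPowerSeries ℤ k (η s * (Polynomial.X ^ n : k[X])) := fun s => by
    rw [hyη, map_mul, Polynomial.coe_pow, Polynomial.coe_X, HahnSeries.ofPowerSeries_X_pow,
      mul_comm]
  have hdf : ∀ s, (Df s).IsDistinguishedAt (IsLocalRing.maximalIdeal k) :=
    fun s => WittParameters.isDistinguishedAt_distPoly _ _ _
  have hdg : ∀ s, (Dg s).IsDistinguishedAt (IsLocalRing.maximalIdeal k) :=
    fun s => WittParameters.isDistinguishedAt_distPoly _ _ _
  have hd1 : ∀ _ : S, (Polynomial.X ^ n : k[X]).IsDistinguishedAt (IsLocalRing.maximalIdeal k) :=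
    fun _ => isDistinguishedAt_X_pow n
  have hint : ∀ {u : (S → k⸨X⸩)ˣ} {P : S → k⟦X⟧}, (∀ s, (u : S → k⸨X⸩) s =
      HahnSeries.ofPowerSeries ℤ k (P s)) → ∀ s, (u : S → k⸨X⸩) s ∈ powerSeriesLattice k :=
    fun h s => ⟨_, (h s).symm⟩
  have hequiv : ∀ w : (S → k⸨X⸩)ˣ, (y⁻¹ * w)⁻¹.mulLeftLinearEquiv k (S → k⸨X⸩) =
      w⁻¹.mulLeftLinearEquiv k (S → k⸨X⸩) ≪≫ₗ y.mulLeftLinearEquiv k (S → k⸨X⸩) := by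
    intro w
    rw [mul_inv, inv_inv]
    ext1 v
    exact mul_assoc _ _ v
  have hA1 : Ak.map ((y⁻¹)⁻¹.mulLeftLinearEquiv k (S → k⸨X⸩)).toLinearMap ≤ Ak := by
    rw [inv_inv]; exact hmap y hxAk
  have hAw : ∀ w : (S → k⸨X⸩)ˣ, ((w⁻¹ : (S → k⸨X⸩)ˣ) : S → k⸨X⸩) ∈ Ak →
      Ak.map ((y⁻¹ * w)⁻¹.mulLeftLinearEquiv k (S → k⸨X⸩)).toLinearMap ≤ Ak := fun w hw => by
    rw [mul_inv, inv_inv]; exact hmap _ (hmulk _ hxAk _ hw)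
  obtain ⟨ρ₁, ρ₂, ρ₃, ρ₄, h₁, h₂, h₃, h₄, hρ⟩ := IsDiscreteSymbol.exists_mul_eq_mul he
    (f := f⁻¹.mulLeftLinearEquiv k (S → k⸨X⸩)) (g := g⁻¹.mulLeftLinearEquiv k (S → k⸨X⸩))
    (hmap y hxAk) (hmap' _ hf' (by rwa [inv_inv])) (hmap' _ hg' (by rwa [inv_inv]))
    (fun v => mul_left_comm _ _ v) (fun v => mul_left_comm _ _ v)
  rw [← hequiv, ← hequiv] at h₁
  rw [← hequiv] at h₃ h₄
  have hinv : y.mulLeftLinearEquiv k (S → k⸨X⸩) = (y⁻¹)⁻¹.mulLeftLinearEquiv k (S → k⸨X⸩) := by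
    rw [inv_inv]
  rw [hinv] at h₂ h₃ h₄
  -- the four symbols along `Ak` are products of local symbols
  have e₁ := Units.ext (latticeSymbol_eq_discreteSymbol hN' hh (hint huf) (hint hug) (hAw f hf')
    (hAw g hg') (isLatticeSymbol_productLattice hdf hdg huf hug) h₁)
  have e₂ := Units.ext (latticeSymbol_eq_discreteSymbol hN' hh (hint hu1) (hint hu1) hA1 hA1
    (isLatticeSymbol_productLattice hd1 hd1 hu1 hu1) h₂)
  have e₃ := Units.ext (latticeSymbol_eq_discreteSymbol hN' hh (hint huf) (hint hu1) (hAw f hf')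
    hA1 (isLatticeSymbol_productLattice hdf hd1 huf hu1) h₃)
  have e₄ := Units.ext (latticeSymbol_eq_discreteSymbol hN' hh (hint hu1) (hint hug) hA1
    (hAw g hg') (isLatticeSymbol_productLattice hd1 hdg hu1 hug) h₄)
  rw [← e₁, ← e₂, ← e₃, ← e₄, ← Finset.prod_mul_distrib, ← Finset.prod_mul_distrib,
    Finset.prod_congr rfl fun s _ => WittParameters.distSymbol_mul_distSymbol (hM s) (hM' s)
      (hdeg s) (hdeg' s) (η s), Finset.prod_mul_distrib] at hρ
  exact mul_eq_right.mp hρ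

end Reciprocity

/-! ### Weak approximation -/

section Order
variable {F : Type*} [Field F]

variable (F) in
/-- The Laurent series of order at least `n`. -/
def ordGE (n : ℤ) : Submodule F F⸨X⸩ where
  carrier := {f | ∀ m < n, f.coeff m = 0}
  add_mem' hf hg m hm := by rw [HahnSeries.coeff_add, hf m hm, hg m hm, add_zero]
  zero_mem' _ _ := rfl
  smul_mem' c f hf m hm := by rw [HahnSeries.coeff_smul, hf m hm, smul_zero]

variable {f g : F⸨X⸩} {m n : ℤ}

lemma ordGE_mono (h : m ≤ n) : ordGE F n ≤ ordGE F m := fun _ hf l hl => hf l (by omega)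

lemma exists_mem_ordGE (f : F⸨X⸩) : ∃ N : ℕ, f ∈ ordGE F (-N) :=
  ⟨f.order.natAbs, fun m hm => HahnSeries.coeff_eq_zero_of_lt_order (by omega)⟩

lemma mem_ordGE_iff_order (hf : f ≠ 0) : f ∈ ordGE F n ↔ n ≤ f.order :=
  ⟨fun h => not_lt.mp fun hn => HahnSeries.coeff_order_eq_zero.not.mpr hf (h _ hn),
    fun h _ hm => HahnSeries.coeff_eq_zero_of_lt_order (hm.trans_le h)⟩

lemma mul_mem_ordGE (hf : f ∈ ordGE F m) (hg : g ∈ ordGE F n) : f * g ∈ ordGE F (m + n) := by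
  rcases eq_or_ne f 0 with rfl | hf0
  · rw [zero_mul]; exact zero_mem _
  rcases eq_or_ne g 0 with rfl | hg0
  · rw [mul_zero]; exact zero_mem _
  rw [mem_ordGE_iff_order (mul_ne_zero hf0 hg0), HahnSeries.order_mul hf0 hg0]
  exact add_le_add ((mem_ordGE_iff_order hf0).mp hf) ((mem_ordGE_iff_order hg0).mp hg)

lemma one_mem_ordGE : (1 : F⸨X⸩) ∈ ordGE F 0 := fun m hm => by
  rw [HahnSeries.coeff_one, if_neg hm.ne]

lemma C_mem_ordGE (c : F) : (HahnSeries.C c : F⸨X⸩) ∈ ordGE F 0 := fun m hm => by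
  rw [HahnSeries.C_apply, HahnSeries.coeff_single_of_ne hm.ne]

lemma pow_mem_ordGE (hf : f ∈ ordGE F m) (l : ℕ) : f ^ l ∈ ordGE F (l * m) := by
  induction l with
  | zero => simpa using one_mem_ordGE
  | succ l ih =>
    rw [pow_succ, Nat.cast_succ, add_mul, one_mul]
    exact mul_mem_ordGE ih hf

lemma inv_mem_ordGE (hf : f ∉ ordGE F n) : f⁻¹ ∈ ordGE F (1 - n) := by
  have h0 : f ≠ 0 := fun h => hf (h ▸ zero_mem _)
  have h1 : f⁻¹ ≠ 0 := inv_ne_zero h0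
  have h2 := HahnSeries.order_mul h0 h1
  rw [mul_inv_cancel₀ h0, HahnSeries.order_one] at h2
  rw [mem_ordGE_iff_order h0] at hf
  rw [mem_ordGE_iff_order h1]
  omega

lemma sub_C_coeff_zero_mem_ordGE (hf : f ∈ ordGE F 0) :
    f - HahnSeries.C (f.coeff 0) ∈ ordGE F 1 := by
  intro m hm
  rcases (show m ≤ 0 by omega).lt_or_eq with h | rfl
  · rw [HahnSeries.coeff_sub, hf m h, C_mem_ordGE _ m h, sub_zero]
  · rw [HahnSeries.coeff_sub, HahnSeries.C_apply, HahnSeries.coeff_single_same, sub_self]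

lemma one_sub_pow_mem_ordGE (hf : f ∈ ordGE F 0) (h : 1 - f ∈ ordGE F n) (l : ℕ) :
    1 - f ^ l ∈ ordGE F n := by
  rw [← mul_neg_geom_sum]
  have h1 : ∑ i ∈ Finset.range l, f ^ i ∈ ordGE F 0 :=
    sum_mem fun i _ => by simpa using pow_mem_ordGE hf i
  simpa only [add_zero] using mul_mem_ordGE h h1

lemma exists_forall_mem_ordGE {ι : Type*} (T : Finset ι) (w : ι → F⸨X⸩) :
    ∃ N : ℕ, ∀ i ∈ T, w i ∈ ordGE F (-N) := by
  choose N hN using fun i => exists_mem_ordGE (w i)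
  refine ⟨∑ i ∈ T, N i, fun i hi => ordGE_mono ?_ (hN i)⟩
  have := Finset.single_le_sum (f := N) (fun _ _ => Nat.zero_le _) hi
  omega

/-- A regular series whose value at `t = 0` is not `c` is invertible after subtracting `c`. -/
lemma inv_sub_C_mem_ordGE {c : F} (hf : f ∉ ordGE F 0 ∨ f.coeff 0 ≠ c) :
    (f - HahnSeries.C c)⁻¹ ∈ ordGE F 0 := by
  refine inv_mem_ordGE (n := 1) fun h => ?_
  have h0 : f ∈ ordGE F 0 := by
    have := add_mem (ordGE_mono zero_le_one h) (C_mem_ordGE c)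
    rwa [sub_add_cancel] at this
  refine hf.elim (· h0) fun h' => h' ?_
  have h1 := h 0 one_pos
  rwa [HahnSeries.coeff_sub, HahnSeries.C_apply, HahnSeries.coeff_single_same, sub_eq_zero] at h1

end Order

section Places
variable {F K P : Type*} [Field F] [Field K] [Algebra F K]

/-- A family of places of `K` over `F`, given by embeddings of `K` in `F((t))`, that behaves like
the closed points of a complete nonsingular curve: there are uniformizers, functions without poles
are constant, functions have finitely many poles, and distinct places are separated by a
function. -/
structure IsPlaceSystem (φ : P → K →+* F⸨X⸩) : Prop where
  map_algebraMap : ∀ p c, φ p (algebraMap F K c) = HahnSeries.C c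
  exists_uniformizer : ∀ p, ∃ t, φ p t = HahnSeries.single 1 1
  exists_constant : ∀ f, (∀ p, φ p f ∈ ordGE F 0) → ∃ c, algebraMap F K c = f
  finite_poles : ∀ f, {p | φ p f ∉ ordGE F 0}.Finite
  exists_pole : ∀ p q, p ≠ q → ∃ a, φ p a ∈ ordGE F 0 ∧ φ q a ∉ ordGE F 0

variable {φ : P → K →+* F⸨X⸩} (hφ : IsPlaceSystem φ)

lemma IsPlaceSystem.map_smul (hφ : IsPlaceSystem φ) (p : P) (c : F) (f : K) :
    φ p (c • f) = c • φ p f := by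
  rw [Algebra.smul_def, map_mul, hφ.map_algebraMap, HahnSeries.C_mul_eq_smul]

/-- The places of a system as `F`-linear maps. -/
noncomputable def IsPlaceSystem.linearMap (hφ : IsPlaceSystem φ) (p : P) : K →ₗ[F] F⸨X⸩ where
  toFun := φ p
  map_add' := map_add _
  map_smul' := hφ.map_smul p

lemma IsPlaceSystem.exists_zero_pole (hφ : IsPlaceSystem φ) {p q : P} (hpq : p ≠ q) :
    ∃ c, φ p c ∈ ordGE F 1 ∧ φ q c ∉ ordGE F 0 := by
  obtain ⟨a, hap, haq⟩ := hφ.exists_pole p q hpq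
  obtain ⟨b, hbq, hbp⟩ := hφ.exists_pole q p hpq.symm
  refine ⟨a * b⁻¹, ?_, fun h => haq ?_⟩
  · rw [map_mul, map_inv₀]
    simpa using mul_mem_ordGE hap (inv_mem_ordGE hbp)
  · have hb : b ≠ 0 := by
      rintro rfl
      exact hbp (by rw [map_zero]; exact zero_mem _)
    have := mul_mem_ordGE h hbq
    rwa [← map_mul, inv_mul_cancel_right₀ hb, add_zero] at this

/-- A function with value `1` at `p`, vanishing at `q` and regular at finitely many given places. -/
lemma IsPlaceSystem.exists_separating [Infinite F] (hφ : IsPlaceSystem φ) {p q : P} (hpq : p ≠ q)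
    (T : Finset P) : ∃ h, (∀ r ∈ T, φ r h ∈ ordGE F 0) ∧ φ p (1 - h) ∈ ordGE F 1 ∧
      φ q h ∈ ordGE F 1 := by
  classical
  obtain ⟨c, hcp, hcq⟩ := hφ.exists_zero_pole hpq
  -- `h = 1 / (1 - c / l)`, where `l` is not a value of `c` at the given places
  obtain ⟨l, hl⟩ := Infinite.exists_notMem_finset
    (insert 0 (T.image fun r => (φ r c).coeff 0))
  rw [Finset.mem_insert, not_or] at hl
  have hl0 : algebraMap F K l ≠ 0 := (map_ne_zero _).mpr hl.1
  have hT : ∀ r ∈ insert p T, φ r (c - algebraMap F K l)⁻¹ ∈ ordGE F 0 := by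
    intro r hr
    rw [map_inv₀, map_sub, hφ.map_algebraMap]
    refine inv_sub_C_mem_ordGE (Or.inr ?_)
    rcases Finset.mem_insert.mp hr with rfl | hr
    · rw [hcp 0 one_pos]; exact Ne.symm hl.1
    · exact fun h => hl.2 (Finset.mem_image.mpr ⟨r, hr, h⟩)
  have hc : c - algebraMap F K l ≠ 0 := by
    intro h
    rw [sub_eq_zero] at h
    rw [h, hφ.map_algebraMap] at hcq
    exact hcq (C_mem_ordGE l)
  have hC : ∀ r, φ r (-algebraMap F K l) ∈ ordGE F 0 := fun r => by
    rw [map_neg, hφ.map_algebraMap]; exact neg_mem (C_mem_ordGE l)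
  refine ⟨-algebraMap F K l * (c - algebraMap F K l)⁻¹, fun r hr => ?_, ?_, ?_⟩
  · rw [map_mul]
    simpa using mul_mem_ordGE (hC r) (hT r (Finset.mem_insert_of_mem hr))
  · rw [show 1 - -algebraMap F K l * (c - algebraMap F K l)⁻¹ = c * (c - algebraMap F K l)⁻¹ by
      field_simp; ring, map_mul]
    simpa using mul_mem_ordGE hcp (hT p (Finset.mem_insert_self p T))
  · rw [map_mul, map_inv₀]
    have h1 : φ q (c - algebraMap F K l) ∉ ordGE F 0 := fun h => hcq (by
      have := add_mem h (neg_mem (hC q))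
      rwa [← map_neg, ← map_add, neg_neg, sub_add_cancel] at this)
    simpa using mul_mem_ordGE (hC q) (inv_mem_ordGE h1)

/-- A function close to `1` at `p` and to `0` at the other places of a finite set. -/
lemma IsPlaceSystem.exists_idempotent [Infinite F] (hφ : IsPlaceSystem φ) (p : P) (T : Finset P)
    (N : ℕ) : ∃ e, φ p (1 - e) ∈ ordGE F N ∧ ∀ q ∈ T, q ≠ p → φ q e ∈ ordGE F N := by
  classical
  choose! h hT hp hq using fun q (hq : q ≠ p) => hφ.exists_separating (Ne.symm hq) (insert p T)
  have key : ∀ T' : Finset P, T' ⊆ T.erase p → ∃ g, (∀ r ∈ insert p T, φ r g ∈ ordGE F 0) ∧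
      φ p (1 - g) ∈ ordGE F 1 ∧ ∀ q ∈ T', φ q g ∈ ordGE F 1 := by
    intro T'
    induction T' using Finset.induction_on with
    | empty => exact fun _ => ⟨1, fun r _ => by rw [map_one]; exact one_mem_ordGE, by simp, by simp⟩
    | insert q T' _ ih =>
      intro hsub
      rw [Finset.insert_subset_iff] at hsub
      obtain ⟨g, hgT, hgp, hgq⟩ := ih hsub.2
      have hqp := Finset.ne_of_mem_erase hsub.1
      have hmem : ∀ r ∈ insert q T', r ∈ insert p T := fun r hr => by
        rcases Finset.mem_insert.mp hr with rfl | hr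
        · exact Finset.mem_insert_of_mem (Finset.mem_of_mem_erase hsub.1)
        · exact Finset.mem_insert_of_mem (Finset.mem_of_mem_erase (hsub.2 hr))
      refine ⟨g * h q, fun r hr => ?_, ?_, fun r hr => ?_⟩
      · rw [map_mul]; simpa using mul_mem_ordGE (hgT r hr) (hT q hqp r hr)
      · rw [show 1 - g * h q = (1 - g) + g * (1 - h q) by ring, map_add, map_mul]
        exact add_mem hgp (by
          simpa using mul_mem_ordGE (hgT p (Finset.mem_insert_self p T)) (hp q hqp))
      · rw [map_mul]
        rcases Finset.mem_insert.mp hr with rfl | hr'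
        · simpa using mul_mem_ordGE (hgT r (hmem r hr)) (hq r hqp)
        · simpa using mul_mem_ordGE (hgq r hr') (hT q hqp r (hmem r hr))
  obtain ⟨g, hgT, hgp, hgq⟩ := key (T.erase p) subset_rfl
  -- both `1 - g` at `p` and `g` at the other places vanish at `t = 0`; powers make them smaller
  refine ⟨1 - (1 - g ^ N) ^ N, ?_, fun q hq hqp => ?_⟩
  · rw [sub_sub_cancel, map_pow]
    have h1 := one_sub_pow_mem_ordGE (hgT p (Finset.mem_insert_self p T))
      (by rwa [map_sub, map_one] at hgp) N
    rw [map_sub, map_one, map_pow]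
    simpa using pow_mem_ordGE h1 N
  · have h1 : φ q (g ^ N) ∈ ordGE F N := by
      rw [map_pow]
      simpa using pow_mem_ordGE (hgq q (Finset.mem_erase.mpr ⟨hqp, hq⟩)) N
    rw [map_sub, map_one, map_pow]
    refine one_sub_pow_mem_ordGE ?_ ?_ N
    · rw [map_sub, map_one]
      exact sub_mem one_mem_ordGE (ordGE_mono (Int.natCast_nonneg N) h1)
    · rw [map_sub, map_one, sub_sub_cancel]
      exact h1

/-- A Laurent series at one place is approximated by a finite sum of powers of a uniformizer. -/
lemma IsPlaceSystem.exists_approx_one (hφ : IsPlaceSystem φ) (p : P) (w : F⸨X⸩) (N : ℤ) :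
    ∃ f, φ p f - w ∈ ordGE F N := by
  obtain ⟨M, hM⟩ := exists_mem_ordGE w
  obtain ⟨t, ht⟩ := hφ.exists_uniformizer p
  have key : ∀ j : ℕ, ∃ f, φ p f - w ∈ ordGE F (-M + j) := by
    intro j
    induction j with
    | zero => exact ⟨0, by rw [map_zero, zero_sub, Nat.cast_zero, add_zero]; exact neg_mem hM⟩
    | succ j ih =>
      obtain ⟨f, hf⟩ := ih
      refine ⟨f - (φ p f - w).coeff (-M + j) • t ^ (-M + j : ℤ), fun m hm => ?_⟩
      rw [map_sub, hφ.map_smul, map_zpow₀, ht, sub_right_comm, HahnSeries.coeff_sub,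
        HahnSeries.coeff_smul, ← RatFunc.single_zpow]
      rcases (show m ≤ -M + j by omega).lt_or_eq with h | rfl
      · rw [hf m h, HahnSeries.coeff_single_of_ne h.ne, smul_zero, sub_zero]
      · rw [HahnSeries.coeff_single_same, smul_eq_mul, mul_one, sub_self]
  obtain ⟨f, hf⟩ := key (N + M).toNat
  exact ⟨f, ordGE_mono (by omega) hf⟩

/-- Weak approximation. -/
theorem IsPlaceSystem.exists_approx [Infinite F] (hφ : IsPlaceSystem φ) (T : Finset P)
    (v : P → F⸨X⸩) (N : ℤ) : ∃ f, ∀ p ∈ T, φ p f - v p ∈ ordGE F N := by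
  classical
  choose f hf using fun p => hφ.exists_approx_one p (v p) N
  obtain ⟨M, hM⟩ := exists_forall_mem_ordGE (T ×ˢ T) fun x => φ x.1 (f x.2)
  choose e he he' using fun p => hφ.exists_idempotent p T (N + M).toNat
  refine ⟨∑ q ∈ T, e q * f q, fun p hp => ?_⟩
  have hmul : ∀ q ∈ T, ∀ a, φ p a ∈ ordGE F (N + M).toNat → φ p (a * f q) ∈ ordGE F N := by
    intro q hq a ha
    rw [map_mul]
    exact ordGE_mono (by omega)
      (mul_mem_ordGE ha (hM (p, q) (Finset.mem_product.mpr ⟨hp, hq⟩)))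
  rw [← Finset.add_sum_erase _ _ hp, map_add, map_sum,
    show e p * f p = f p - (1 - e p) * f p by ring, map_sub, add_sub_right_comm, sub_right_comm]
  exact add_mem (sub_mem (hf p) (hmul p hp _ (he p))) (sum_mem fun q hq =>
    hmul q (Finset.mem_of_mem_erase hq) _ (he' q p hp (Finset.ne_of_mem_erase hq).symm))

end Places

/-! ### Finiteness of cohomology -/

/-- If `A` contains the kernel of a linear map from `B` to a finite-dimensional space, then `B` is
generated modulo `A` by a finite set. -/
lemma exists_finset_span_of_ker_le {F K W : Type*} [Field F] [AddCommGroup K] [Module F K]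
    [AddCommGroup W] [Module F W] [FiniteDimensional F W] (A B : Submodule F K) (ψ : K →ₗ[F] W)
    (h : ∀ b ∈ B, ψ b = 0 → b ∈ A) :
    ∃ Y : Finset K, (Y : Set K) ⊆ B ∧ ∀ b ∈ B, ∃ y ∈ Submodule.span F (Y : Set K), b - y ∈ A := by
  classical
  obtain ⟨t, ht⟩ := IsNoetherian.noetherian (B.map ψ)
  obtain ⟨Y, hYB, hY⟩ := Finset.subset_set_image_iff.mp
    (show (t : Set W) ⊆ ψ '' B from fun x hx => by
      have := Submodule.subset_span (R := F) hx
      rwa [ht] at this)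
  refine ⟨Y, hYB, fun b hb => ?_⟩
  have h1 : ψ b ∈ (Submodule.span F (Y : Set K)).map ψ := by
    rw [Submodule.map_span, ← Finset.coe_image, hY, ht]
    exact Submodule.mem_map_of_mem hb
  obtain ⟨y, hy, hyb⟩ := h1
  exact ⟨y, hy, h _ (B.sub_mem hb (Submodule.span_le.mpr hYB hy)) (by rw [map_sub, hyb, sub_self])⟩

section Places
variable {F K P : Type*} [Field F] [Field K] [Algebra F K] {φ : P → K →+* F⸨X⸩}

/-- The functions whose poles lie in `T` and have order at most `N`. -/
def IsPlaceSystem.boundedPoles (hφ : IsPlaceSystem φ) (T : Finset P) (N : ℤ) : Submodule F K where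
  carrier := {f | (∀ p ∉ T, φ p f ∈ ordGE F 0) ∧ ∀ p ∈ T, φ p f ∈ ordGE F (-N)}
  add_mem' hf hg := ⟨fun p hp => by rw [map_add]; exact add_mem (hf.1 p hp) (hg.1 p hp),
    fun p hp => by rw [map_add]; exact add_mem (hf.2 p hp) (hg.2 p hp)⟩
  zero_mem' := ⟨fun p _ => by rw [map_zero]; exact zero_mem _,
    fun p _ => by rw [map_zero]; exact zero_mem _⟩
  smul_mem' c f hf := ⟨fun p hp => by rw [hφ.map_smul]; exact Submodule.smul_mem _ _ (hf.1 p hp),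
    fun p hp => by rw [hφ.map_smul]; exact Submodule.smul_mem _ _ (hf.2 p hp)⟩

/-- The functions whose poles lie in `T`. -/
def IsPlaceSystem.regularOutside (hφ : IsPlaceSystem φ) (T : Finset P) : Submodule F K where
  carrier := {f | ∀ p ∉ T, φ p f ∈ ordGE F 0}
  add_mem' hf hg p hp := by rw [map_add]; exact add_mem (hf p hp) (hg p hp)
  zero_mem' p _ := by rw [map_zero]; exact zero_mem _
  smul_mem' c f hf p hp := by rw [hφ.map_smul]; exact Submodule.smul_mem _ _ (hf p hp)

lemma IsPlaceSystem.mul_mem_regularOutside (hφ : IsPlaceSystem φ) {T : Finset P} {f g : K}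
    (hf : f ∈ hφ.regularOutside T) (hg : g ∈ hφ.regularOutside T) :
    f * g ∈ hφ.regularOutside T := fun p hp => by
  rw [map_mul]; simpa only [add_zero] using mul_mem_ordGE (hf p hp) (hg p hp)

lemma IsPlaceSystem.pow_mem_regularOutside (hφ : IsPlaceSystem φ) {T : Finset P} {f : K}
    (hf : f ∈ hφ.regularOutside T) (n : ℕ) : f ^ n ∈ hφ.regularOutside T := fun p hp => by
  rw [map_pow]; simpa only [mul_zero] using pow_mem_ordGE (hf p hp) n

/-- The coefficients of `t ^ (-N), …, t ^ (-1)` of the expansions at the places in `T`. -/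
noncomputable def IsPlaceSystem.polarPart (hφ : IsPlaceSystem φ) (T : Finset P) (N : ℕ) :
    K →ₗ[F] T → Fin N → F where
  toFun f p i := (φ p f).coeff (-N + i)
  map_add' f g := by ext p i; simp
  map_smul' c f := by ext p i; simp [hφ.map_smul]

lemma IsPlaceSystem.mem_ordGE_zero_of_polarPart_eq_zero (hφ : IsPlaceSystem φ) {T : Finset P}
    {N : ℕ} {f : K} (h : hφ.polarPart T N f = 0) {p : P} (hp : p ∈ T)
    (hf : φ p f ∈ ordGE F (-N)) : φ p f ∈ ordGE F 0 := by
  intro m hm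
  rcases lt_or_ge m (-N) with h' | h'
  · exact hf m h'
  · have h1 := congrFun (congrFun h ⟨p, hp⟩) ⟨(m + N).toNat, by omega⟩
    have h2 : (-N + ((m + N).toNat : ℤ)) = m := by omega
    change (φ p f).coeff (-N + ((m + N).toNat : ℤ)) = 0 at h1
    rwa [h2] at h1

lemma IsPlaceSystem.finiteDimensional_boundedPoles (hφ : IsPlaceSystem φ) (T : Finset P) (N : ℕ) :
    FiniteDimensional F (hφ.boundedPoles T N) := by
  obtain ⟨Y, -, hY⟩ := exists_finset_span_of_ker_le (Submodule.span F {(1 : K)})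
    (hφ.boundedPoles T N) (hφ.polarPart T N) fun f hf h0 => by
      obtain ⟨c, rfl⟩ := hφ.exists_constant f fun p => by
        by_cases hp : p ∈ T
        · exact hφ.mem_ordGE_zero_of_polarPart_eq_zero h0 hp (hf.2 p hp)
        · exact hf.1 p hp
      rw [Algebra.algebraMap_eq_smul_one]
      exact Submodule.smul_mem _ _ (Submodule.mem_span_singleton_self 1)
  have hle : hφ.boundedPoles T N ≤ Submodule.span F (Y : Set K) ⊔ Submodule.span F {(1 : K)} := by
    intro b hb
    obtain ⟨y, hy, hby⟩ := hY b hb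
    rw [← add_sub_cancel y b]
    exact Submodule.add_mem_sup hy hby
  exact Submodule.finiteDimensional_of_le hle

/-- Some functions, finite in number, approximate all families of series without poles at the
places of `T`. -/
lemma IsPlaceSystem.exists_finset_approx [Infinite F] (hφ : IsPlaceSystem φ) (T : Finset P)
    (M : ℕ) : ∃ Y : Finset K, ∀ u : P → F⸨X⸩, (∀ p ∈ T, u p ∈ ordGE F 0) →
      ∃ y ∈ Submodule.span F (Y : Set K), ∀ p ∈ T, u p - φ p y ∈ ordGE F M := by
  classical
  choose y hy using fun x : P × ℕ => hφ.exists_approx T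
    (Function.update 0 x.1 (HahnSeries.single (x.2 : ℤ) 1)) M
  refine ⟨(T ×ˢ Finset.range M).image y, fun u hu => ⟨∑ x ∈ T ×ˢ Finset.range M,
    (u x.1).coeff x.2 • y x, sum_mem fun x hx => Submodule.smul_mem _ _
      (Submodule.subset_span (Finset.mem_coe.mpr (Finset.mem_image_of_mem y hx))), fun p hp => ?_⟩⟩
  have h1 : u p - ∑ i ∈ Finset.range M, (u p).coeff i • HahnSeries.single (i : ℤ) (1 : F) ∈
      ordGE F M := by
    intro m hm
    rw [HahnSeries.coeff_sub, HahnSeries.coeff_sum]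
    rcases lt_or_ge m 0 with h | h
    · rw [hu p hp m h, Finset.sum_eq_zero, sub_zero]
      intro i _
      rw [HahnSeries.coeff_smul, HahnSeries.coeff_single_of_ne (by omega), smul_zero]
    · lift m to ℕ using h
      rw [Finset.sum_eq_single m]
      · rw [HahnSeries.coeff_smul, HahnSeries.coeff_single_same, smul_eq_mul, mul_one, sub_self]
      · intro i _ hi
        rw [HahnSeries.coeff_smul, HahnSeries.coeff_single_of_ne (by omega), smul_zero]
      · intro hM
        exact absurd (Finset.mem_range.mpr (by omega)) hM
  have h2 : ∑ i ∈ Finset.range M, (u p).coeff i • HahnSeries.single (i : ℤ) (1 : F) =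
      ∑ x ∈ T ×ˢ Finset.range M, (u x.1).coeff x.2 •
        Function.update (0 : P → F⸨X⸩) x.1 (HahnSeries.single (x.2 : ℤ) 1) p := by
    rw [Finset.sum_product, Finset.sum_eq_single p]
    · simp
    · intro q _ hq
      refine Finset.sum_eq_zero fun i _ => ?_
      rw [Function.update_of_ne hq.symm, Pi.zero_apply, smul_zero]
    · exact fun h => absurd hp h
  rw [h2] at h1
  have h3 : ∑ x ∈ T ×ˢ Finset.range M, (u x.1).coeff x.2 • (φ p (y x) -
      Function.update (0 : P → F⸨X⸩) x.1 (HahnSeries.single (x.2 : ℤ) 1) p) ∈ ordGE F M :=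
    sum_mem fun x _ => Submodule.smul_mem _ _ (hy x p hp)
  have h4 := sub_mem h1 h3
  simp only [smul_sub, Finset.sum_sub_distrib] at h4
  rw [sub_sub_sub_cancel_right] at h4
  rw [map_sum]
  simpa only [hφ.map_smul] using h4

/-- For a suitable set of places that contains `S`, namely the poles of a function `x` that has
poles in `S`, the functions regular outside this set and the families with bounded poles span. -/
lemma IsPlaceSystem.exists_superset_approx [Infinite F] (hφ : IsPlaceSystem φ) {S : Finset P}
    (hS : S.Nonempty) : ∃ (T : Finset P) (N : ℕ), S ⊆ T ∧ ∀ v : P → F⸨X⸩,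
      ∃ a ∈ hφ.regularOutside T, ∀ p ∈ T, φ p a - v p ∈ ordGE F (-N) := by
  classical
  obtain ⟨x, hx⟩ := hφ.exists_approx S (fun _ => HahnSeries.single (-1) 1) 0
  let T := (hφ.finite_poles x).toFinset
  have hT : ∀ p, p ∈ T ↔ φ p x ∉ ordGE F 0 := fun p => Set.Finite.mem_toFinset _
  have hST : S ⊆ T := fun p hp => by
    rw [hT]
    intro h
    have h1 := sub_mem h (hx p hp) (-1) (by omega)
    rw [sub_sub_cancel, HahnSeries.coeff_single_same] at h1
    exact one_ne_zero h1
  have hxT : x ∈ hφ.regularOutside T := fun p hp => not_not.mp ((hT p).not.mp hp)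
  obtain ⟨M, hM⟩ := exists_forall_mem_ordGE T fun p => φ p x
  -- multiplication by `x` makes the error of the approximation by `Y` regular again
  obtain ⟨Y, hY⟩ := hφ.exists_finset_approx T M
  -- the poles of the functions in `Y` outside `T` are removed by a polynomial in `x`
  let Q := Y.biUnion fun y => (hφ.finite_poles y).toFinset
  obtain ⟨M', hM'⟩ := exists_forall_mem_ordGE (Q ×ˢ Y) fun z => φ z.1 z.2
  let b : K := ∏ q ∈ Q, (x - algebraMap F K ((φ q x).coeff 0)) ^ M'
  have hxc : ∀ c, x - algebraMap F K c ∈ hφ.regularOutside T := fun c =>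
    sub_mem hxT fun p _ => by rw [hφ.map_algebraMap]; exact C_mem_ordGE c
  have hbT : b ∈ hφ.regularOutside T := by
    refine Finset.prod_induction _ (· ∈ hφ.regularOutside T)
      (fun _ _ => hφ.mul_mem_regularOutside) (fun p _ => ?_) fun q _ =>
        hφ.pow_mem_regularOutside (hxc _) M'
    rw [map_one]; exact one_mem_ordGE
  have hbQ : ∀ q ∈ Q, q ∉ T → φ q b ∈ ordGE F M' := fun q hq hqT => by
    have h1 : φ q ((x - algebraMap F K ((φ q x).coeff 0)) ^ M') ∈ ordGE F M' := by
      rw [map_pow, map_sub, hφ.map_algebraMap]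
      simpa only [mul_one] using pow_mem_ordGE (sub_C_coeff_zero_mem_ordGE (hxT q hqT)) M'
    have h2 : ∏ r ∈ Q.erase q, (x - algebraMap F K ((φ r x).coeff 0)) ^ M' ∈
        hφ.regularOutside T := by
      refine Finset.prod_induction _ (· ∈ hφ.regularOutside T)
        (fun _ _ => hφ.mul_mem_regularOutside) (fun p _ => ?_) fun q _ =>
          hφ.pow_mem_regularOutside (hxc _) M'
      rw [map_one]; exact one_mem_ordGE
    change φ q (∏ q ∈ Q, (x - algebraMap F K ((φ q x).coeff 0)) ^ M') ∈ _
    rw [← Finset.mul_prod_erase _ _ hq, map_mul]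
    simpa only [add_zero] using mul_mem_ordGE h1 (h2 q hqT)
  have hbY : ∀ y ∈ Submodule.span F (Y : Set K), b * y ∈ hφ.regularOutside T := by
    intro y hy
    induction hy using Submodule.span_induction with
    | mem y hy =>
      intro q hq
      by_cases hqQ : q ∈ Q
      · rw [map_mul]
        simpa only [add_neg_cancel] using mul_mem_ordGE (hbQ q hqQ hq)
          (hM' (q, y) (Finset.mem_product.mpr ⟨hqQ, hy⟩))
      · rw [map_mul]
        have h1 : φ q y ∈ ordGE F 0 := by
          by_contra h
          exact hqQ (Finset.mem_biUnion.mpr ⟨y, hy, (Set.Finite.mem_toFinset _).mpr h⟩)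
        simpa only [add_zero] using mul_mem_ordGE (hbT q hq) h1
    | zero => rw [mul_zero]; exact zero_mem _
    | add y z _ _ hy hz => rw [mul_add]; exact add_mem hy hz
    | smul c y _ hy => rw [mul_smul_comm]; exact Submodule.smul_mem _ _ hy
  obtain ⟨p₀, hp₀⟩ := hS
  have hb0 : b ≠ 0 := by
    refine Finset.prod_ne_zero_iff.mpr fun q _ => pow_ne_zero _ fun h => ?_
    rw [sub_eq_zero] at h
    refine (hT p₀).mp (hST hp₀) ?_
    rw [h, hφ.map_algebraMap]
    exact C_mem_ordGE _
  -- approximate `w` by a function `y`, split off `x ^ i b y`, and lower the power of `x`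
  have key : ∀ (i : ℕ) (w : P → F⸨X⸩), (∀ p ∈ T, w p ∈ ordGE F 0) →
      ∃ a ∈ hφ.regularOutside T, ∃ w' : P → F⸨X⸩, (∀ p ∈ T, w' p ∈ ordGE F 0) ∧
        ∀ p ∈ T, φ p (x ^ i * b) * w p = φ p a + φ p b * w' p := by
    intro i
    induction i with
    | zero => exact fun w hw => ⟨0, zero_mem _, w, hw, fun p _ => by
        rw [pow_zero, one_mul, map_zero, zero_add]⟩
    | succ i ih =>
      intro w hw
      obtain ⟨y, hyY, hy⟩ := hY w hw
      obtain ⟨a, ha, w', hw', haw⟩ := ih (fun p => φ p x * (w p - φ p y)) fun p hp => by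
        simpa only [neg_add_cancel] using mul_mem_ordGE (hM p hp) (hy p hp)
      refine ⟨x ^ (i + 1) * (b * y) + a, add_mem (hφ.mul_mem_regularOutside
        (hφ.pow_mem_regularOutside hxT _) (hbY y hyY)) ha, w', hw', fun p hp => ?_⟩
      have h1 := haw p hp
      simp only [map_add, map_mul, map_pow] at h1 ⊢
      linear_combination h1
  obtain ⟨N, hN⟩ := exists_forall_mem_ordGE T fun p => φ p b
  refine ⟨T, N, hST, fun v => ?_⟩
  obtain ⟨L, hL⟩ := exists_forall_mem_ordGE T fun p => (φ p b)⁻¹ * v p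
  obtain ⟨a, ha, w', hw', haw⟩ := key L (fun p => (φ p x)⁻¹ ^ L * ((φ p b)⁻¹ * v p)) fun p hp => by
    have h1 := pow_mem_ordGE (inv_mem_ordGE ((hT p).mp hp)) L
    simpa using mul_mem_ordGE h1 (hL p hp)
  refine ⟨a, ha, fun p hp => ?_⟩
  have hx0 : φ p x ≠ 0 := fun h => (hT p).mp hp (h ▸ zero_mem _)
  have hb0' : φ p b ≠ 0 := (map_ne_zero _).mpr hb0
  have h1 := haw p hp
  rw [map_mul, map_pow, inv_pow] at h1
  have h2 : φ p a - v p = -(φ p b * w' p) := by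
    field_simp at h1
    linear_combination -h1
  rw [h2]
  simpa only [add_zero] using neg_mem (mul_mem_ordGE (hN p hp) (hw' p hp))

/-- The functions regular outside `S` and the families with bounded poles span. This holds for a
larger set `T`; and the functions with bounded poles in `T ∖ S` are, modulo those regular outside
`S`, spanned by finitely many functions, whose poles in `S` are bounded. -/
theorem IsPlaceSystem.exists_regularOutside_approx [Infinite F] (hφ : IsPlaceSystem φ)
    {S : Finset P} (hS : S.Nonempty) : ∃ N : ℕ, ∀ v : P → F⸨X⸩,
      ∃ a ∈ hφ.regularOutside S, ∀ p ∈ S, φ p a - v p ∈ ordGE F (-N) := by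
  classical
  obtain ⟨T, N, hST, hT⟩ := hφ.exists_superset_approx hS
  let B : Submodule F K :=
    { carrier := {f | f ∈ hφ.regularOutside T ∧ ∀ p ∈ T \ S, φ p f ∈ ordGE F (-N)}
      add_mem' := fun hf hg => ⟨add_mem hf.1 hg.1, fun p hp => by
        rw [map_add]; exact add_mem (hf.2 p hp) (hg.2 p hp)⟩
      zero_mem' := ⟨zero_mem _, fun p _ => by rw [map_zero]; exact zero_mem _⟩
      smul_mem' := fun c f hf => ⟨Submodule.smul_mem _ _ hf.1, fun p hp => by
        rw [hφ.map_smul]; exact Submodule.smul_mem _ _ (hf.2 p hp)⟩ }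
  obtain ⟨Y, -, hY⟩ := exists_finset_span_of_ker_le (hφ.regularOutside S) B
    (hφ.polarPart (T \ S) N) fun f hf h0 p hp => by
      by_cases hpT : p ∈ T
      · have hp' := Finset.mem_sdiff.mpr ⟨hpT, hp⟩
        exact hφ.mem_ordGE_zero_of_polarPart_eq_zero h0 hp' (hf.2 p hp')
      · exact hf.1 p hpT
  obtain ⟨M, hM⟩ := exists_forall_mem_ordGE (S ×ˢ Y) fun z => φ z.1 z.2
  have hM' : ∀ p ∈ S, ∀ y ∈ Submodule.span F (Y : Set K), φ p y ∈ ordGE F (-M) := by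
    intro p hp y hy
    induction hy using Submodule.span_induction with
    | mem y hy => exact hM (p, y) (Finset.mem_product.mpr ⟨hp, hy⟩)
    | zero => rw [map_zero]; exact zero_mem _
    | add y z _ _ hy hz => rw [map_add]; exact add_mem hy hz
    | smul c y _ hy => rw [hφ.map_smul]; exact Submodule.smul_mem _ _ hy
  refine ⟨N + M, fun v => ?_⟩
  obtain ⟨f, hf, hfv⟩ := hT fun p => if p ∈ S then v p else 0
  obtain ⟨y, hyY, hy⟩ := hY f ⟨hf, fun p hp => by
    have h1 := hfv p (Finset.sdiff_subset hp)
    rwa [if_neg (Finset.mem_sdiff.mp hp).2, sub_zero] at h1⟩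
  refine ⟨f - y, hy, fun p hp => ?_⟩
  have h1 := hfv p (hST hp)
  rw [if_pos hp] at h1
  rw [map_sub, sub_right_comm]
  exact sub_mem (ordGE_mono (by omega) h1) (ordGE_mono (by omega) (hM' p hp y hyY))

end Places

/-! ### Points and local rings of a curve -/

section Curve
open AlgebraicGeometry CategoryTheory TopologicalSpace
variable {F : Type u} [Field F] {X : Scheme.{u}} [X.Over (Spec (.of F))]

/-- The closure of a point, as an irreducible closed set. -/
def pointClosure {T : Type*} [TopologicalSpace T] (x : T) : IrreducibleCloseds T :=
  ⟨closure {x}, isIrreducible_singleton.closure, isClosed_closure⟩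

lemma IsCompleteNonsingularCurve.isMin_or_isMax (hX : IsCompleteNonsingularCurve F X)
    (Z : IrreducibleCloseds X) : IsMin Z ∨ IsMax Z :=
  Order.krullDim_le_one_iff.mp hX.dim_eq_one.le Z

lemma IsCompleteNonsingularCurve.isMin_of_ne_univ (hX : IsCompleteNonsingularCurve F X)
    {Z : IrreducibleCloseds X} (hZ : (Z : Set X) ≠ Set.univ) : IsMin Z := by
  have := hX.isIntegral
  refine (hX.isMin_or_isMax Z).resolve_right fun h => hZ ?_
  have h1 : Z ≤ ⟨Set.univ, IrreducibleSpace.isIrreducible_univ X, isClosed_univ⟩ :=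
    fun x _ => trivial
  exact Set.univ_subset_iff.mp (h h1)

lemma IsCompleteNonsingularCurve.subsingleton_of_ne_univ (hX : IsCompleteNonsingularCurve F X)
    {Z : IrreducibleCloseds X} (hZ : (Z : Set X) ≠ Set.univ) : (Z : Set X).Subsingleton := by
  have hmin := hX.isMin_of_ne_univ hZ
  have key : ∀ x ∈ (Z : Set X), closure {x} = (Z : Set X) := fun x hx => by
    have h1 : pointClosure x ≤ Z := closure_minimal (Set.singleton_subset_iff.mpr hx) Z.isClosed
    exact le_antisymm h1 (hmin h1)
  intro x hx y hy
  have h1 : Inseparable x y := inseparable_iff_closure_eq.mpr ((key x hx).trans (key y hy).symm)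
  exact h1.eq

/-- A point of the curve other than the generic point is closed. -/
lemma IsCompleteNonsingularCurve.isClosed_singleton [IsIntegral X]
    (hX : IsCompleteNonsingularCurve F X) {x : X} (hx : x ≠ genericPoint X) : IsClosed {x} := by
  have h1 : (pointClosure x : Set X) ≠ Set.univ := fun h => hx
    ((isGenericPoint_def.mpr h).eq (genericPoint_spec X))
  have h2 := hX.subsingleton_of_ne_univ h1
  have h3 : closure {x} = {x} := h2.eq_singleton_of_mem (subset_closure (Set.mem_singleton x))
  exact h3 ▸ isClosed_closure

lemma IsCompleteNonsingularCurve.isNoetherian (hX : IsCompleteNonsingularCurve F X) :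
    IsNoetherian X := by
  have := hX.isProper
  have h1 : IsLocallyNoetherian X := LocallyOfFiniteType.isLocallyNoetherian (X ↘ Spec (.of F))
  have h2 : CompactSpace X := (quasiCompact_iff_compactSpace (X ↘ Spec (.of F))).mp inferInstance
  exact { }

/-- A proper closed subset of the curve is finite. -/
lemma IsCompleteNonsingularCurve.finite_of_isClosed (hX : IsCompleteNonsingularCurve F X)
    {Z : Set X} (hZ : IsClosed Z) (hZ' : Z ≠ Set.univ) : Z.Finite := by
  have := hX.isNoetherian
  obtain ⟨T, hT, hclosed, hirr, rfl⟩ := NoetherianSpace.exists_finite_set_isClosed_irreducible hZ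
  refine hT.sUnion fun t ht => (hX.subsingleton_of_ne_univ
    (Z := ⟨t, hirr t ht, hclosed t ht⟩) fun h => hZ' ?_).finite
  exact Set.eq_univ_of_subset (Set.subset_sUnion_of_mem ht) h

/-- The maximal ideal of a regular local ring of dimension at most one is principal. -/
lemma IsCompleteNonsingularCurve.exists_isUniformizer (hX : IsCompleteNonsingularCurve F X)
    (x : X) : ∃ π : X.presheaf.stalk x, IsUniformizer π := by
  have := hX.isRegularLocalRing x
  have h1 : ringKrullDim (X.presheaf.stalk x) ≤ 1 := by
    rw [← PrimeSpectrum.topologicalKrullDim_eq_ringKrullDim, ← hX.dim_eq_one]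
    exact (X.fromSpecStalk x).isEmbedding.isInducing.topologicalKrullDim_le
  rw [← (IsRegularLocalRing.iff_finrank_cotangentSpace _).mp this] at h1
  obtain ⟨π, hπ⟩ := IsLocalRing.finrank_cotangentSpace_le_one_iff.mp (Nat.cast_le_one.mp h1)
  exact ⟨π, hπ⟩

end Curve

/-! ### Expansions of meromorphic functions -/

section Expansion
variable {F A K : Type*} [Field F] [CommRing A] [Algebra F A] [IsLocalRing A] [IsNoetherianRing A]
  [IsDomain A] [Field K] [Algebra A K] [IsFractionRing A K] [Algebra F K] [IsScalarTower F A K]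
  (hA : ¬ IsField A) (hF : Function.Surjective (algebraMap F (IsLocalRing.ResidueField A)))
  {π : A} (hπ : IsUniformizer π)

lemma fractionExpansion_algebraMap (a : A) : fractionExpansion F K hA hF hπ (algebraMap A K a) =
    HahnSeries.ofPowerSeries ℤ F (expansion F hA hF hπ a) :=
  IsFractionRing.lift_algebraMap
    (HahnSeries.ofPowerSeries_injective.comp (expansion_injective hA hF hπ)) a

lemma expansion_uniformizer : expansion F hA hF hπ π = PowerSeries.X := by
  have hnz : π ≠ 0 := fun h => hA (IsLocalRing.isField_iff_maximalIdeal_eq.mpr (by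
    rw [hπ, h, Ideal.span_singleton_eq_bot.mpr rfl]))
  have hu : ¬ IsUnit π := (IsLocalRing.mem_maximalIdeal π).mp (by
    rw [hπ]; exact Ideal.mem_span_singleton_self π)
  refine (isExpansion_expansion hA hF hπ π).unique (mem_nonZeroDivisors_of_ne_zero hnz) hu ?_
  rw [isExpansion_iff]
  exact fun n => ⟨Polynomial.X, by simp, by simp⟩

lemma ofPowerSeries_mem_ordGE (f : F⟦X⟧) : HahnSeries.ofPowerSeries ℤ F f ∈ ordGE F 0 :=
  mem_powerSeriesLattice_iff.mp ⟨f, rfl⟩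

/-- A fraction lies in the local ring if and only if its expansion has no pole. -/
lemma fractionExpansion_mem_ordGE_iff {f : K} :
    fractionExpansion F K hA hF hπ f ∈ ordGE F 0 ↔ ∃ a, algebraMap A K a = f := by
  constructor
  · intro h
    rcases eq_or_ne f 0 with rfl | hf
    · exact ⟨0, map_zero _⟩
    have hprin : (IsLocalRing.maximalIdeal A).IsPrincipal := ⟨π, hπ⟩
    have hval : ValuationRing A := ((IsDiscreteValuationRing.TFAE A hA).out 1 4).mpr hprin
    rcases ValuationRing.isInteger_or_isInteger A f with ⟨a, ha⟩ | ⟨b, hb⟩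
    · exact ⟨a, ha⟩
    by_cases hbu : IsUnit b
    · obtain ⟨c, rfl⟩ := hbu
      refine ⟨(c⁻¹ : Aˣ), ?_⟩
      have h1 : algebraMap A K (c⁻¹ : Aˣ) * algebraMap A K c = 1 := by
        rw [← map_mul, Units.inv_mul, map_one]
      rw [hb] at h1
      rw [eq_inv_of_mul_eq_one_left h1, inv_inv]
    · -- the expansion of `f⁻¹` would vanish at `t = 0`
      exfalso
      have h1 : b ∈ IsLocalRing.maximalIdeal A := hbu
      rw [hπ, Ideal.mem_span_singleton] at h1
      obtain ⟨c, rfl⟩ := h1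
      have h2 : fractionExpansion F K hA hF hπ f⁻¹ ∈ ordGE F (1 + 0) := by
        rw [← hb, fractionExpansion_algebraMap, map_mul, map_mul, expansion_uniformizer,
          HahnSeries.ofPowerSeries_X]
        refine mul_mem_ordGE (fun m hm => ?_) (ofPowerSeries_mem_ordGE _)
        rw [HahnSeries.coeff_single_of_ne hm.ne]
      have h3 := mul_mem_ordGE h h2
      rw [← map_mul, mul_inv_cancel₀ hf, map_one] at h3
      have h4 := h3 0 (by omega)
      rw [HahnSeries.coeff_one, if_pos rfl] at h4
      exact one_ne_zero h4
  · rintro ⟨a, rfl⟩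
    rw [fractionExpansion_algebraMap]
    exact ofPowerSeries_mem_ordGE _

end Expansion

section Curve
open AlgebraicGeometry CategoryTheory TopologicalSpace
variable {F : Type u} [Field F] {X : Scheme.{u}} [X.Over (Spec (.of F))]

/-- A meromorphic function that lies in the local rings at the points of an open set is a section
over this set. -/
lemma exists_germ_eq_of_forall_mem_stalk [IsIntegral X] (U : X.Opens) (hU : genericPoint X ∈ U)
    (f : X.functionField)
    (hf : ∀ x ∈ U, ∃ a : X.presheaf.stalk x, algebraMap _ X.functionField a = f) :
    ∃ s : Γ(X, U), X.presheaf.germ U (genericPoint X) hU s = f := by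
  have hgen : ∀ V : X.Opens, ∀ x ∈ V, genericPoint X ∈ V := fun V x hx =>
    ((genericPoint_spec X).mem_open_set_iff V.isOpen).mpr ⟨x, trivial, hx⟩
  have h1 : ∀ x : U, ∃ (V : X.Opens) (hV : x.1 ∈ V) (_ : V ≤ U) (s : Γ(X, V)),
      X.presheaf.germ V (genericPoint X) (hgen V x hV) s = f := by
    rintro ⟨x, hx⟩
    obtain ⟨a, ha⟩ := hf x hx
    obtain ⟨V, hV, s, rfl⟩ := X.presheaf.exists_germ_eq a
    refine ⟨V ⊓ U, ⟨hV, hx⟩, inf_le_right, X.presheaf.map (homOfLE inf_le_left).op s, ?_⟩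
    rw [← ha, TopCat.Presheaf.germ_res_apply]
    exact (TopCat.Presheaf.germ_stalkSpecializes_apply ..).symm
  choose V hV hVU s hs using h1
  obtain ⟨t, ht, -⟩ := X.sheaf.existsUnique_gluing' V U (fun x => homOfLE (hVU x))
    (fun x hx => Opens.mem_iSup.mpr ⟨⟨x, hx⟩, hV _⟩) s (by
      intro x y
      have hxy : genericPoint X ∈ V x ⊓ V y := ⟨hgen _ x (hV x), hgen _ y (hV y)⟩
      apply germ_injective_of_isIntegral X (genericPoint X) hxy
      refine (TopCat.Presheaf.germ_res_apply ..).trans ?_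
      refine Eq.trans ?_ (TopCat.Presheaf.germ_res_apply ..).symm
      exact (hs x).trans (hs y).symm)
  refine ⟨t, ?_⟩
  have h2 := ht ⟨genericPoint X, hU⟩
  rw [← hs ⟨genericPoint X, hU⟩, ← h2]
  exact (TopCat.Presheaf.germ_res_apply ..).symm

end Curve

/-! ### The closed points of a curve as places -/

section Curve
open AlgebraicGeometry CategoryTheory TopologicalSpace
variable {F : Type u} [Field F] {X : Scheme.{u}} [X.Over (Spec (.of F))]

/-- Closed points are determined by their local rings in the function field, since the curve is
separated. -/
lemma IsCompleteNonsingularCurve.eq_of_stalk_le [IsIntegral X]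
    (hX : IsCompleteNonsingularCurve F X) {p q : X} (hq : IsClosed {q})
    (h : ∀ a : X.presheaf.stalk p, ∃ b : X.presheaf.stalk q,
      algebraMap _ X.functionField b = algebraMap _ X.functionField a) : p = q := by
  have := hX.isProper
  have hinj : Function.Injective (algebraMap (X.presheaf.stalk q) X.functionField) :=
    IsFractionRing.injective _ _
  choose i hi using h
  -- the inclusion `ι` of the local rings gives a second morphism from the spectrum of the local
  -- ring at `q` to the curve, which agrees with the canonical one at the generic point
  let ι : X.presheaf.stalk p →+* X.presheaf.stalk q :=
    { toFun := i
      map_one' := hinj (by rw [hi, map_one, map_one])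
      map_mul' := fun a b => hinj (by rw [hi, map_mul, map_mul, hi, hi])
      map_zero' := hinj (by rw [hi, map_zero, map_zero])
      map_add' := fun a b => hinj (by rw [hi, map_add, map_add, hi, hi]) }
  have hp' : genericPoint X ⤳ p := (genericPoint_spec X).specializes trivial
  have hq' : genericPoint X ⤳ q := (genericPoint_spec X).specializes trivial
  have hι : CommRingCat.ofHom ι ≫ X.presheaf.stalkSpecializes hq' =
      X.presheaf.stalkSpecializes hp' := by
    ext a
    exact hi a
  have hιF : ι.comp (algebraMap F (X.presheaf.stalk p)) = algebraMap F (X.presheaf.stalk q) := by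
    ext c
    apply hinj
    rw [← IsScalarTower.algebraMap_apply, RingHom.comp_apply]
    exact (hi _).trans (IsScalarTower.algebraMap_apply ..).symm
  have hdom : IsDominant (Spec.map (X.presheaf.stalkSpecializes hq')) := by
    refine ⟨(PrimeSpectrum.denseRange_comap_iff_ker_le_nilRadical _).mpr ?_⟩
    exact ((RingHom.injective_iff_ker_eq_bot _).mp hinj).le.trans bot_le
  have key : X.fromSpecStalk q = Spec.map (CommRingCat.ofHom ι) ≫ X.fromSpecStalk p := by
    refine ext_of_isDominant_of_isSeparated (X ↘ Spec (.of F)) ?_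
      (Spec.map (X.presheaf.stalkSpecializes hq')) ?_
    · rw [Category.assoc, ← specMap_algebraMap_stalk, ← specMap_algebraMap_stalk, ← Spec.map_comp,
        ← CommRingCat.ofHom_comp, hιF]
    · rw [← Category.assoc, ← Spec.map_comp, hι, Scheme.SpecMap_stalkSpecializes_fromSpecStalk,
        Scheme.SpecMap_stalkSpecializes_fromSpecStalk]
  have h1 : q ∈ Set.range (X.fromSpecStalk p) := by
    refine ⟨(Spec.map (CommRingCat.ofHom ι)) (IsLocalRing.closedPoint (X.presheaf.stalk q)), ?_⟩
    have h := congrArg (fun φ => φ (IsLocalRing.closedPoint (X.presheaf.stalk q))) key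
    exact h.symm.trans Scheme.fromSpecStalk_closedPoint
  rw [Scheme.range_fromSpecStalk] at h1
  have h2 := h1.mem_closed hq (Set.mem_singleton q)
  exact h2

variable [IsAlgClosed F]

/-- The functions regular on the whole curve are constant. -/
lemma IsCompleteNonsingularCurve.exists_algebraMap_eq [IsIntegral X]
    (hX : IsCompleteNonsingularCurve F X) (s : Γ(X, ⊤)) : ∃ c : F, algebraMap F X.functionField c =
      X.presheaf.germ ⊤ (genericPoint X) trivial s := by
  have := hX.isProper
  let ψ : F →+* Γ(X, ⊤) := ((Scheme.ΓSpecIso (.of F)).inv ≫ (X ↘ Spec (.of F)).appTop).hom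
  have hψ : ψ.IsIntegral := by
    apply RingHom.isIntegral_respectsIso.2
      (e := (Scheme.ΓSpecIso (.of F)).symm.commRingCatIsoToRingEquiv)
    exact isIntegral_appTop_of_universallyClosed (X ↘ Spec (.of F))
  obtain ⟨c, rfl⟩ := (IsAlgClosed.ringHom_bijective_of_isIntegral ψ hψ).2 s
  exact ⟨c, rfl⟩

variable (hX : IsCompleteNonsingularCurve F X) [IsIntegral X]
  {π : ∀ p : closedPoints X, X.presheaf.stalk p.1} (hπ : ∀ p, IsUniformizer (π p))

/-- The expansion of meromorphic functions at a closed point, for a choice of uniformizers. -/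
noncomputable def IsCompleteNonsingularCurve.placeHom (p : closedPoints X) :
    X.functionField →+* F⸨X⸩ :=
  have := hX.isRegularLocalRing p.1
  (fractionExpansion F X.functionField (hX.not_isField_stalk p.2) (hX.residue_surjective p.2)
    (hπ p)).toRingHom

lemma IsCompleteNonsingularCurve.placeHom_mem_ordGE_iff {p : closedPoints X}
    {f : X.functionField} : hX.placeHom hπ p f ∈ ordGE F 0 ↔
      ∃ a : X.presheaf.stalk p.1, algebraMap _ X.functionField a = f :=
  have := hX.isRegularLocalRing p.1
  fractionExpansion_mem_ordGE_iff ..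

/-- A meromorphic function is a section over an open set if its expansions at the closed points
there have no poles. -/
lemma IsCompleteNonsingularCurve.exists_germ_eq {U : X.Opens} (hU : genericPoint X ∈ U)
    {f : X.functionField} (hf : ∀ p : closedPoints X, p.1 ∈ U → hX.placeHom hπ p f ∈ ordGE F 0) :
    ∃ s : Γ(X, U), X.presheaf.germ U (genericPoint X) hU s = f := by
  refine exists_germ_eq_of_forall_mem_stalk U hU f fun x hx => ?_
  by_cases h : x = genericPoint X
  · subst h
    refine ⟨f, ?_⟩
    change (X.presheaf.stalkSpecializes _).hom f = f
    rw [TopCat.Presheaf.stalkSpecializes_refl]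
    rfl
  · exact (hX.placeHom_mem_ordGE_iff hπ).mp (hf ⟨x, hX.isClosed_singleton h⟩ hx)

/-- Functions without poles are constant by properness, poles are finite in number because proper
closed subsets are finite, and distinct closed points are separated by a function because the curve
is separated and its local rings are valuation rings. -/
lemma IsCompleteNonsingularCurve.isPlaceSystem : IsPlaceSystem (hX.placeHom hπ) where
  map_algebraMap p c := by
    have := hX.isRegularLocalRing p.1
    refine (AlgHom.commutes (fractionExpansion F X.functionField (hX.not_isField_stalk p.2)
      (hX.residue_surjective p.2) (hπ p)) c).trans ?_
    exact HahnSeries.ofPowerSeries_C c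
  exists_uniformizer p := by
    have := hX.isRegularLocalRing p.1
    refine ⟨algebraMap _ _ (π p), (fractionExpansion_algebraMap ..).trans ?_⟩
    rw [expansion_uniformizer, HahnSeries.ofPowerSeries_X]
  exists_constant f hf := by
    obtain ⟨s, rfl⟩ := hX.exists_germ_eq hπ (U := ⊤) trivial fun p _ => hf p
    exact hX.exists_algebraMap_eq s
  finite_poles f := by
    obtain ⟨U, hU, s, rfl⟩ := X.presheaf.exists_germ_eq f
    have h1 : (U : Set X)ᶜ ≠ Set.univ := fun h => by
      have : genericPoint X ∈ (U : Set X)ᶜ := h ▸ trivial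
      exact this hU
    refine ((hX.finite_of_isClosed U.isOpen.isClosed_compl h1).preimage
      Subtype.val_injective.injOn).subset fun p hp hpU => hp ?_
    rw [hX.placeHom_mem_ordGE_iff hπ]
    refine ⟨X.presheaf.germ U p.1 hpU s, ?_⟩
    exact TopCat.Presheaf.germ_stalkSpecializes_apply X.presheaf hpU
      ((genericPoint_spec X).specializes trivial) s
  exists_pole p q hpq := by
    by_contra! h
    refine hpq (Subtype.ext (hX.eq_of_stalk_le q.2 fun a => ?_))
    exact (hX.placeHom_mem_ordGE_iff hπ).mp (h _ ((hX.placeHom_mem_ordGE_iff hπ).mpr ⟨a, rfl⟩))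

end Curve

/-! ### Functions regular outside a finite set of points -/

section Regular
variable {F K P : Type*} [Field F] [Field K] [Algebra F K] {φ : P → K →+* F⸨X⸩}

/-- The expansions at the places of `S` of the functions whose poles lie in `S`, as a subspace of
`F((t))^S`. -/
noncomputable def IsPlaceSystem.regularExpansions (hφ : IsPlaceSystem φ) (S : Finset P) :
    Submodule F (S → F⸨X⸩) :=
  (hφ.regularOutside S).map (LinearMap.pi fun s : S => hφ.linearMap s.1)

variable (hφ : IsPlaceSystem φ) {S : Finset P}

lemma IsPlaceSystem.mem_regularExpansions {f : K} (hf : f ∈ hφ.regularOutside S) :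
    (fun s : S => φ s.1 f) ∈ hφ.regularExpansions S :=
  ⟨f, hf, rfl⟩

lemma IsPlaceSystem.mul_mem_regularExpansions {a b : S → F⸨X⸩} (ha : a ∈ hφ.regularExpansions S)
    (hb : b ∈ hφ.regularExpansions S) : a * b ∈ hφ.regularExpansions S := by
  obtain ⟨f, hf, rfl⟩ := ha
  obtain ⟨g, hg, rfl⟩ := hb
  refine ⟨f * g, hφ.mul_mem_regularOutside hf hg, ?_⟩
  ext1 s
  exact map_mul (φ s.1) f g

lemma IsPlaceSystem.exists_regularExpansions_sup_eq_top [Infinite F] (hS : S.Nonempty) :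
    ∃ N, hφ.regularExpansions S ⊔ poleLattice F S N = ⊤ := by
  classical
  obtain ⟨N, hN⟩ := hφ.exists_regularOutside_approx hS
  refine ⟨N, eq_top_iff.mpr fun v _ => ?_⟩
  obtain ⟨a, ha, hav⟩ := hN fun p => if h : p ∈ S then v ⟨p, h⟩ else 0
  rw [← add_sub_cancel (fun s : S => φ s.1 a) v]
  refine Submodule.add_mem_sup (hφ.mem_regularExpansions ha) fun s => ?_
  have h := hav s.1 s.2
  rw [dif_pos s.2] at h
  rw [Pi.sub_apply, ← neg_sub]
  exact neg_mem h

lemma IsPlaceSystem.finiteDimensional_regularExpansions_inf (N : ℤ) : FiniteDimensional F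
    (hφ.regularExpansions S ⊓ poleLattice F S N : Submodule F (S → F⸨X⸩)) := by
  have := hφ.finiteDimensional_boundedPoles S N.toNat
  refine Submodule.finiteDimensional_of_le (S₂ := (hφ.boundedPoles S N.toNat).map
    (LinearMap.pi fun s : S => hφ.linearMap s.1)) ?_
  rintro _ ⟨⟨f, hf, rfl⟩, hN⟩
  refine ⟨f, ⟨hf, fun p hp => ?_⟩, rfl⟩
  exact ordGE_mono (by omega) (hN ⟨p, hp⟩)

end Regular

section Curve
open AlgebraicGeometry CategoryTheory TopologicalSpace
variable {F : Type u} [Field F] [IsAlgClosed F] {X : Scheme.{u}} [X.Over (Spec (.of F))]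
  (hX : IsCompleteNonsingularCurve F X) [IsIntegral X] {S : Finset (closedPoints X)}
  {π : ∀ p : closedPoints X, X.presheaf.stalk p.1} (hπ : ∀ p, IsUniformizer (π p))

/-- Sections over `X ∖ S` have no poles outside `S`. -/
lemma IsCompleteNonsingularCurve.toFunctionField_mem_regularOutside (f : Γ(X, complOpens S)) :
    hX.toFunctionField S f ∈ (hX.isPlaceSystem hπ).regularOutside S := by
  intro p hp
  have hpU : p.1 ∈ complOpens S := fun h => by
    obtain ⟨s, hs, hps⟩ := Set.mem_iUnion₂.mp h
    obtain rfl : p = s := Subtype.ext hps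
    exact hp hs
  rw [hX.placeHom_mem_ordGE_iff hπ]
  exact ⟨X.presheaf.germ _ p.1 hpU f, TopCat.Presheaf.germ_stalkSpecializes_apply X.presheaf hpU
    ((genericPoint_spec X).specializes trivial) f⟩

variable (S) {k : Type v} [CommRing k] [Algebra F k]

/-- The expansions of elements of `H⁰(X ∖ S, 𝒪_X) ⊗ k` lie in the extension to `k` of the expansions
of the functions regular outside `S`. -/
lemma IsCompleteNonsingularCurve.laurentExpansionTensor_mem (x : Γ(X, complOpens S) ⊗[F] k) :
    (fun s : S => hX.laurentExpansionTensor S k s.1 (hπ s.1) x) ∈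
      scalarExtSubmodule k ((hX.isPlaceSystem hπ).regularExpansions S) := by
  induction x using TensorProduct.induction_on with
  | zero =>
    simp only [map_zero]
    exact zero_mem _
  | add x y hx hy =>
    simp only [map_add]
    exact add_mem hx hy
  | tmul f c =>
    convert smul_scalarExt_mem (k := k) c ((hX.isPlaceSystem hπ).mem_regularExpansions
      (hX.toFunctionField_mem_regularOutside hπ f)) using 1
    ext1 s
    rw [hX.laurentExpansionTensor_tmul, mul_comm, HahnSeries.C_mul_eq_smul]
    rfl

/-- The reciprocity law, for uniformizers chosen at all closed points of the curve. -/
theorem IsCompleteNonsingularCurve.prod_symbol_eq_one (hS : S.Nonempty) [IsLocalRing k]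
    [IsArtinianRing k] [Module.Finite F k] (f g : (Γ(X, complOpens S) ⊗[F] k)ˣ) :
    ∏ s : S, symbol
      (Units.map (hX.laurentExpansionTensor S k s.1 (hπ s.1)).toMonoidHom f)
      (Units.map (hX.laurentExpansionTensor S k s.1 (hπ s.1)).toMonoidHom g) = 1 := by
  have hφ := hX.isPlaceSystem hπ
  let Φ : Γ(X, complOpens S) ⊗[F] k →+* (S → k⸨X⸩) :=
    RingHom.pi fun s => hX.laurentExpansionTensor S k s.1 (hπ s.1)
  exact ContouCarrere.prod_symbol_eq_one (F := F) (A := hφ.regularExpansions S)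
    (f := Units.map Φ.toMonoidHom f) (g := Units.map Φ.toMonoidHom g)
    (fun _ ha _ hb => hφ.mul_mem_regularExpansions ha hb)
    (hφ.exists_regularExpansions_sup_eq_top hS) hφ.finiteDimensional_regularExpansions_inf
    (hX.laurentExpansionTensor_mem S hπ f.val) (hX.laurentExpansionTensor_mem S hπ f.inv)
    (hX.laurentExpansionTensor_mem S hπ g.val) (hX.laurentExpansionTensor_mem S hπ g.inv)

end Curve

end ContouCarrere

theorem mainTheorem2 {F : Type u} [Field F] [IsAlgClosed F]
    (X : Scheme.{u}) [X.Over (Spec (.of F))] (hX : IsCompleteNonsingularCurve F X)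
    (S : Finset (closedPoints X)) (hS : S.Nonempty)
    (π : ∀ s : S, X.presheaf.stalk s.1.1) (hπ : ∀ s, IsUniformizer (π s))
    (k : Type v) [CommRing k] [IsLocalRing k] [IsArtinianRing k] [Algebra F k] [Module.Finite F k]
    (f g : (Γ(X, complOpens S) ⊗[F] k)ˣ) :
    ∏ s : S, symbol
      (Units.map (hX.laurentExpansionTensor S k s.1 (hπ s)).toMonoidHom f)
      (Units.map (hX.laurentExpansionTensor S k s.1 (hπ s)).toMonoidHom g) = 1 := by
  classical
  have := hX.isIntegral
  -- extend the choice of uniformizers to all closed points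
  obtain ⟨σ, hσ, rfl⟩ : ∃ σ : ∀ p : closedPoints X, X.presheaf.stalk p.1,
      (∀ p, IsUniformizer (σ p)) ∧ (fun s : S => σ s.1) = π := by
    choose ϖ hϖ using fun p : closedPoints X => hX.exists_isUniformizer p.1
    refine ⟨fun p => if h : p ∈ S then π ⟨p, h⟩ else ϖ p, fun p => ?_, ?_⟩
    · dsimp only
      split_ifs with h
      exacts [hπ ⟨p, h⟩, hϖ p]
    · ext1 s
      exact dif_pos s.2
  exact hX.prod_symbol_eq_one S hσ hS f g
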